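/- **Setting.** Fix $n\ge 1$, $m\ge 0$ and pairwise distinct complex numbers $p_1,\dots,p_{n+1},q_1,\dots,q_m$. In the blow-up of $0\in\mathbb C^2$ use the chart $(x,u)$, $u=y/x$, and let $\mathcal L$ (given by $x=0$) be the exceptional divisor; $\tilde{\mathcal F}$ denotes the blow-up of a foliation $\mathcal F$. Foliations are given by germs of holomorphic vector fields with an isolated singularity at $0$. * $\mathcal N_{\mathsf p}(\mathbf h)$: non dicritical foliations given by a field $v=(P,Q)$ of order $n$ with $xQ_n-yP_n=c\prod_i(y-p_ix)$, $c\ne0$, whose hidden holonomy (the holonomy of the leaf $\mathcal L\smallsetminus\{p_i\}$ of the blow-up) is conjugate to $\mathbf h$ by one germ tangent to the identity. * $\mathcal D_{\mathsf q}(\mathcal I)$, $\mathcal I=(I_1,\dots,I_m)$: dicritical foliations given by a field of order $m+1$ with principal part $c\prod_j(y-q_jx)\cdot(x,y)$, $c\neq0$, whose blow-up is regular at the (simple) tangency points $(0,q_j)$; $I_j$ is the holomorphic involution at $q_j$ ($I_j(q_j)=q_j$, $I_j'(q_j)=-1$) exchanging the two intersection points of a leaf with $\mathcal L$. Put $g_j(u)=(q_j-u)(I_j(u)-q_j)$.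 Let $(\mathcal F,\mathcal G)\in\mathcal N_{\mathsf p}(\mathbf h)\times\mathcal D_{\mathsf q}(\mathcal I)$, let $\mathcal F_\mu\in\mathcal N_{\mathsf p}(\mathbf h)$ have exactly the lines $y=p_ix$ as separatrices, let $\lambda_i$ be the Camacho–Sad index of $\tilde{\mathcal F}_\mu$ at $(0,p_i)$ relative to $\mathcal L$, and let $\mathcal G_{\mathbf r}$ be the radial foliation. *Local models and normalizing transformations* of $(\mathcal F,\mathcal G)$ with respect to $(\mathcal F_\mu,\mathcal G_{\mathbf r})$ consist of the following. * Germs of holomorphic functions $s_i(x)=\sum_{r\ge1}s_{i,r}x^r$, $z_j(x)=\sum_{r\ge1}z_{j,r}x^r$ with $z_{j,1}\ne0$. * A biholomorphism $\mathbf H_{\mathbf n}$ between neighbourhoods of $\mathcal L\smallsetminus\{p_i,q_j\}$ (including $u=\infty$) in the blow-up, $\mathbf H_{\mathbf n}(x,u)=(x+O(x^2),u+O(x))$, taking $(\tilde{\mathcal F}_\mu,\tilde{\mathcal G}_{\mathbf r})$ to $(\tilde{\mathcal F},\tilde{\mathcal G})$; germs of biholomorphisms $H_{p_i}$ at $(0,p_i)$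 and $H_{q_j}$ at $(0,q_j)$, equal to the identity on $x=0$, such that $H_{p_i}$ takes the foliations of $\lambda_ix\partial_x+(u-p_i)\partial_u$ and $u+s_i(x)=\mathrm{cst}$ to $(\tilde{\mathcal F},\tilde{\mathcal G})$, and $H_{q_j}$ takes $x=\mathrm{cst}$ and $z_j(x)+g_j(u)=\mathrm{cst}$ to $(\tilde{\mathcal F},\tilde{\mathcal G})$. * The factorizations $H_{p_i}=\mathbf H_{\mathbf n}\circ\xi_i\circ\Psi_i$, $H_{q_j}=\mathbf H_{\mathbf n}\circ\zeta_j\circ\Phi_j$ hold near punctured discs around $p_i$, $q_j$ in $\mathcal L$. Here $\Psi_i=\bigl(x(1+\tfrac{s_i(x)}{u-p_i})^{\lambda_i},u+s_i(x)\bigr)$; $\Phi_j=(x,\phi_j)$ with $g_j(\phi_j(x,u))=g_j(u)+z_j(x)$, $\phi_j(0,u)=u$; $\xi_i=(\varepsilon_i,u)$, $\varepsilon_i=\sum_{k\ge1}\varepsilon_{i,k}(u)x^k$, holomorphic at $(0,p_i)$, takes the foliation of $\lambda_ix\partial_x+(u-p_i)\partial_u$ to $\tilde{\mathcal F}_\mu$,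 with $\varepsilon_{i,1}(p_i)=1$; $\zeta_j=(\varsigma_j,u)$, $\varsigma_j=\sum_{k\ge1}\varsigma_{j,k}(u)x^k$, holomorphic at $(0,q_j)$, takes $x=\mathrm{cst}$ to $\tilde{\mathcal F}_\mu$, with $\varsigma_{j,1}(q_j)=1$ and $\varsigma_{j,k}(q_j)=0$ for $k\ge2$. **Normal form.** Write $[x^k]$ for the coefficient of $x^k$, and $(\cdot)_{\mathcal P,a}$ for the principal part at $a$. Define $a_{\mathbf n,1}=1$, $a_{p_i,1}=\varepsilon_{i,1}$, $a_{q_j,1}=\varsigma_{j,1}$, $b_{\mathbf n,1}=-\sum_j\bigl(\tfrac{z_{j,1}}{\varsigma_{j,1}g_j'}\bigr)_{\mathcal P,q_j}$, $b_{p_i,1}=s_{i,1}+\varepsilon_{i,1}b_{\mathbf n,1}$, $b_{q_j,1}=\tfrac{z_{j,1}}{g_j'}+\varsigma_{j,1}b_{\mathbf n,1}$. For $k\ge2$, with $A=\sum_{r<k}a_{\mathbf n,r}(u)x^r$ and $B=u+\sum_{r<k}b_{\mathbf n,r}(u)x^r$, put $$\mathbf A_{p_i}=[x^k](A\circ\xi_i\circ\Psi_i)-\varepsilon_{i,k},\qquad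 \mathbf A_{q_j}=[x^k](A\circ\zeta_j\circ\Phi_j)-\varsigma_{j,k},$$ $$\mathbf B_{p_i}=[x^k](B\circ\xi_i\circ\Psi_i)-s_{i,k}-\varepsilon_{i,k}b_{\mathbf n,1},\qquad \mathbf B_{q_j}=[x^k](B\circ\zeta_j\circ\Phi_j)-\tfrac{z_{j,k}}{g_j'}-\varsigma_{j,k}b_{\mathbf n,1},$$ $$a_{\mathbf n,k}=-\sum_i\Bigl(\tfrac{\mathbf A_{p_i}}{\varepsilon_{i,1}^k}\Bigr)_{\mathcal P,p_i}-\sum_j\Bigl(\tfrac{\mathbf A_{q_j}}{\varsigma_{j,1}^k}\Bigr)_{\mathcal P,q_j},\qquad b_{\mathbf n,k}=-\sum_i\Bigl(\tfrac{\mathbf B_{p_i}}{\varepsilon_{i,1}^k}\Bigr)_{\mathcal P,p_i}-\sum_j\Bigl(\tfrac{z_{j,k}}{\varsigma_{j,1}^kg_j'}+\tfrac{\mathbf B_{q_j}}{\varsigma_{j,1}^k}\Bigr)_{\mathcal P,q_j},$$ $$a_{p_i,k}=\varepsilon_{i,k}+\mathbf A_{p_i}+\varepsilon_{i,1}^ka_{\mathbf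 n,k},\qquad a_{q_j,k}=\varsigma_{j,k}+\mathbf A_{q_j}+\varsigma_{j,1}^ka_{\mathbf n,k},$$ $$b_{p_i,k}=s_{i,k}+\varepsilon_{i,k}b_{\mathbf n,1}+\mathbf B_{p_i}+\varepsilon_{i,1}^kb_{\mathbf n,k},\qquad b_{q_j,k}=\tfrac{z_{j,k}}{g_j'}+\varsigma_{j,k}b_{\mathbf n,1}+\mathbf B_{q_j}+\varsigma_{j,1}^kb_{\mathbf n,k}.$$ The normalizing transformations are in *$k_0$-normal form* if, for each of $\cdot=\mathbf n,p_i,q_j$, the corresponding transformation is $\bigl(\sum_{k\le k_0}a_{\cdot,k}x^k+O(x^{k_0+1}),\,u+\sum_{k\le k_0}b_{\cdot,k}x^k+O(x^{k_0+1})\bigr)$. **Theorem.** There are functional transformations $\boldsymbol\pi_{p_i,k}$, $\boldsymbol\pi_{q_j,k}$ ($k\ge1$), depending only on $\mathsf p$, $\mathsf q$, with $\boldsymbol\pi_{p_i,1}=0$ and $\boldsymbol\pi_{q_j,1}=0$, such that the following holds whenever the local models and normalizing transformations of $(\mathcal F,\mathcal G)$ as above are in $k_0$-normal form. Near $(0,p_i)$,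 respectively $(0,q_j)$, the curve of tangencies of $(\tilde{\mathcal F},\tilde{\mathcal G})$ is the graph $u=\pi_{p_i}(x)$, respectively $u=\pi_{q_j}(x)$, of a holomorphic germ $\pi_{p_i}=p_i+\sum_{r\ge1}\mathbf c_{p_i,r}x^r$, respectively $\pi_{q_j}=q_j+\sum_{r\ge1}\mathbf c_{q_j,r}x^r$, and for $1\le k\le k_0$ $$\mathbf c_{p_i,k}=(1-k\lambda_i)s_{i,k}-\sum_{j=1}^m\frac{z_{j,k}}{2(p_i-q_j)}+\boldsymbol\pi_{p_i,k}(p_i),$$ $$\mathbf c_{q_j,k}=-\frac{z_{j,k}}2\Bigl(k\,\varsigma_{j,1}'(q_j)+\frac{g_j'''(q_j)}4\Bigr)-\sum_{l\ne j}\frac{z_{l,k}}{2(q_j-q_l)}+\boldsymbol\pi_{q_j,k}(q_j).$$ Here $\boldsymbol\pi_{p_i,k}$, respectively $\boldsymbol\pi_{q_j,k}$, is a function holomorphic at $p_i$, respectively $q_j$, obtained by evaluating the functional transformation at the germ $\varepsilon_{i,k}$ at $p_i$, respectively $\varsigma_{j,k}$ at $q_j$, and at the data of order at most $k-1$: the numbers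 $\lambda_\imath,s_{\imath,r},z_{\jmath,r}$ and the germs $g_\jmath$ and $\varsigma_{\jmath,r}$ at $q_\jmath$ and $\varepsilon_{\imath,r}$ at $p_\imath$, for all $\imath,\jmath$ and $1\le r\le k-1$. -/

import Mathlib

open Filter Topology Set
open scoped Nat

noncomputable section

namespace TangencyCurves

/-! ### Taylor coefficients, homogeneous parts, principal parts -/

/-- The coefficient of `(t - c)^k` in the Taylor expansion of `f` at `c`. -/
def taylorCoeff (k : ℕ) (f : ℂ → ℂ) (c : ℂ) : ℂ :=
  iteratedDeriv k f c / (k ! : ℂ)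

/-- The coefficient `F_k(u)` of `x^k` in the expansion `F (x, u) = ∑ F_k(u) x^k` along `x = 0`. -/
def coeffX (k : ℕ) (F : ℂ × ℂ → ℂ) (u : ℂ) : ℂ :=
  taylorCoeff k (fun x => F (x, u)) 0

/-- The value at `a` of the homogeneous part of degree `d` of the Taylor expansion of `f` at the
origin: the coefficient of `t^d` in `t ↦ f (t a)`. -/
def homPart (d : ℕ) (f : ℂ × ℂ → ℂ) (a : ℂ × ℂ) : ℂ :=
  taylorCoeff d (fun t => f (t • a)) 0

/-- `P` (a polynomial in `(u - a)⁻¹` without constant term) is the principal part at `a` of the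
function `f`, meromorphic at `a`: the difference extends holomorphically to `a`. -/
def IsPrincipalPart (f : ℂ → ℂ) (a : ℂ) (P : Polynomial ℂ) : Prop :=
  P.coeff 0 = 0 ∧ ∃ r : ℂ → ℂ, AnalyticAt ℂ r a ∧
    ∀ᶠ u in 𝓝[≠] a, f u = P.eval (u - a)⁻¹ + r u

open Classical in
/-- The principal part of `f` at `a`, as a function on `ℂ` (holomorphic off `a`). -/
def principalPart (f : ℂ → ℂ) (a : ℂ) : ℂ → ℂ :=
  if h : ∃ P, IsPrincipalPart f a P then fun u => h.choose.eval (u - a)⁻¹ else 0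

/-! ### Vector fields, blow-up, foliations -/

/-- The lift to the chart `(x, u)`, `u = y / x`, of a vector field `v = (P, Q)` at the origin,
multiplied by `x^(-e)`. Off the divisor `x = 0` this is
`x^(-e) (P (x, xu), (Q (x, xu) - u P (x, xu)) / x)`; on the divisor it is the coefficient of `x^0`
of these expressions (`e = ν - 1` for a non dicritical and `e = ν` for a dicritical field of
order `ν` gives the blow-up). -/
def blowUp (e : ℕ) (v : ℂ × ℂ → ℂ × ℂ) (z : ℂ × ℂ) : ℂ × ℂ :=
  open Classical in
  if z.1 = 0 then
    (homPart e (fun a => (v a).1) (1, z.2),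
      homPart (e + 1) (fun a => (v a).2) (1, z.2)
        - z.2 * homPart (e + 1) (fun a => (v a).1) (1, z.2))
  else
    ((v (z.1, z.1 * z.2)).1 / z.1 ^ e,
      ((v (z.1, z.1 * z.2)).2 - z.2 * (v (z.1, z.1 * z.2)).1) / z.1 ^ (e + 1))

/-- The radial vector field `x ∂/∂x + y ∂/∂y`. -/
def radial : ℂ × ℂ → ℂ × ℂ := fun z => z

/-- The points where the foliations defined by the fields `V` and `W` are tangent
(or one of the fields is singular). -/
def tangencyLocus (V W : ℂ × ℂ → ℂ × ℂ) : Set (ℂ × ℂ) :=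
  {z | (V z).1 * (W z).2 - (V z).2 * (W z).1 = 0}

/-- Near the set `K`, the map `H` takes the foliation defined by the field `X` to the one defined
by the field `Y`: `DH · X = f · (Y ∘ H)` with a non-vanishing holomorphic factor `f`. -/
def MapsFoliation (H X Y : ℂ × ℂ → ℂ × ℂ) (K : Set (ℂ × ℂ)) : Prop :=
  ∃ f : ℂ × ℂ → ℂ, AnalyticOnNhd ℂ f K ∧ (∀ z ∈ K, f z ≠ 0) ∧
    ∀ᶠ z in 𝓝ˢ K, fderiv ℂ H z (X z) = f z • Y (H z)

/-- `H` is a germ of biholomorphism at `z`. -/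
def IsLocalBiholomorphism (H : ℂ × ℂ → ℂ × ℂ) (z : ℂ × ℂ) : Prop :=
  AnalyticAt ℂ H z ∧ (fderiv ℂ H z).IsInvertible

/-- `v` defines a germ of holomorphic foliation at the origin, singular at most there, and all
homogeneous parts of `v` of degree `< d` vanish. -/
structure IsFoliationGerm (d : ℕ) (v : ℂ × ℂ → ℂ × ℂ) : Prop where
  analytic : AnalyticAt ℂ v 0
  singular : v 0 = 0
  isolated : ∀ᶠ z in 𝓝[≠] (0 : ℂ × ℂ), v z ≠ 0
  order_le : ∀ k < d, ∀ a,
    homPart k (fun z => (v z).1) a = 0 ∧ homPart k (fun z => (v z).2) a = 0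

/-! ### The class of non dicritical foliations with given hidden holonomy -/

/-- A (parametrized) loop in `ℂ ∖ {p_i}` based at `u₀`. -/
def IsLoopAt {ι : Type} (p : ι → ℂ) (u₀ : ℂ) (γ : ℝ → ℂ) : Prop :=
  ContDiff ℝ 1 γ ∧ γ 0 = u₀ ∧ γ 1 = u₀ ∧ ∀ t ∈ Icc (0 : ℝ) 1, ∀ i, γ t ≠ p i

/-- `f` is (as a germ at `0`) the holonomy of the foliation defined by `V` along the path `γ` in
the leaf `x = 0`, on the transversals `u = cst`: points `x₀` near `0` are transported along the
leaves over `γ`. -/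
def IsHolonomy (V : ℂ × ℂ → ℂ × ℂ) (γ : ℝ → ℂ) (f : ℂ → ℂ) : Prop :=
  ∀ δ > 0, ∀ᶠ x₀ in 𝓝 (0 : ℂ), ∃ x : ℝ → ℂ, x 0 = x₀ ∧ x 1 = f x₀ ∧
    ∀ t ∈ Icc (0 : ℝ) 1, ‖x t‖ < δ ∧
      HasDerivWithinAt x (deriv γ t * (V (x t, γ t)).1 / (V (x t, γ t)).2) (Icc 0 1) t

/-- `v` defines a foliation of the class `N_p(h)`: it is non dicritical of order `n`, the singular
points of its blow-up on the exceptional divisor are the `n + 1` simple points `(0, p_i)`, and its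
hidden (projective) holonomy is strictly analytically equivalent to `h`, i.e. conjugate to `h` by
one germ tangent to the identity. -/
structure MemN {n : ℕ} (p : Fin (n + 1) → ℂ) (u₀ : ℂ) (h : (ℝ → ℂ) → ℂ → ℂ)
    (v : ℂ × ℂ → ℂ × ℂ) : Prop where
  germ : IsFoliationGerm n v
  nondicritical : ∃ c : ℂ, c ≠ 0 ∧ ∀ a : ℂ × ℂ,
    a.1 * homPart n (fun z => (v z).2) a - a.2 * homPart n (fun z => (v z).1) a
      = c * ∏ i, (a.2 - p i * a.1)
  base : ∀ i, u₀ ≠ p i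
  holonomy : ∃ τ : ℂ → ℂ, AnalyticAt ℂ τ 0 ∧ τ 0 = 0 ∧ deriv τ 0 = 1 ∧
    ∀ γ, IsLoopAt p u₀ γ → ∃ f : ℂ → ℂ, IsHolonomy (blowUp (n - 1) v) γ f ∧
      ∀ᶠ x in 𝓝 (0 : ℂ), f (τ x) = τ (h γ x)

/-- The separatrices of the foliation defined by `v` are exactly the lines `y = p_i x`. -/
def HasStraightSeparatrices {ι : Type} (p : ι → ℂ) (v : ℂ × ℂ → ℂ × ℂ) : Prop :=
  (∀ i, ∀ᶠ x in 𝓝 (0 : ℂ), (v (x, p i * x)).2 = p i * (v (x, p i * x)).1) ∧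
  ∀ γ : ℂ → ℂ × ℂ, AnalyticAt ℂ γ 0 → γ 0 = 0 → ¬ (∀ᶠ t in 𝓝 (0 : ℂ), γ t = 0) →
    (∀ᶠ t in 𝓝 (0 : ℂ), (v (γ t)).1 * (deriv γ t).2 - (v (γ t)).2 * (deriv γ t).1 = 0) →
    ∃ i, ∀ᶠ t in 𝓝 (0 : ℂ), (γ t).2 = p i * (γ t).1

/-- The Camacho-Sad index at `(0, c)`, relative to `x = 0`, of the foliation defined by a field
`V` tangent to `x = 0` whose second component has a simple zero at `c` on `x = 0`. -/
def camachoSad (V : ℂ × ℂ → ℂ × ℂ) (c : ℂ) : ℂ :=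
  deriv (fun x => (V (x, c)).1) 0 / deriv (fun u => (V (0, u)).2) c

/-! ### The class of dicritical foliations with given involutions -/

/-- `w` defines a foliation of the class `D_q(I)`: it is dicritical of order `m + 1`, the points
of tangency of its blow-up with the exceptional divisor are the simple tangencies `(0, q_j)`, and
near `(0, q_j)` the involution `I_j` exchanges the two points of intersection of a leaf with the
divisor (`f` is a local first integral). -/
structure MemD {m : ℕ} (q : Fin m → ℂ) (I : Fin m → ℂ → ℂ)
    (w : ℂ × ℂ → ℂ × ℂ) : Prop where
  germ : IsFoliationGerm (m + 1) w
  dicritical : ∃ c : ℂ, c ≠ 0 ∧ ∀ a : ℂ × ℂ,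
    homPart (m + 1) (fun z => (w z).1) a = a.1 * (c * ∏ j, (a.2 - q j * a.1)) ∧
    homPart (m + 1) (fun z => (w z).2) a = a.2 * (c * ∏ j, (a.2 - q j * a.1))
  regular : ∀ j, blowUp (m + 1) w (0, q j) ≠ 0
  invol_analytic : ∀ j, AnalyticAt ℂ (I j) (q j)
  invol_fix : ∀ j, I j (q j) = q j
  invol_deriv : ∀ j, deriv (I j) (q j) = -1
  invol_invol : ∀ j, ∀ᶠ u in 𝓝 (q j), I j (I j u) = u
  invol_leaf : ∀ j, ∃ f : ℂ × ℂ → ℂ, AnalyticAt ℂ f (0, q j) ∧ fderiv ℂ f (0, q j) ≠ 0 ∧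
    (∀ᶠ z in 𝓝 ((0 : ℂ), q j), fderiv ℂ f z (blowUp (m + 1) w z) = 0) ∧
    ∀ᶠ u in 𝓝 (q j), f (0, I j u) = f (0, u)

/-! ### Local models, normalizing transformations, factorization equations -/

/-- The objects entering local models and normalizing transformations: `lam i = λ_i`, `s i`,
`z j`, the involutions `I j`, the maps `H_n`, `H_{p_i}`, `H_{q_j}`, the first components
`eps i = ε_i` of `ξ_i = (ε_i, u)` and `sig j = ς_j` of `ζ_j = (ς_j, u)`, and the second components
`phi j` of `Φ_j = (x, φ_j)`. The conditions on them are in `IsNormalizing`. -/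
structure NormalizingData (n m : ℕ) where
  lam : Fin (n + 1) → ℂ
  s : Fin (n + 1) → ℂ → ℂ
  z : Fin m → ℂ → ℂ
  I : Fin m → ℂ → ℂ
  Hn : ℂ × ℂ → ℂ × ℂ
  Hp : Fin (n + 1) → ℂ × ℂ → ℂ × ℂ
  Hq : Fin m → ℂ × ℂ → ℂ × ℂ
  eps : Fin (n + 1) → ℂ × ℂ → ℂ
  sig : Fin m → ℂ × ℂ → ℂ
  phi : Fin m → ℂ × ℂ → ℂ

namespace NormalizingData

variable {n m : ℕ} (D : NormalizingData n m) (p : Fin (n + 1) → ℂ) (q : Fin m → ℂ)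

/-- `g_j(u) = (q_j - u) (I_j(u) - q_j)`. -/
def g (j : Fin m) (u : ℂ) : ℂ := (q j - u) * (D.I j u - q j)

/-- `Ψ_i = (x (1 + s_i(x) / (u - p_i))^{λ_i}, u + s_i(x))`. -/
def Psi (i : Fin (n + 1)) (z : ℂ × ℂ) : ℂ × ℂ :=
  (z.1 * (1 + D.s i z.1 / (z.2 - p i)) ^ D.lam i, z.2 + D.s i z.1)

/-- `ξ_i = (ε_i, u)`. -/
def xi (i : Fin (n + 1)) (z : ℂ × ℂ) : ℂ × ℂ := (D.eps i z, z.2)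

/-- `Φ_j = (x, φ_j)`. -/
def Phi (j : Fin m) (z : ℂ × ℂ) : ℂ × ℂ := (z.1, D.phi j z)

/-- `ζ_j = (ς_j, u)`. -/
def zeta (j : Fin m) (z : ℂ × ℂ) : ℂ × ℂ := (D.sig j z, z.2)

/-- The linear field `λ_i x ∂/∂x + (u - p_i) ∂/∂u`. -/
def linField (i : Fin (n + 1)) (z : ℂ × ℂ) : ℂ × ℂ := (D.lam i * z.1, z.2 - p i)

/-- A field defining the foliation `u + s_i(x) = cst`. -/
def modelGp (i : Fin (n + 1)) (z : ℂ × ℂ) : ℂ × ℂ := (1, -deriv (D.s i) z.1)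

/-- A field defining the foliation `z_j(x) + g_j(u) = cst`. -/
def modelGq (j : Fin m) (z : ℂ × ℂ) : ℂ × ℂ := (deriv (D.g q j) z.2, -deriv (D.z j) z.1)

/-- The exceptional divisor without the points `p_i`, `q_j`, in the chart `(x, u)`. -/
def puncturedDivisor : Set (ℂ × ℂ) := {z | z.1 = 0 ∧ (∀ i, z.2 ≠ p i) ∧ ∀ j, z.2 ≠ q j}

/-- `D` consists of local models and normalizing transformations, with respect to the pair
(`Fμ`, radial foliation), of the pair of foliations defined by the fields `F`, `G`. -/
structure IsNormalizing (F G Fμ : ℂ × ℂ → ℂ × ℂ) : Prop where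
  lam_eq : ∀ i, D.lam i = camachoSad (blowUp (n - 1) Fμ) (p i)
  s_analytic : ∀ i, AnalyticAt ℂ (D.s i) 0
  s_zero : ∀ i, D.s i 0 = 0
  z_analytic : ∀ j, AnalyticAt ℂ (D.z j) 0
  z_zero : ∀ j, D.z j 0 = 0
  z_deriv : ∀ j, deriv (D.z j) 0 ≠ 0
  /-- `H_n` is a biholomorphism between neighbourhoods of the punctured divisor,
  `H_n (x, u) = (x + O(x^2), u + O(x))`. -/
  Hn_biholomorphism : ∃ U : Set (ℂ × ℂ), IsOpen U ∧ puncturedDivisor p q ⊆ U ∧ InjOn D.Hn U ∧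
    ∀ z ∈ U, IsLocalBiholomorphism D.Hn z
  Hn_divisor : ∀ z ∈ puncturedDivisor p q, D.Hn z = z
  Hn_tangent : ∀ z ∈ puncturedDivisor p q, coeffX 1 (fun y => (D.Hn y).1) z.2 = 1
  /-- In the chart `(1 / u, x u)`, `H_n` extends to a biholomorphism at the point `u = ∞` of the
  divisor. -/
  Hn_infinity : ∃ K : ℂ × ℂ → ℂ × ℂ, IsLocalBiholomorphism K 0 ∧ K 0 = 0 ∧
    ∀ᶠ y in 𝓝 (0 : ℂ × ℂ), y.1 ≠ 0 → (K y).1 ≠ 0 →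
      K y = ((D.Hn (y.1 * y.2, y.1⁻¹)).2⁻¹,
        (D.Hn (y.1 * y.2, y.1⁻¹)).1 * (D.Hn (y.1 * y.2, y.1⁻¹)).2)
  Hn_F : MapsFoliation D.Hn (blowUp (n - 1) Fμ) (blowUp (n - 1) F) (puncturedDivisor p q)
  Hn_G : MapsFoliation D.Hn (blowUp 1 radial) (blowUp (m + 1) G) (puncturedDivisor p q)
  Hp_biholomorphism : ∀ i, IsLocalBiholomorphism (D.Hp i) (0, p i)
  Hp_divisor : ∀ i, ∀ᶠ u in 𝓝 (p i), D.Hp i (0, u) = (0, u)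
  Hp_F : ∀ i, MapsFoliation (D.Hp i) (D.linField p i) (blowUp (n - 1) F) {(0, p i)}
  Hp_G : ∀ i, MapsFoliation (D.Hp i) (D.modelGp i) (blowUp (m + 1) G) {(0, p i)}
  Hq_biholomorphism : ∀ j, IsLocalBiholomorphism (D.Hq j) (0, q j)
  Hq_divisor : ∀ j, ∀ᶠ u in 𝓝 (q j), D.Hq j (0, u) = (0, u)
  Hq_F : ∀ j, MapsFoliation (D.Hq j) (fun _ => (0, 1)) (blowUp (n - 1) F) {(0, q j)}
  Hq_G : ∀ j, MapsFoliation (D.Hq j) (D.modelGq q j) (blowUp (m + 1) G) {(0, q j)}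
  /-- `ξ_i` takes the linear foliation to the blow-up of `Fμ`, and is normalized. -/
  eps_analytic : ∀ i, AnalyticAt ℂ (D.eps i) (0, p i)
  eps_divisor : ∀ i, ∀ᶠ u in 𝓝 (p i), D.eps i (0, u) = 0
  eps_one : ∀ i, coeffX 1 (D.eps i) (p i) = 1
  eps_F : ∀ i, MapsFoliation (D.xi i) (D.linField p i) (blowUp (n - 1) Fμ) {(0, p i)}
  /-- `ζ_j` takes the foliation `x = cst` to the blow-up of `Fμ`, and is normalized. -/
  sig_analytic : ∀ j, AnalyticAt ℂ (D.sig j) (0, q j)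
  sig_divisor : ∀ j, ∀ᶠ u in 𝓝 (q j), D.sig j (0, u) = 0
  sig_one : ∀ j, coeffX 1 (D.sig j) (q j) = 1
  sig_higher : ∀ j, ∀ k, 2 ≤ k → coeffX k (D.sig j) (q j) = 0
  sig_F : ∀ j, MapsFoliation (D.zeta j) (fun _ => (0, 1)) (blowUp (n - 1) Fμ) {(0, q j)}
  /-- `g_j (φ_j (x, u)) = g_j (u) + z_j (x)` and `φ_j (0, u) = u`, near the punctured disc. -/
  phi_spec : ∀ j, ∀ᶠ u in 𝓝[≠] (q j), AnalyticAt ℂ (D.phi j) (0, u) ∧ D.phi j (0, u) = u ∧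
    ∀ᶠ y in 𝓝 ((0 : ℂ), u), D.g q j (D.phi j y) = D.g q j y.2 + D.z j y.1
  /-- The factorization equations, near the punctured discs. -/
  factor_p : ∀ i, ∀ᶠ u in 𝓝[≠] (p i), ∀ᶠ y in 𝓝 ((0 : ℂ), u),
    D.Hp i y = D.Hn (D.xi i (D.Psi p i y))
  factor_q : ∀ j, ∀ᶠ u in 𝓝[≠] (q j), ∀ᶠ y in 𝓝 ((0 : ℂ), u),
    D.Hq j y = D.Hn (D.zeta j (D.Phi j y))

/-! ### The canonical solutions and the normal form -/

/-- The term `𝐀_{p_i,k}`: what remains of the coefficient of `x^k` in `A ∘ ξ_i ∘ Ψ_i` after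
removing `ε_{i,k}`, where `A` is the sum of the terms of order `< k` of the first component. -/
def resAp (k : ℕ) (A : ℂ × ℂ → ℂ) (i : Fin (n + 1)) (u : ℂ) : ℂ :=
  coeffX k (fun y => A (D.xi i (D.Psi p i y))) u - coeffX k (D.eps i) u

/-- The term `𝐀_{q_j,k}`. -/
def resAq (k : ℕ) (A : ℂ × ℂ → ℂ) (j : Fin m) (u : ℂ) : ℂ :=
  coeffX k (fun y => A (D.zeta j (D.Phi j y))) u - coeffX k (D.sig j) u

/-- `a_{n,k}` for `k ≥ 2`, in terms of the sum `A` of the terms of order `< k`. -/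
def nextA (k : ℕ) (A : ℂ × ℂ → ℂ) (u : ℂ) : ℂ :=
  - (∑ i, principalPart (fun t => D.resAp p k A i t / coeffX 1 (D.eps i) t ^ k) (p i) u)
  - ∑ j, principalPart (fun t => D.resAq k A j t / coeffX 1 (D.sig j) t ^ k) (q j) u

/-- `truncA k = ∑_{r=1}^k a_{n,r}(u) x^r`. -/
def truncA : ℕ → ℂ × ℂ → ℂ
  | 0 => fun _ => 0
  | 1 => fun y => y.1
  | k + 2 => fun y => truncA (k + 1) y + D.nextA p q (k + 2) (truncA (k + 1)) y.2 * y.1 ^ (k + 2)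

/-- `a_{n,k}` (`a_{n,1} = 1`). -/
def aN : ℕ → ℂ → ℂ
  | 0 => fun _ => 0
  | 1 => fun _ => 1
  | k + 2 => D.nextA p q (k + 2) (D.truncA p q (k + 1))

/-- `a_{p_i,k}` (`a_{p_i,1} = ε_{i,1}`). -/
def aP (k : ℕ) (i : Fin (n + 1)) (u : ℂ) : ℂ :=
  if k = 1 then coeffX 1 (D.eps i) u
  else coeffX k (D.eps i) u + D.resAp p k (D.truncA p q (k - 1)) i u
    + coeffX 1 (D.eps i) u ^ k * D.aN p q k u

/-- `a_{q_j,k}` (`a_{q_j,1} = ς_{j,1}`). -/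
def aQ (k : ℕ) (j : Fin m) (u : ℂ) : ℂ :=
  if k = 1 then coeffX 1 (D.sig j) u
  else coeffX k (D.sig j) u + D.resAq k (D.truncA p q (k - 1)) j u
    + coeffX 1 (D.sig j) u ^ k * D.aN p q k u

/-- `b_{n,1}`. -/
def bOne (u : ℂ) : ℂ :=
  - ∑ j, principalPart
      (fun t => taylorCoeff 1 (D.z j) 0 / (coeffX 1 (D.sig j) t * deriv (D.g q j) t)) (q j) u

/-- The term `𝐁_{p_i,k}`, `k ≥ 2`: what remains of the coefficient of `x^k` in `B ∘ ξ_i ∘ Ψ_i`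
after removing `s_{i,k}` and `ε_{i,k} b_{n,1}`, where `B` is the sum of the terms of order `< k` of
the second component. -/
def resBp (k : ℕ) (B : ℂ × ℂ → ℂ) (i : Fin (n + 1)) (u : ℂ) : ℂ :=
  coeffX k (fun y => B (D.xi i (D.Psi p i y))) u - taylorCoeff k (D.s i) 0
    - coeffX k (D.eps i) u * D.bOne q u

/-- The term `𝐁_{q_j,k}`, `k ≥ 2`. -/
def resBq (k : ℕ) (B : ℂ × ℂ → ℂ) (j : Fin m) (u : ℂ) : ℂ :=
  coeffX k (fun y => B (D.zeta j (D.Phi j y))) u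
    - taylorCoeff k (D.z j) 0 / deriv (D.g q j) u - coeffX k (D.sig j) u * D.bOne q u

/-- `b_{n,k}` for `k ≥ 2`, in terms of the sum `B` of the terms of order `< k`. -/
def nextB (k : ℕ) (B : ℂ × ℂ → ℂ) (u : ℂ) : ℂ :=
  - (∑ i, principalPart (fun t => D.resBp p q k B i t / coeffX 1 (D.eps i) t ^ k) (p i) u)
  - ∑ j, principalPart
      (fun t => taylorCoeff k (D.z j) 0 / (coeffX 1 (D.sig j) t ^ k * deriv (D.g q j) t)
        + D.resBq q k B j t / coeffX 1 (D.sig j) t ^ k) (q j) u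

/-- `truncB k = u + ∑_{r=1}^k b_{n,r}(u) x^r`. -/
def truncB : ℕ → ℂ × ℂ → ℂ
  | 0 => fun y => y.2
  | 1 => fun y => y.2 + D.bOne q y.2 * y.1
  | k + 2 => fun y => truncB (k + 1) y + D.nextB p q (k + 2) (truncB (k + 1)) y.2 * y.1 ^ (k + 2)

/-- `b_{n,k}`. -/
def bN : ℕ → ℂ → ℂ
  | 0 => fun _ => 0
  | 1 => D.bOne q
  | k + 2 => D.nextB p q (k + 2) (D.truncB p q (k + 1))

/-- `b_{p_i,k}`. -/
def bP (k : ℕ) (i : Fin (n + 1)) (u : ℂ) : ℂ :=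
  if k = 1 then taylorCoeff 1 (D.s i) 0 + coeffX 1 (D.eps i) u * D.bOne q u
  else taylorCoeff k (D.s i) 0 + coeffX k (D.eps i) u * D.bOne q u
    + D.resBp p q k (D.truncB p q (k - 1)) i u + coeffX 1 (D.eps i) u ^ k * D.bN p q k u

/-- `b_{q_j,k}`. -/
def bQ (k : ℕ) (j : Fin m) (u : ℂ) : ℂ :=
  if k = 1 then taylorCoeff 1 (D.z j) 0 / deriv (D.g q j) u + coeffX 1 (D.sig j) u * D.bOne q u
  else taylorCoeff k (D.z j) 0 / deriv (D.g q j) u + coeffX k (D.sig j) u * D.bOne q u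
    + D.resBq q k (D.truncB p q (k - 1)) j u + coeffX 1 (D.sig j) u ^ k * D.bN p q k u

/-- The normalizing transformations are in `k₀`-normal form: up to order `k₀`, the coefficients of
their expansions in powers of `x` are the canonical ones (on the punctured divisor, respectively
near `p_i` and `q_j`, where the formulas for `a_{p_i,k}`, … have removable singularities). -/
structure InNormalForm (k₀ : ℕ) : Prop where
  n_first : ∀ k, 1 ≤ k → k ≤ k₀ → ∀ u, (∀ i, u ≠ p i) → (∀ j, u ≠ q j) →
    coeffX k (fun y => (D.Hn y).1) u = D.aN p q k u
  n_second : ∀ k, 1 ≤ k → k ≤ k₀ → ∀ u, (∀ i, u ≠ p i) → (∀ j, u ≠ q j) →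
    coeffX k (fun y => (D.Hn y).2) u = D.bN p q k u
  p_first : ∀ k, 1 ≤ k → k ≤ k₀ → ∀ i, ∀ᶠ u in 𝓝[≠] (p i),
    coeffX k (fun y => (D.Hp i y).1) u = D.aP p q k i u
  p_second : ∀ k, 1 ≤ k → k ≤ k₀ → ∀ i, ∀ᶠ u in 𝓝[≠] (p i),
    coeffX k (fun y => (D.Hp i y).2) u = D.bP p q k i u
  q_first : ∀ k, 1 ≤ k → k ≤ k₀ → ∀ j, ∀ᶠ u in 𝓝[≠] (q j),
    coeffX k (fun y => (D.Hq j y).1) u = D.aQ p q k j u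
  q_second : ∀ k, 1 ≤ k → k ≤ k₀ → ∀ j, ∀ᶠ u in 𝓝[≠] (q j),
    coeffX k (fun y => (D.Hq j y).2) u = D.bQ p q k j u

end NormalizingData

/-! ### The data of lower order -/

/-- The possible values of the data of order `≤ k - 1`: the numbers `λ_i`, `s_{i,r}`, `z_{j,r}`
and the germs of `g_j`, `ε_{i,r}`, `ς_{j,r}`, for all `i`, `j` and `1 ≤ r ≤ k - 1`
(the index `r : Fin (k - 1)` stands for the order `r + 1`). -/
structure LowerData {n m : ℕ} (p : Fin (n + 1) → ℂ) (q : Fin m → ℂ) (k : ℕ) where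
  lam : Fin (n + 1) → ℂ
  s : Fin (n + 1) → Fin (k - 1) → ℂ
  z : Fin m → Fin (k - 1) → ℂ
  g : (j : Fin m) → Germ (𝓝 (q j)) ℂ
  eps : (i : Fin (n + 1)) → Fin (k - 1) → Germ (𝓝 (p i)) ℂ
  sig : (j : Fin m) → Fin (k - 1) → Germ (𝓝 (q j)) ℂ

/-- The data of order `≤ k - 1` of `D`. -/
def NormalizingData.lowerData {n m : ℕ} (D : NormalizingData n m) (p : Fin (n + 1) → ℂ)
    (q : Fin m → ℂ) (k : ℕ) : LowerData p q k where
  lam := D.lam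
  s i r := taylorCoeff (r + 1) (D.s i) 0
  z j r := taylorCoeff (r + 1) (D.z j) 0
  g j := ((D.g q j : ℂ → ℂ) : Germ (𝓝 (q j)) ℂ)
  eps i r := ((coeffX (r + 1) (D.eps i) : ℂ → ℂ) : Germ (𝓝 (p i)) ℂ)
  sig j r := ((coeffX (r + 1) (D.sig j) : ℂ → ℂ) : Germ (𝓝 (q j)) ℂ)

/-- Near `(0, c)` the tangency locus of `V` and `W` is the graph of the holomorphic germ
`x ↦ π(x)`, `π(0) = c`. -/
def IsTangencyBranch (V W : ℂ × ℂ → ℂ × ℂ) (c : ℂ) (π : ℂ → ℂ) : Prop :=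
  AnalyticAt ℂ π 0 ∧ π 0 = c ∧ ∀ᶠ y in 𝓝 ((0 : ℂ), c), y ∈ tangencyLocus V W ↔ y.2 = π y.1

end TangencyCurves

end

open TangencyCurves

open Filter Topology Set
open scoped Nat

noncomputable section

namespace TangencyCurves

open Asymptotics

/-! ### Taylor expansions in one variable -/

/-! Near `(0, p_i)` and `(0, q_j)` the maps `H_{p_i}`, `H_{q_j}` carry pairs of model foliations to
the given pair. The model tangency curves are explicit: `u = p_i - λ_i x s_i'(x)` at `p_i`, and `u =
q_j`, the critical point of `g_j`, at `q_j`. A biholomorphism fixing the divisor pointwise sends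
such a graph to a graph (`exists_isTangencyBranch`), so the branches exist and their coefficients
are governed by the expansion of `H`.

The functional transformations are not computed. Write the coefficient of order `k` as the announced
explicit part plus a remainder. It suffices that the remainder is determined by the germ of order
`k` (`ε_{i,k}` or `ς_{j,k}`) and the data of lower order; the transformation is then that
well-defined number, taken as a constant function of `u`. For `k ≥ 2` one therefore compares two
normalized data `D`, `D'` with equal lower-order data and the same germ of order `k`. Modulo
`o(x^k)` everything nonlinear cancels, and the difference of the branch coefficients is the
difference `ω` of the model curves plus the difference `β` of the coefficients `b_k` at the point
(`taylorCoeff_branch_sub`).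

At `p_i`, the Euler operator `x d/dx` gives `ω = -k λ_i Δs_{i,k}`, while `β = Δs_{i,k} +
Δb_{n,k}(p_i)`. At `q_j`, `ω = 0` and `β` is the value at `q_j` of `Δz_{j,k} / g_j' + ς_{j,1}^k
Δb_{n,k}`. In both cases `Δb_{n,k}(u) = -∑ Δz_{j,k} / (2 (u - q_j))` (`bN_sub`): the terms `𝐀`, `𝐁`
depend only on lower-order data, and `1 / (ς_{j,1}^k g_j')` has a simple pole with residue `1/2`. At
`q_j` the two poles cancel, and the finite part produces `k ς_{j,1}'` and `g_j''' / 4`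
(`tendsto_inv_sub_div`).

Order `1` is separate: there `H` is compared with the map having the same first component and second
component `u`, and the remainder is zero. -/

lemma taylorCoeff_congr {k : ℕ} {f g : ℂ → ℂ} {c : ℂ} (h : f =ᶠ[𝓝 c] g) :
    taylorCoeff k f c = taylorCoeff k g c := by
  rw [taylorCoeff, taylorCoeff, h.iteratedDeriv_eq]

lemma taylorCoeff_zero (f : ℂ → ℂ) (c : ℂ) : taylorCoeff 0 f c = f c := by
  simp [taylorCoeff]

lemma taylorCoeff_one (f : ℂ → ℂ) (c : ℂ) : taylorCoeff 1 f c = deriv f c := by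
  simp [taylorCoeff]

lemma taylorCoeff_succ (k : ℕ) (f : ℂ → ℂ) (c : ℂ) :
    taylorCoeff (k + 1) f c = taylorCoeff k (deriv f) c / (k + 1) := by
  have : (k ! : ℂ) ≠ 0 := by exact_mod_cast k.factorial_ne_zero
  rw [taylorCoeff, taylorCoeff, iteratedDeriv_succ', Nat.factorial_succ]
  have : (k : ℂ) + 1 ≠ 0 := by exact_mod_cast k.succ_ne_zero
  push_cast
  field_simp

lemma taylorCoeff_pow_self (k : ℕ) (c : ℂ) : taylorCoeff k (fun x => c * x ^ k) 0 = c := by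
  have hk : (k ! : ℂ) ≠ 0 := by exact_mod_cast k.factorial_ne_zero
  rw [taylorCoeff, iteratedDeriv_const_mul_field, iteratedDeriv_fun_pow_zero]
  simp [hk]

lemma taylorCoeff_sub {k : ℕ} {f g : ℂ → ℂ} {c : ℂ} (hf : AnalyticAt ℂ f c)
    (hg : AnalyticAt ℂ g c) :
    taylorCoeff k (fun x => f x - g x) c = taylorCoeff k f c - taylorCoeff k g c := by
  rw [taylorCoeff, taylorCoeff, taylorCoeff,
    iteratedDeriv_fun_sub hf.contDiffAt hg.contDiffAt, sub_div]

lemma isLittleO_pow_succ (k : ℕ) : (fun x : ℂ => x ^ (k + 1)) =o[𝓝 0] fun x => x ^ k := by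
  simpa using isLittleO_pow_pow (𝕜 := ℂ) (Nat.lt_succ_self k)

lemma isBigO_pow_pow {k l : ℕ} (h : l ≤ k) :
    (fun x : ℂ => x ^ k) =O[𝓝 0] fun x => x ^ l := by
  rcases h.eq_or_lt with rfl | h
  · exact isBigO_refl _ _
  · exact (isLittleO_pow_pow h).isBigO

/-- A zero of order `m ≤ k` would give `x^m = O(h)`, hence `x^m = o(x^m)` on a punctured
neighbourhood. -/
lemma iteratedDeriv_eq_zero_of_isLittleO {k : ℕ} {h : ℂ → ℂ} (hh : AnalyticAt ℂ h 0)
    (ho : h =o[𝓝 0] fun x => x ^ k) : iteratedDeriv k h 0 = 0 := by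
  suffices H : ((k + 1 : ℕ) : ℕ∞) ≤ analyticOrderAt h 0 from
    (natCast_le_analyticOrderAt_iff_iteratedDeriv_eq_zero hh).1 H k (Nat.lt_succ_self k)
  by_contra H
  rw [not_le] at H
  obtain ⟨m, hm⟩ := ENat.ne_top_iff_exists.1 (ne_top_of_lt H)
  rw [← hm] at H
  have hmk : m ≤ k := by
    have : m < k + 1 := by exact_mod_cast H
    omega
  obtain ⟨g, hg, hg0, hhg⟩ := (hh.analyticOrderAt_eq_natCast).1 hm.symm
  have h1 : (fun x : ℂ => x ^ m) =O[𝓝 0] h := by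
    have h2 : (fun x => (g x)⁻¹) =O[𝓝 0] fun _ : ℂ => (1 : ℂ) :=
      (hg.continuousAt.inv₀ hg0).tendsto.isBigO_one ℂ
    refine ((isBigO_refl h (𝓝 0)).mul h2).congr' ?_ (by simp)
    filter_upwards [hhg, hg.continuousAt.eventually_ne hg0] with x hx hx0
    simp [hx, hx0]
  have h4 := ((h1.trans_isLittleO ho).trans_isBigO (isBigO_pow_pow hmk)).mono (nhdsWithin_le_nhds (s := {0}ᶜ))
  refine isLittleO_irrefl (f'' := fun x : ℂ => x ^ m) (l := 𝓝[≠] (0 : ℂ)) ?_ h4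
  refine Eventually.frequently ?_
  filter_upwards [self_mem_nhdsWithin] with x hx
  exact pow_ne_zero _ hx

/-- This turns asymptotic estimates back into coefficients, so that no formula for higher
derivatives of a composition is needed; `isLittleO_sub_of_taylorCoeff_eq` is the way in. -/
lemma taylorCoeff_sub_of_isLittleO {k : ℕ} {f f' : ℂ → ℂ} {c : ℂ} (hf : AnalyticAt ℂ f 0)
    (hf' : AnalyticAt ℂ f' 0)
    (ho : (fun x => f x - f' x - c * x ^ k) =o[𝓝 0] fun x => x ^ k) :
    taylorCoeff k f 0 - taylorCoeff k f' 0 = c := by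
  have hp : AnalyticAt ℂ (fun x : ℂ => c * x ^ k) 0 := by fun_prop
  have h1 := iteratedDeriv_eq_zero_of_isLittleO ((hf.sub hf').sub hp) ho
  have h2 := taylorCoeff_sub (k := k) (hf.sub hf') hp
  have h3 := taylorCoeff_sub (k := k) hf hf'
  rw [taylorCoeff_pow_self] at h2
  have h4 : taylorCoeff k (fun x => (f - f') x - c * x ^ k) 0 = 0 := by
    rw [taylorCoeff]
    have : iteratedDeriv k (fun x => (f - f') x - c * x ^ k) 0 = 0 := h1
    rw [this, zero_div]
  have h5 : taylorCoeff k (f - f') 0 = taylorCoeff k f 0 - taylorCoeff k f' 0 := h3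
  rw [← h5]
  rw [h4] at h2
  linear_combination -h2

lemma isBigO_taylor {f : ℂ → ℂ} (hf : AnalyticAt ℂ f 0) (k : ℕ) :
    (fun x => f x - ∑ i ∈ Finset.range k, taylorCoeff i f 0 * x ^ i)
      =O[𝓝 0] fun x => x ^ k := by
  obtain ⟨R, hR, h⟩ := hf.exists_eventuallyEq_sum_add_pow_mul k
  have h2 : R =O[𝓝 0] fun _ : ℂ => (1 : ℂ) := hR.continuousAt.tendsto.isBigO_one ℂ
  refine ((isBigO_refl (fun x : ℂ => x ^ k) (𝓝 0)).mul h2).congr' ?_ (by simp)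
  filter_upwards [h] with x hx
  rw [hx, smul_eq_mul, eq_sub_iff_add_eq, add_comm]
  congr 1
  refine Finset.sum_congr rfl fun i _ => ?_
  rw [taylorCoeff, smul_eq_mul]
  ring

lemma isLittleO_sub_of_taylorCoeff_eq {k : ℕ} {f f' : ℂ → ℂ} (hf : AnalyticAt ℂ f 0)
    (hf' : AnalyticAt ℂ f' 0) (h : ∀ r < k, taylorCoeff r f 0 = taylorCoeff r f' 0) :
    (fun x => f x - f' x - (taylorCoeff k f 0 - taylorCoeff k f' 0) * x ^ k)
      =o[𝓝 0] fun x => x ^ k := by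
  refine (((isBigO_taylor hf (k + 1)).sub (isBigO_taylor hf' (k + 1))).trans_isLittleO
    (isLittleO_pow_succ k)).congr_left fun x => ?_
  rw [Finset.sum_range_succ, Finset.sum_range_succ,
    Finset.sum_congr rfl fun r hr => by rw [h r (Finset.mem_range.1 hr)]]
  ring

lemma isBigO_of_isLittleO_sub {k : ℕ} {f : ℂ → ℂ} {c : ℂ}
    (h : (fun x => f x - c * x ^ k) =o[𝓝 0] fun x => x ^ k) :
    f =O[𝓝 0] fun x => x ^ k := by
  refine (h.isBigO.add ((isBigO_refl (fun x : ℂ => x ^ k) (𝓝 0)).const_mul_left c)).congr_left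
    fun x => by ring

/-! ### Expansions along `x = 0` of functions of two variables -/

/-- The partial derivative with respect to the first variable. -/
def derivX (F : ℂ × ℂ → ℂ) (y : ℂ × ℂ) : ℂ := fderiv ℂ F y (1, 0)

lemma analyticAt_derivX {F : ℂ × ℂ → ℂ} {y : ℂ × ℂ} (hF : AnalyticAt ℂ F y) :
    AnalyticAt ℂ (derivX F) y :=
  (ContinuousLinearMap.apply ℂ ℂ ((1 : ℂ), (0 : ℂ))).analyticAt _ |>.comp hF.fderiv

lemma hasDerivAt_derivX {F : ℂ × ℂ → ℂ} {x v : ℂ} (hF : AnalyticAt ℂ F (x, v)) :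
    HasDerivAt (fun t => F (t, v)) (derivX F (x, v)) x := by
  have h1 : HasDerivAt (fun t : ℂ => (t, v)) ((1 : ℂ), (0 : ℂ)) x :=
    (hasDerivAt_id x).prodMk (hasDerivAt_const x v)
  exact hF.differentiableAt.hasFDerivAt.comp_hasDerivAt x h1

lemma eventually_nhds_line {P : ℂ × ℂ → Prop} {x u : ℂ} (h : ∀ᶠ y in 𝓝 (x, u), P y) :
    ∀ᶠ v in 𝓝 u, ∀ᶠ t in 𝓝 x, P (t, v) := by
  have h' : ∀ᶠ y in 𝓝 u ×ˢ 𝓝 x, P (y.2, y.1) := by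
    rw [← nhds_prod_eq]
    have hs : Tendsto (Prod.swap : ℂ × ℂ → ℂ × ℂ) (𝓝 (u, x)) (𝓝 (x, u)) :=
      continuous_swap.tendsto (u, x)
    exact hs.eventually h
  exact h'.curry

lemma coeffX_zero (F : ℂ × ℂ → ℂ) (u : ℂ) : coeffX 0 F u = F (0, u) := taylorCoeff_zero _ _

/-- Differentiation in `x` lowers the order by one. It drives the inductions over all `F` in
`analyticAt_coeffX` and `isBigO_coeffX`. -/
lemma coeffX_succ {F : ℂ × ℂ → ℂ} {u : ℂ} (hF : AnalyticAt ℂ F (0, u)) (k : ℕ) :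
    coeffX (k + 1) F u = coeffX k (derivX F) u / (k + 1) := by
  rw [coeffX, taylorCoeff_succ]
  congr 1
  refine taylorCoeff_congr ?_
  filter_upwards [(Continuous.prodMk_left u).continuousAt.eventually (f := fun x => (x, u))
    hF.eventually_analyticAt] with x hx
  exact (hasDerivAt_derivX hx).deriv

lemma analyticAt_coeffX {F : ℂ × ℂ → ℂ} {u : ℂ} (hF : AnalyticAt ℂ F (0, u)) (k : ℕ) :
    AnalyticAt ℂ (coeffX k F) u := by
  induction k generalizing F with
  | zero =>
    have : coeffX 0 F = fun v => F (0, v) := funext (coeffX_zero F)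
    rw [this]
    exact hF.comp_of_eq (f := fun v => ((0 : ℂ), v)) (by fun_prop) rfl
  | succ k ih =>
    refine ((ih (analyticAt_derivX hF)).div_const (c := (k : ℂ) + 1)).congr ?_
    filter_upwards [(eventually_nhds_line hF.eventually_analyticAt)] with v hv
    exact (coeffX_succ hv.self_of_nhds k).symm

/-- Taylor's formula along `x = 0`, locally uniformly in the second variable. -/
lemma isBigO_coeffX {F : ℂ × ℂ → ℂ} {u : ℂ} (hF : AnalyticAt ℂ F (0, u)) (k : ℕ) :
    (fun y : ℂ × ℂ => F y - ∑ i ∈ Finset.range k, coeffX i F y.2 * y.1 ^ i)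
      =O[𝓝 (0, u)] fun y => y.1 ^ k := by
  induction k generalizing F with
  | zero => simpa using hF.continuousAt.tendsto.isBigO_one ℂ
  | succ k ih =>
    obtain ⟨C, hC⟩ := (ih (analyticAt_derivX hF)).bound
    obtain ⟨ε, hε, hball⟩ := Metric.eventually_nhds_iff_ball.1 (hC.and hF.eventually_analyticAt)
    refine IsBigO.of_bound C ?_
    filter_upwards [Metric.ball_mem_nhds _ hε] with y hy
    obtain ⟨x, v⟩ := y
    have hxv : ‖x‖ < ε ∧ dist v u < ε := by simpa [Prod.dist_eq] using hy
    have hmem : ∀ t ∈ Metric.closedBall (0 : ℂ) ‖x‖, (t, v) ∈ Metric.ball ((0 : ℂ), u) ε := by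
      intro t ht
      have : ‖t‖ ≤ ‖x‖ := by simpa using ht
      simpa [Prod.dist_eq] using ⟨this.trans_lt hxv.1, hxv.2⟩
    have hC0 : 0 ≤ C * ‖x‖ ^ k :=
      (norm_nonneg _).trans (by simpa using (hball (x, v) hy).1)
    have hF0 : AnalyticAt ℂ F (0, v) := (hball _ (hmem 0 (by simp))).2
    have hder : ∀ t ∈ Metric.closedBall (0 : ℂ) ‖x‖, HasDerivWithinAt
        (fun t => F (t, v) - ∑ i ∈ Finset.range (k + 1), coeffX i F v * t ^ i)
        (derivX F (t, v) - ∑ i ∈ Finset.range k, coeffX i (derivX F) v * t ^ i)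
        (Metric.closedBall (0 : ℂ) ‖x‖) t := by
      intro t ht
      refine HasDerivAt.hasDerivWithinAt ((hasDerivAt_derivX (hball _ (hmem t ht)).2).sub ?_)
      have h1 : HasDerivAt (fun t => ∑ i ∈ Finset.range (k + 1), coeffX i F v * t ^ i)
          (∑ i ∈ Finset.range (k + 1), coeffX i F v * (i * t ^ (i - 1))) t :=
        HasDerivAt.fun_sum fun i _ => (hasDerivAt_pow i t).const_mul _
      refine h1.congr_deriv ?_
      rw [Finset.sum_range_succ']
      simp only [CharP.cast_eq_zero, zero_mul, mul_zero, add_zero]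
      refine Finset.sum_congr rfl fun i _ => ?_
      rw [coeffX_succ hF0]
      have : (i : ℂ) + 1 ≠ 0 := by exact_mod_cast i.succ_ne_zero
      push_cast
      field_simp
    -- Mean value inequality on the disc `|t| ≤ |x|` in the line through `v`: the remainder vanishes
    -- at `t = 0` and its derivative is bounded by `C |x|^k`, with `C` independent of `v`.
    have key := Convex.norm_image_sub_le_of_norm_hasDerivWithin_le (C := C * ‖x‖ ^ k) hder
      (fun t ht => ?_) (convex_closedBall 0 ‖x‖) (x := 0) (y := x) (by simp) (by simp)
    · rw [Finset.sum_range_succ' _ k] at key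
      simp only [sub_zero, coeffX_zero] at key
      simpa [Finset.sum_range_succ' _ k, coeffX_zero, pow_succ, mul_assoc] using key
    · refine (hball _ (hmem t ht)).1.trans ?_
      have ht' : ‖t‖ ≤ ‖x‖ := by simpa using ht
      have h0 : 0 ≤ C * ‖t‖ ^ k := (norm_nonneg _).trans (by simpa using (hball _ (hmem t ht)).1)
      simp only [norm_pow]
      rcases eq_or_ne x 0 with rfl | hx
      · have : t = 0 := by simpa using ht'
        simp [this]
      · have hC1 : 0 ≤ C := nonneg_of_mul_nonneg_left hC0 (by positivity)
        gcongr

/-! ### Compositions and congruences modulo powers of `x` -/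

/-- Strict differentiability makes `f` Lipschitz near `u`. -/
lemma isBigO_comp_sub_comp {f : ℂ → ℂ} {u : ℂ} (hf : AnalyticAt ℂ f u) {v v' : ℂ → ℂ}
    (hv : Tendsto v (𝓝 0) (𝓝 u)) (hv' : Tendsto v' (𝓝 0) (𝓝 u)) :
    (fun x => f (v x) - f (v' x)) =O[𝓝 0] fun x => v x - v' x := by
  have h := hf.hasStrictFDerivAt.isBigO_sub
  have ht : Tendsto (fun x => (v x, v' x)) (𝓝 0) (𝓝 (u, u)) := by
    rw [nhds_prod_eq]
    exact hv.prodMk hv'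
  exact h.comp_tendsto ht

lemma isLittleO_comp_sub_sum {F : ℂ × ℂ → ℂ} {u : ℂ} (hF : AnalyticAt ℂ F (0, u)) (k : ℕ)
    {ψ v : ℂ → ℂ} (hψ : ψ =O[𝓝 0] fun x => x) (hv : Tendsto v (𝓝 0) (𝓝 u)) :
    (fun x => F (ψ x, v x) - ∑ i ∈ Finset.range (k + 1), coeffX i F (v x) * ψ x ^ i)
      =o[𝓝 0] fun x => x ^ k := by
  have hψ0 : Tendsto ψ (𝓝 0) (𝓝 0) := hψ.trans_tendsto tendsto_id
  have ht : Tendsto (fun x => (ψ x, v x)) (𝓝 0) (𝓝 (0, u)) := by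
    rw [nhds_prod_eq]
    exact hψ0.prodMk hv
  exact (((isBigO_coeffX hF (k + 1)).comp_tendsto ht).trans (hψ.pow (k + 1))).trans_isLittleO
    (isLittleO_pow_succ k)

/-- Comparison modulo `o(x^k)` of two compositions whose ingredients agree up to order `< k`. -/
lemma isLittleO_comp_sub_comp {k : ℕ} {e e' : ℂ × ℂ → ℂ} {u : ℂ}
    (he : AnalyticAt ℂ e (0, u)) (he' : AnalyticAt ℂ e' (0, u))
    (he0 : ∀ᶠ w in 𝓝 u, e (0, w) = 0) (he0' : ∀ᶠ w in 𝓝 u, e' (0, w) = 0)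
    (hee' : ∀ r < k, coeffX r e =ᶠ[𝓝 u] coeffX r e')
    {ψ ψ' v v' : ℂ → ℂ} (hψ : (fun x => ψ x - x) =o[𝓝 0] fun x => x)
    (hψ' : (fun x => ψ' x - x) =o[𝓝 0] fun x => x)
    (hψψ' : (fun x => ψ x - ψ' x) =o[𝓝 0] fun x => x ^ k)
    (hv : Tendsto v (𝓝 0) (𝓝 u)) (hv' : Tendsto v' (𝓝 0) (𝓝 u))
    (hvv' : (fun x => v x - v' x) =O[𝓝 0] fun x => x ^ k) :
    (fun x => e (ψ x, v x) - e' (ψ' x, v' x) - (coeffX k e u - coeffX k e' u) * x ^ k)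
      =o[𝓝 0] fun x => x ^ k := by
  have hψO : ψ =O[𝓝 0] fun x => x :=
    (hψ.isBigO.add (isBigO_refl _ _)).congr_left fun x => by ring
  have hψO' : ψ' =O[𝓝 0] fun x => x :=
    (hψ'.isBigO.add (isBigO_refl _ _)).congr_left fun x => by ring
  have hψ0 : Tendsto ψ (𝓝 0) (𝓝 0) := hψO.trans_tendsto tendsto_id
  have hψ0' : Tendsto ψ' (𝓝 0) (𝓝 0) := hψO'.trans_tendsto tendsto_id
  have h1 := isLittleO_comp_sub_sum he k hψO hv
  have h2 := isLittleO_comp_sub_sum he' k hψO' hv'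
  -- the leading terms
  have lead : ∀ {f ψ v : ℂ → ℂ}, AnalyticAt ℂ f u → (fun x => ψ x - x) =o[𝓝 0] (fun x => x) →
      Tendsto v (𝓝 0) (𝓝 u) →
      (fun x => f (v x) * ψ x ^ k - f u * x ^ k) =o[𝓝 0] fun x => x ^ k := by
    intro f ψ v hf hψ hv
    have heq : IsEquivalent (𝓝 0) (fun x => ψ x ^ k) fun x : ℂ => x ^ k :=
      IsEquivalent.pow (t := ψ) (u := fun x => x) hψ k
    have hc : (fun x => f (v x) - f u) =o[𝓝 0] fun _ : ℂ => (1 : ℂ) := by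
      rw [isLittleO_one_iff]
      simpa using ((hf.continuousAt.tendsto.comp hv).sub_const (f u))
    refine ((hc.mul_isBigO heq.isBigO).congr_right fun x => by simp).add
      (heq.isLittleO.const_mul_left (f u)) |>.congr_left fun x => ?_
    simp only [Pi.sub_apply]
    ring
  have low : (fun x => ∑ i ∈ Finset.range k,
      (coeffX i e (v x) * ψ x ^ i - coeffX i e' (v' x) * ψ' x ^ i)) =o[𝓝 0] fun x => x ^ k := by
    refine IsLittleO.fun_sum fun i hi => ?_
    rw [Finset.mem_range] at hi
    rcases Nat.eq_zero_or_pos i with rfl | hi0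
    -- There is no factor `ψ` at order `0` to improve `v - v' = O(x^k)` to `o(x^k)`; vanishing on
    -- the divisor removes this term.
    · refine (isLittleO_zero (fun x : ℂ => x ^ k) (𝓝 (0 : ℂ))).congr' ?_ EventuallyEq.rfl
      filter_upwards [hv.eventually he0, hv'.eventually he0'] with x hx hx'
      simp [coeffX_zero, hx, hx']
    · have ha := analyticAt_coeffX he i
      have t1 : (fun x => (coeffX i e (v x) - coeffX i e (v' x)) * ψ x ^ i)
          =o[𝓝 0] fun x => x ^ k := by
        have : (fun x => ψ x ^ i) =o[𝓝 0] fun _ : ℂ => (1 : ℂ) := by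
          rw [isLittleO_one_iff]
          simpa [hi0.ne'] using hψ0.pow i
        simpa using ((isBigO_comp_sub_comp ha hv hv').trans hvv').mul_isLittleO this
      have t2 : (fun x => coeffX i e (v' x) * (ψ x ^ i - ψ' x ^ i))
          =o[𝓝 0] fun x => x ^ k := by
        have hb : (fun x => coeffX i e (v' x)) =O[𝓝 0] fun _ : ℂ => (1 : ℂ) :=
          (ha.continuousAt.tendsto.comp hv').isBigO_one ℂ
        have hp : (fun x => ψ x ^ i - ψ' x ^ i) =O[𝓝 0] fun x => ψ x - ψ' x :=
          isBigO_comp_sub_comp (f := fun t => t ^ i) (by fun_prop) hψ0 hψ0'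
        simpa using hb.mul_isLittleO (hp.trans_isLittleO hψψ')
      refine (t1.add t2).congr' ?_ EventuallyEq.rfl
      filter_upwards [hv'.eventually (hee' i hi)] with x hx
      rw [← hx]
      ring
  have l1 := lead (analyticAt_coeffX he k) hψ hv
  have l2 := lead (analyticAt_coeffX he' k) hψ' hv'
  refine ((((h1.sub h2).add low).add l1).sub l2).congr_left fun x => ?_
  rw [Finset.sum_range_succ, Finset.sum_range_succ, Finset.sum_sub_distrib]
  ring

/-- Comparison modulo `o(x^k)` of the compositions of a fixed polynomial in `x` with maps that
agree up to order `< k`. -/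
lemma isLittleO_polynomial_comp {k N : ℕ} {c u : ℂ} {β : ℂ → ℂ} {t : ℕ → ℂ → ℂ}
    (hβ : AnalyticAt ℂ β u) (ht : ∀ r, AnalyticAt ℂ (t r) u)
    {T : ℂ × ℂ → ℂ}
    (hT : ∀ y, T y = c * y.2 + β y.2 * y.1 + ∑ r ∈ Finset.range N, t r y.2 * y.1 ^ (r + 2))
    {E E' v v' : ℂ → ℂ} {ε ν : ℂ} (hE : E =O[𝓝 0] fun x => x) (hE' : E' =O[𝓝 0] fun x => x)
    (hv : Tendsto v (𝓝 0) (𝓝 u)) (hv' : Tendsto v' (𝓝 0) (𝓝 u))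
    (hEE' : (fun x => E x - E' x - ε * x ^ k) =o[𝓝 0] fun x => x ^ k)
    (hvv' : (fun x => v x - v' x - ν * x ^ k) =o[𝓝 0] fun x => x ^ k) :
    (fun x => T (E x, v x) - T (E' x, v' x) - (c * ν + β u * ε) * x ^ k)
      =o[𝓝 0] fun x => x ^ k := by
  have hE0 : Tendsto E (𝓝 0) (𝓝 0) := hE.trans_tendsto tendsto_id
  have hE0' : Tendsto E' (𝓝 0) (𝓝 0) := hE'.trans_tendsto tendsto_id
  have hEo : E =o[𝓝 0] fun _ : ℂ => (1 : ℂ) := (isLittleO_one_iff _).2 hE0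
  have hEo' : E' =o[𝓝 0] fun _ : ℂ => (1 : ℂ) := (isLittleO_one_iff _).2 hE0'
  have hEEO := isBigO_of_isLittleO_sub hEE'
  have hvvO := isBigO_of_isLittleO_sub hvv'
  have hb1 : (fun x => (β (v x) - β (v' x)) * E x) =o[𝓝 0] fun x => x ^ k := by
    simpa using ((isBigO_comp_sub_comp hβ hv hv').trans hvvO).mul_isLittleO hEo
  have hb2 : (fun x => (β (v' x) - β u) * (E x - E' x)) =o[𝓝 0] fun x => x ^ k := by
    have hc : (fun x => β (v' x) - β u) =o[𝓝 0] fun _ : ℂ => (1 : ℂ) := by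
      rw [isLittleO_one_iff]
      simpa using ((hβ.continuousAt.tendsto.comp hv').sub_const (β u))
    simpa using hc.mul_isBigO hEEO
  -- In degree at least two in `x`, every difference keeps a factor `E` or `E'`, which is `o(1)`.
  -- Thus only `c u` and `β(u) x` contribute at order `k`.
  have hs : (fun x => ∑ r ∈ Finset.range N,
      (t r (v x) * E x ^ (r + 2) - t r (v' x) * E' x ^ (r + 2))) =o[𝓝 0] fun x => x ^ k := by
    refine IsLittleO.fun_sum fun r _ => ?_
    have t1 : (fun x => (t r (v x) - t r (v' x)) * E x ^ (r + 2)) =o[𝓝 0] fun x => x ^ k := by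
      have : (fun x => E x ^ (r + 2)) =o[𝓝 0] fun _ : ℂ => (1 : ℂ) := by
        rw [isLittleO_one_iff]
        simpa using hE0.pow (r + 2)
      simpa using ((isBigO_comp_sub_comp (ht r) hv hv').trans hvvO).mul_isLittleO this
    have t2 : (fun x => t r (v' x) * (E x ^ (r + 1) - E' x ^ (r + 1)) * E x)
        =o[𝓝 0] fun x => x ^ k := by
      have hb : (fun x => t r (v' x)) =O[𝓝 0] fun _ : ℂ => (1 : ℂ) :=
        ((ht r).continuousAt.tendsto.comp hv').isBigO_one ℂ
      have hp : (fun x => E x ^ (r + 1) - E' x ^ (r + 1)) =O[𝓝 0] fun x => E x - E' x :=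
        isBigO_comp_sub_comp (f := fun t => t ^ (r + 1)) (by fun_prop) hE0 hE0'
      simpa using (hb.mul (hp.trans hEEO)).mul_isLittleO hEo
    have t3 : (fun x => t r (v' x) * (E x - E' x) * E' x ^ (r + 1))
        =o[𝓝 0] fun x => x ^ k := by
      have hb : (fun x => t r (v' x)) =O[𝓝 0] fun _ : ℂ => (1 : ℂ) :=
        ((ht r).continuousAt.tendsto.comp hv').isBigO_one ℂ
      have : (fun x => E' x ^ (r + 1)) =o[𝓝 0] fun _ : ℂ => (1 : ℂ) := by
        rw [isLittleO_one_iff]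
        simpa using hE0'.pow (r + 1)
      simpa using (hb.mul hEEO).mul_isLittleO this
    exact ((t1.add t2).add t3).congr_left fun x => by ring
  refine ((((hvv'.const_mul_left c).add hb1).add hb2).add
    ((hEE'.const_mul_left (β u)).add hs)).congr_left fun x => ?_
  rw [hT, hT, Finset.sum_sub_distrib]
  ring

lemma analyticAt_polynomial_comp {N : ℕ} {c u : ℂ} {β : ℂ → ℂ} {t : ℕ → ℂ → ℂ}
    (hβ : AnalyticAt ℂ β u) (ht : ∀ r, AnalyticAt ℂ (t r) u) {T : ℂ × ℂ → ℂ}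
    (hT : ∀ y, T y = c * y.2 + β y.2 * y.1 + ∑ r ∈ Finset.range N, t r y.2 * y.1 ^ (r + 2))
    {E v : ℂ → ℂ} (hE : AnalyticAt ℂ E 0) (hv : AnalyticAt ℂ v 0) (hv0 : v 0 = u) :
    AnalyticAt ℂ (fun x => T (E x, v x)) 0 := by
  simp only [hT]
  subst hv0
  refine ((analyticAt_const.mul hv).add ((hβ.comp hv).mul hE)).add
    (Finset.analyticAt_fun_sum _ fun r _ => ((ht r).comp hv).mul (hE.pow (r + 2)))

/-- If `π ∘ X = U` and `π' ∘ X' = U'`, where `X = x + o(x)` and `X'` agree modulo `o(x^k)`, then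
the difference of the coefficients of order `k` of `π` and `π'` is that of `U` and `U'`. -/
lemma taylorCoeff_sub_of_conj {k : ℕ} {π π' X X' U U' : ℂ → ℂ} {d : ℂ}
    (hπ : AnalyticAt ℂ π 0) (hπ' : AnalyticAt ℂ π' 0) (hX : AnalyticAt ℂ X 0) (hX0 : X 0 = 0)
    (hX1 : deriv X 0 = 1) (hX' : Tendsto X' (𝓝 0) (𝓝 0))
    (hXX' : (fun x => X x - X' x) =o[𝓝 0] fun x => x ^ k)
    (h : ∀ᶠ x in 𝓝 0, π (X x) = U x) (h' : ∀ᶠ x in 𝓝 0, π' (X' x) = U' x)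
    (hU : (fun x => U x - U' x - d * x ^ k) =o[𝓝 0] fun x => x ^ k) :
    taylorCoeff k π 0 - taylorCoeff k π' 0 = d := by
  refine taylorCoeff_sub_of_isLittleO hπ hπ' ?_
  have hXs : HasStrictDerivAt X 1 0 := hX1 ▸ hX.hasStrictDerivAt
  -- As `X` maps the neighbourhood filter of `0` onto itself, the estimate on `π - π'` may be
  -- checked after composition with `X`.
  have hmap : map X (𝓝 0) = 𝓝 0 := by
    simpa [hX0] using hXs.map_nhds_eq one_ne_zero
  have hXt : Tendsto X (𝓝 0) (𝓝 0) := hmap.le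
  have hXo : (fun x => X x - x) =o[𝓝 0] fun x => x := by
    simpa [hX0] using hXs.hasDerivAt.isLittleO
  have heq : IsEquivalent (𝓝 0) (fun x => X x ^ k) fun x : ℂ => x ^ k :=
    IsEquivalent.pow (t := X) (u := fun x => x) hXo k
  rw [← hmap, isLittleO_map]
  have h1 := (isBigO_comp_sub_comp hπ' hX' hXt).trans_isLittleO
    (hXX'.neg_left.congr_left fun x => by ring)
  refine (((hU.add h1).sub (heq.isLittleO.const_mul_left d)).trans_isBigO
    heq.symm.isBigO).congr' ?_ EventuallyEq.rfl
  filter_upwards [h, h'] with x hx hx'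
  simp only [Function.comp, Pi.sub_apply, hx, hx']
  ring

/-! ### Principal parts -/

lemma isPrincipalPart_congr {f g : ℂ → ℂ} {a : ℂ} (h : f =ᶠ[𝓝[≠] a] g) (P : Polynomial ℂ) :
    IsPrincipalPart f a P ↔ IsPrincipalPart g a P := by
  refine and_congr_right fun _ => exists_congr fun r => and_congr_right fun _ => ?_
  exact ⟨fun H => by filter_upwards [H, h] with u hu hfg using hfg ▸ hu,
    fun H => by filter_upwards [H, h] with u hu hfg using hfg ▸ hu⟩

-- The two defining predicates are equal, so even the chosen polynomials coincide. Neither existence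
-- nor uniqueness of a principal part is needed.
open Classical in
lemma principalPart_congr {f g : ℂ → ℂ} {a : ℂ} (h : f =ᶠ[𝓝[≠] a] g) :
    principalPart f a = principalPart g a := by
  have : IsPrincipalPart f a = IsPrincipalPart g a :=
    funext fun P => propext (isPrincipalPart_congr h P)
  exact congrArg (fun S : Polynomial ℂ → Prop =>
    if h : ∃ P, S P then fun u => h.choose.eval (u - a)⁻¹ else 0) this

/-- A meromorphic function has a principal part. -/
lemma exists_isPrincipalPart {f : ℂ → ℂ} {a : ℂ} (hf : MeromorphicAt f a) :
    ∃ P, IsPrincipalPart f a P := by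
  obtain ⟨N, hN⟩ := hf
  have hg : AnalyticAt ℂ (fun z => (z - a) ^ N • f z) (0 + a) := by simpa using hN
  have hg0 : AnalyticAt ℂ (fun w => ((w + a) - a) ^ N • f (w + a)) 0 :=
    hg.comp (f := fun w => w + a) (by fun_prop)
  obtain ⟨R, hR, hfR⟩ := hg0.exists_eq_sum_add_pow_mul N
  set g : ℂ → ℂ := fun w => ((w + a) - a) ^ N • f (w + a)
  refine ⟨∑ i ∈ Finset.range N,
    Polynomial.C (iteratedDeriv i g 0 / (i ! : ℂ)) * Polynomial.X ^ (N - i), ?_,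
    fun u => R (u - a), ?_, ?_⟩
  · rw [Polynomial.finsetSum_coeff]
    refine Finset.sum_eq_zero fun i hi => ?_
    rw [Finset.mem_range] at hi
    simp [Polynomial.coeff_X_pow, (Nat.sub_pos_of_lt hi).ne]
  · exact (show AnalyticAt ℂ R (a - a) by simpa using hR).comp (f := fun u => u - a) (by fun_prop)
  · filter_upwards [self_mem_nhdsWithin] with u hu
    have hu' : u - a ≠ 0 := sub_ne_zero.2 hu
    have := hfR (u - a)
    simp only [g, sub_add_cancel, smul_eq_mul] at this
    rw [← mul_right_inj' (pow_ne_zero N hu'), this, Polynomial.eval_finsetSum, mul_add,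
      Finset.mul_sum]
    congr 1
    refine Finset.sum_congr rfl fun i hi => ?_
    rw [Finset.mem_range] at hi
    simp only [Polynomial.eval_mul, Polynomial.eval_C, Polynomial.eval_pow, Polynomial.eval_X,
      inv_pow]
    have hs : (u - a) ^ N = (u - a) ^ i * (u - a) ^ (N - i) := by
      rw [← pow_add, Nat.add_sub_cancel' hi.le]
    rw [hs]
    field_simp
    rfl

/-- A polynomial in `(u - a)⁻¹` without constant term that is bounded near `a` vanishes. -/
lemma eq_zero_of_eval_inv_eventuallyEq {P : Polynomial ℂ} {a : ℂ} {r : ℂ → ℂ}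
    (h0 : P.coeff 0 = 0) (hr : ContinuousAt r a)
    (h : ∀ᶠ u in 𝓝[≠] a, P.eval (u - a)⁻¹ = r u) : P = 0 := by
  by_contra hP
  have hdeg : 0 < P.degree := by
    rw [← Polynomial.natDegree_pos_iff_degree_pos, Nat.pos_iff_ne_zero]
    intro hd
    rw [Polynomial.natDegree_eq_zero] at hd
    obtain ⟨c, rfl⟩ := hd
    simp_all
  have ht : Tendsto (fun u : ℂ => ‖(u - a)⁻¹‖) (𝓝[≠] a) atTop := by
    refine tendsto_norm_cobounded_atTop.comp (tendsto_inv₀_nhdsNE_zero.comp ?_)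
    refine tendsto_nhdsWithin_iff.2 ⟨?_, ?_⟩
    · exact (Continuous.tendsto' (f := fun u : ℂ => u - a) (by fun_prop) _ _
        (sub_self a)).mono_left nhdsWithin_le_nhds
    · filter_upwards [self_mem_nhdsWithin] with u hu using sub_ne_zero.2 hu
  have h1 := P.tendsto_norm_atTop hdeg ht
  have h2 : Tendsto (fun u => ‖r u‖) (𝓝[≠] a) (𝓝 ‖r a‖) :=
    hr.norm.tendsto.mono_left nhdsWithin_le_nhds
  refine not_tendsto_nhds_of_tendsto_atTop h1 _ (h2.congr' ?_)
  filter_upwards [h] with u hu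
  rw [hu]

lemma IsPrincipalPart.unique {f : ℂ → ℂ} {a : ℂ} {P Q : Polynomial ℂ}
    (hP : IsPrincipalPart f a P) (hQ : IsPrincipalPart f a Q) : P = Q := by
  obtain ⟨hP0, r, hr, hPr⟩ := hP
  obtain ⟨hQ0, s, hs, hQs⟩ := hQ
  rw [← sub_eq_zero]
  refine eq_zero_of_eval_inv_eventuallyEq (a := a) (r := fun u => s u - r u)
    (by simp [hP0, hQ0]) (hs.continuousAt.sub hr.continuousAt) ?_
  filter_upwards [hPr, hQs] with u hu hu'
  rw [Polynomial.eval_sub]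
  linear_combination hu' - hu

lemma IsPrincipalPart.sub {f g : ℂ → ℂ} {a : ℂ} {P Q : Polynomial ℂ}
    (hP : IsPrincipalPart f a P) (hQ : IsPrincipalPart g a Q) :
    IsPrincipalPart (fun u => f u - g u) a (P - Q) := by
  obtain ⟨hP0, r, hr, hPr⟩ := hP
  obtain ⟨hQ0, s, hs, hQs⟩ := hQ
  refine ⟨by simp [hP0, hQ0], fun u => r u - s u, hr.sub hs, ?_⟩
  filter_upwards [hPr, hQs] with u hu hu'
  rw [hu, hu', Polynomial.eval_sub]
  ring

lemma IsPrincipalPart.principalPart_eq {f : ℂ → ℂ} {a : ℂ} {P : Polynomial ℂ}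
    (hP : IsPrincipalPart f a P) : principalPart f a = fun u => P.eval (u - a)⁻¹ := by
  have h : ∃ P, IsPrincipalPart f a P := ⟨P, hP⟩
  rw [principalPart, dif_pos h, h.choose_spec.unique hP]

/-- The default value `0` need not be compatible with subtraction, hence the meromorphy of both
functions; `meromorphicAt_polarB` supplies it in the application. -/
lemma principalPart_sub {f g : ℂ → ℂ} {a : ℂ} (hf : MeromorphicAt f a) (hg : MeromorphicAt g a)
    (u : ℂ) :
    principalPart (fun t => f t - g t) a u = principalPart f a u - principalPart g a u := by
  obtain ⟨P, hP⟩ := exists_isPrincipalPart hf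
  obtain ⟨Q, hQ⟩ := exists_isPrincipalPart hg
  rw [hP.principalPart_eq, hQ.principalPart_eq, (hP.sub hQ).principalPart_eq]
  simp

/-- The default value is the case `P = 0`, so regularity off `a` holds unconditionally. -/
lemma principalPart_eq_eval (f : ℂ → ℂ) (a : ℂ) :
    ∃ P : Polynomial ℂ, principalPart f a = fun u => P.eval (u - a)⁻¹ := by
  by_cases h : ∃ P, IsPrincipalPart f a P
  · exact ⟨_, h.choose_spec.principalPart_eq⟩
  · exact ⟨0, by rw [principalPart, dif_neg h]; ext; simp⟩

lemma analyticAt_principalPart (f : ℂ → ℂ) {a u : ℂ} (hu : u ≠ a) :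
    AnalyticAt ℂ (principalPart f a) u := by
  obtain ⟨P, hP⟩ := principalPart_eq_eval f a
  rw [hP]
  simp only [Polynomial.eval_eq_sum_range]
  exact Finset.analyticAt_fun_sum _ fun i _ => analyticAt_const.mul
    (((analyticAt_id.sub analyticAt_const).inv (sub_ne_zero.2 hu)).pow i)

lemma meromorphicAt_principalPart (f : ℂ → ℂ) (a u : ℂ) :
    MeromorphicAt (principalPart f a) u := by
  obtain ⟨P, hP⟩ := principalPart_eq_eval f a
  rw [hP]
  simp only [Polynomial.eval_eq_sum_range]
  exact MeromorphicAt.fun_sum fun i _ => (MeromorphicAt.const _ _).mul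
    (((MeromorphicAt.id u).sub (MeromorphicAt.const a u)).inv.pow i)

/-- The principal part at a simple pole. -/
lemma principalPart_simplePole {f h : ℂ → ℂ} {a : ℂ} (hh : AnalyticAt ℂ h a)
    (hf : ∀ᶠ u in 𝓝[≠] a, f u = h u / (u - a)) (u : ℂ) :
    principalPart f a u = h a / (u - a) := by
  have hP : IsPrincipalPart f a (Polynomial.C (h a) * Polynomial.X) := by
    refine ⟨by simp, dslope h a, ?_, ?_⟩
    · obtain ⟨ps, hps⟩ := hh
      exact hps.has_fpower_series_dslope_fslope.analyticAt
    · filter_upwards [hf, self_mem_nhdsWithin] with u hu hua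
      have : u - a ≠ 0 := sub_ne_zero.2 hua
      rw [hu, dslope_of_ne _ hua, slope_def_field]
      simp
      field_simp
      ring
  rw [hP.principalPart_eq]
  simp [div_eq_mul_inv]

/-! ### The curve of tangencies -/

lemma exists_analytic_leftRightInverse {X : ℂ → ℂ} {a : ℂ} (hX : AnalyticAt ℂ X 0)
    (hX0 : X 0 = 0) (hXa : HasDerivAt X a 0) (ha : a ≠ 0) :
    ∃ Y : ℂ → ℂ, AnalyticAt ℂ Y 0 ∧ Y 0 = 0 ∧ (∀ᶠ x in 𝓝 0, Y (X x) = x) ∧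
      ∀ᶠ t in 𝓝 0, X (Y t) = t := by
  have hs : HasStrictDerivAt X a 0 := hXa.deriv ▸ hX.hasStrictDerivAt
  have hs' := hs.hasStrictFDerivAt_equiv ha
  -- Here `⊤` is the analytic class, so the local inverse is analytic.
  have hc : ContDiffAt ℂ ⊤ X 0 := hX.contDiffAt
  refine ⟨hs'.localInverse, ?_, ?_, hs'.eventually_left_inverse, ?_⟩
  · have := hc.to_localInverse hs'.hasFDerivAt (by simp)
    rw [hX0] at this
    rw [← contDiffWithinAt_univ] at this
    exact analyticWithinAt_univ.1 (contDiffWithinAt_omega_iff_analyticWithinAt.1 this)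
  · have := hs'.eventually_left_inverse.self_of_nhds
    rwa [hX0] at this
  · have := hs'.eventually_right_inverse
    rwa [hX0] at this

/-- Multiplicativity of the determinant; through it tangency loci are carried along by
biholomorphisms. -/
lemma det_map_eq (L : ℂ × ℂ →L[ℂ] ℂ × ℂ) (a b : ℂ × ℂ) :
    (L a).1 * (L b).2 - (L a).2 * (L b).1 =
      ((L (1, 0)).1 * (L (0, 1)).2 - (L (1, 0)).2 * (L (0, 1)).1) *
        (a.1 * b.2 - a.2 * b.1) := by
  have key : ∀ a : ℂ × ℂ, L a = a.1 • L (1, 0) + a.2 • L (0, 1) := fun a => by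
    rw [← map_smul, ← map_smul, ← map_add]
    simp
  rw [key a, key b]
  simp only [Prod.fst_add, Prod.snd_add, Prod.smul_fst, Prod.smul_snd, smul_eq_mul]
  ring

/-- The image of the curve of tangencies of two model foliations, when it is a graph over the
`x`-axis, under a germ of biholomorphism fixing the divisor. -/
lemma exists_isTangencyBranch {H X Y V W : ℂ × ℂ → ℂ × ℂ} {c : ℂ} {w : ℂ → ℂ}
    (hH : IsLocalBiholomorphism H (0, c)) (hdiv : ∀ᶠ u in 𝓝 c, H (0, u) = (0, u))
    (hX : MapsFoliation H X V {(0, c)}) (hY : MapsFoliation H Y W {(0, c)})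
    (hw : AnalyticAt ℂ w 0) (hw0 : w 0 = c)
    (hloc : ∀ᶠ y in 𝓝 ((0 : ℂ), c), y ∈ tangencyLocus X Y ↔ y.2 = w y.1) :
    ∃ π, IsTangencyBranch V W c π ∧ ∀ᶠ x in 𝓝 (0 : ℂ), π (H (x, w x)).1 = (H (x, w x)).2 := by
  obtain ⟨hHa, e, he⟩ := hH
  have hst : HasStrictFDerivAt H (e : ℂ × ℂ →L[ℂ] ℂ × ℂ) (0, c) := he ▸ hHa.hasStrictFDerivAt
  have hH0 : H (0, c) = (0, c) := hdiv.self_of_nhds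
  have hmap : map H (𝓝 (0, c)) = 𝓝 (0, c) := by
    simpa [hH0] using hst.map_nhds_eq_of_equiv
  have hHt : Tendsto H (𝓝 (0, c)) (𝓝 (0, c)) := hmap.le
  -- the differential at the base point
  have hL01 : fderiv ℂ H (0, c) (0, 1) = (0, 1) := by
    have h1 : HasDerivAt (fun u : ℂ => ((0 : ℂ), u)) ((0 : ℂ), (1 : ℂ)) c :=
      (hasDerivAt_const c 0).prodMk (hasDerivAt_id c)
    have h2 := hHa.differentiableAt.hasFDerivAt.comp_hasDerivAt c h1
    refine h2.unique (h1.congr_of_eventuallyEq ?_)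
    filter_upwards [hdiv] with u hu
    simpa using hu
  set a := (fderiv ℂ H (0, c) (1, 0)).1 with ha_def
  -- Otherwise `dH (1, 0)` would be a multiple of `(0, 1) = dH (0, 1)`, against injectivity of `dH`.
  -- Hence the image of the graph of `w` is again transverse to the divisor.
  have ha : a ≠ 0 := by
    intro ha0
    have h1 : fderiv ℂ H (0, c) (1, 0) =
        fderiv ℂ H (0, c) (0, (fderiv ℂ H (0, c) (1, 0)).2) := by
      have : ((0 : ℂ), (fderiv ℂ H (0, c) (1, 0)).2) =
          (fderiv ℂ H (0, c) (1, 0)).2 • ((0 : ℂ), (1 : ℂ)) := by simp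
      rw [this, map_smul, hL01]
      ext
      · simpa using ha0
      · simp
    rw [← he] at h1
    have := e.injective h1
    simp at this
  have hdet : ∀ᶠ z in 𝓝 ((0 : ℂ), c), (fderiv ℂ H z (1, 0)).1 * (fderiv ℂ H z (0, 1)).2
      - (fderiv ℂ H z (1, 0)).2 * (fderiv ℂ H z (0, 1)).1 ≠ 0 := by
    have hc : ∀ v : ℂ × ℂ, ContinuousAt (fun z => fderiv ℂ H z v) (0, c) := fun v =>
      (ContinuousLinearMap.apply ℂ (ℂ × ℂ) v).continuous.continuousAt.comp
        hHa.fderiv.continuousAt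
    refine ContinuousAt.eventually_ne (((hc (1, 0)).fst.mul (hc (0, 1)).snd).sub
      ((hc (1, 0)).snd.mul (hc (0, 1)).fst)) ?_
    simpa [hL01] using ha
  have hiff : ∀ᶠ z in 𝓝 ((0 : ℂ), c), H z ∈ tangencyLocus V W ↔ z ∈ tangencyLocus X Y := by
    obtain ⟨f, hf, hf0, hfX⟩ := hX
    obtain ⟨g, hg, hg0, hgY⟩ := hY
    rw [nhdsSet_singleton] at hfX hgY
    filter_upwards [hfX, hgY, hdet, (hf _ rfl).continuousAt.eventually_ne (hf0 _ rfl),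
      (hg _ rfl).continuousAt.eventually_ne (hg0 _ rfl)] with z h1 h2 h3 h4 h5
    have key := det_map_eq (fderiv ℂ H z) (X z) (Y z)
    rw [h1, h2] at key
    simp only [Prod.smul_fst, Prod.smul_snd, smul_eq_mul] at key
    have key' : f z * g z * ((V (H z)).1 * (W (H z)).2 - (V (H z)).2 * (W (H z)).1) =
      ((fderiv ℂ H z (1, 0)).1 * (fderiv ℂ H z (0, 1)).2
        - (fderiv ℂ H z (1, 0)).2 * (fderiv ℂ H z (0, 1)).1) *
      ((X z).1 * (Y z).2 - (X z).2 * (Y z).1) := by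
      rw [← key]; ring
    simp only [tangencyLocus, Set.mem_ofPred_eq]
    constructor
    · intro h
      rw [h, mul_zero, eq_comm, mul_eq_zero] at key'
      exact key'.resolve_left h3
    · intro h
      rw [h, mul_zero, mul_eq_zero] at key'
      exact key'.resolve_left (mul_ne_zero h4 h5)
  -- the parametrized curve
  have hγ : AnalyticAt ℂ (fun x => (x, w x)) 0 := analyticAt_id.prod hw
  have hγ0 : (fun x => (x, w x)) 0 = ((0 : ℂ), c) := by simp [hw0]
  have hHγ : AnalyticAt ℂ (fun x => H (x, w x)) 0 := hHa.comp_of_eq hγ hγ0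
  have hγt : Tendsto (fun x => (x, w x)) (𝓝 0) (𝓝 (0, c)) := by
    simpa [hw0] using hγ.continuousAt.tendsto
  have hXa : HasDerivAt (fun x => (H (x, w x)).1) a 0 := by
    have h1 : HasDerivAt (fun x => (x, w x)) ((1 : ℂ), deriv w 0) 0 :=
      (hasDerivAt_id 0).prodMk hw.differentiableAt.hasDerivAt
    have h2 : HasFDerivAt H (fderiv ℂ H (0, c)) (0, w 0) := by
      rw [hw0]
      exact hHa.differentiableAt.hasFDerivAt
    have h3 := (ContinuousLinearMap.fst ℂ ℂ ℂ).hasFDerivAt.comp_hasDerivAt (0 : ℂ)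
      (h2.comp_hasDerivAt (0 : ℂ) h1)
    refine h3.congr_deriv ?_
    have : ((1 : ℂ), deriv w 0) = (1, 0) + deriv w 0 • ((0 : ℂ), (1 : ℂ)) := by simp
    rw [this, map_add, map_smul, hL01]
    simp [a]
  -- `Z` recovers the parameter of the curve from the first coordinate of its image; the branch is
  -- the second coordinate as a function of the first.
  obtain ⟨Z, hZ, hZ0, hZX, hXZ⟩ := exists_analytic_leftRightInverse
    (X := fun x => (H (x, w x)).1) (analyticAt_fst.comp hHγ : AnalyticAt ℂ (fun x => (H (x, w x)).1) 0)
    (by simp [hw0, hH0]) hXa ha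
  have hπ : ∀ᶠ x in 𝓝 (0 : ℂ), (H (Z (H (x, w x)).1, w (Z (H (x, w x)).1))).2
      = (H (x, w x)).2 := by
    filter_upwards [hZX] with x hx
    rw [hx]
  refine ⟨fun t => (H (Z t, w (Z t))).2, ⟨?_, ?_, ?_⟩, hπ⟩
  · have h1 : AnalyticAt ℂ (fun x => (H (x, w x)).2) 0 := analyticAt_snd.comp hHγ
    exact h1.comp_of_eq hZ hZ0
  · simp [hZ0, hw0, hH0]
  -- Every point near `(0, c)` is some `H z`, so the equivalence is checked at `H z`.
  · rw [← hmap, eventually_map]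
    have hfst : Tendsto (fun z => (H z).1) (𝓝 (0, c)) (𝓝 0) :=
      (continuous_fst.tendsto ((0 : ℂ), c)).comp hHt
    have hZt : Tendsto (fun z => Z (H z).1) (𝓝 (0, c)) (𝓝 0) := by
      have : Tendsto Z (𝓝 0) (𝓝 0) := by simpa [hZ0] using hZ.continuousAt.tendsto
      exact this.comp hfst
    have hinv := hst.eventually_left_inverse
    filter_upwards [hiff, hloc, hinv, (hγt.comp hZt).eventually hinv, hfst.eventually hXZ,
      (continuous_fst.tendsto ((0 : ℂ), c)).eventually hπ] with
      z h1 h2 h3 h4 h5 h6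
    rw [h1, h2]
    constructor
    · intro h
      have hz : z = (z.1, w z.1) := by rw [← h]
      rw [hz]
      exact h6.symm
    · intro h
      -- The curve point over the same first coordinate has the same image as `z`; local injectivity
      -- puts `z` on the curve.
      have h7 : H (Z (H z).1, w (Z (H z).1)) = H z := Prod.ext h5 h.symm
      simp only [Function.comp] at h4
      rw [h7, h3] at h4
      have h8 := congrArg Prod.fst h4
      have h9 := congrArg Prod.snd h4
      simp only at h8 h9
      rw [← h8] at h9
      exact h9

/-! ### Comparison of two curves of tangencies -/

lemma eventuallyEq_of_punctured {f g : ℂ → ℂ} {c : ℂ} (hf : AnalyticAt ℂ f c)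
    (hg : AnalyticAt ℂ g c) (h : f =ᶠ[𝓝[≠] c] g) : f =ᶠ[𝓝 c] g :=
  (hf.frequently_eq_iff_eventually_eq hg).1 h.frequently

/-- The normal form gives coefficients only off the marked points; their values there are obtained
as limits at removable singularities. -/
lemma eq_of_tendsto_punctured {f g : ℂ → ℂ} {c l : ℂ} (hf : AnalyticAt ℂ f c)
    (h : f =ᶠ[𝓝[≠] c] g) (hg : Tendsto g (𝓝[≠] c) (𝓝 l)) : f c = l :=
  tendsto_nhds_unique ((hf.continuousAt.tendsto.mono_left nhdsWithin_le_nhds).congr' h) hg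

lemma coeffX_sub {k : ℕ} {F G : ℂ × ℂ → ℂ} {u : ℂ} (hF : AnalyticAt ℂ F (0, u))
    (hG : AnalyticAt ℂ G (0, u)) :
    coeffX k (fun y => F y - G y) u = coeffX k F u - coeffX k G u :=
  taylorCoeff_sub (hF.comp_of_eq (f := fun x => (x, u)) (by fun_prop) rfl)
    (hG.comp_of_eq (f := fun x => (x, u)) (by fun_prop) rfl)

/-- Comparison of the coefficients of order `k` of two curves of tangencies. -/
lemma taylorCoeff_branch_sub {k : ℕ} {H H' : ℂ × ℂ → ℂ × ℂ} {c β ω : ℂ}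
    (hH : AnalyticAt ℂ H (0, c)) (hH' : AnalyticAt ℂ H' (0, c))
    (hdiv : ∀ᶠ u in 𝓝 c, H (0, u) = (0, u)) (hdiv' : ∀ᶠ u in 𝓝 c, H' (0, u) = (0, u))
    (h1 : ∀ r, 1 ≤ r → r ≤ k →
      coeffX r (fun y => (H y).1) =ᶠ[𝓝[≠] c] coeffX r (fun y => (H' y).1))
    (h2 : ∀ r, 1 ≤ r → r < k →
      coeffX r (fun y => (H y).2) =ᶠ[𝓝[≠] c] coeffX r (fun y => (H' y).2))
    (hβ : coeffX k (fun y => (H y).2) c - coeffX k (fun y => (H' y).2) c = β)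
    (ha : coeffX 1 (fun y => (H y).1) c = 1)
    {w w' π π' : ℂ → ℂ} (hw : AnalyticAt ℂ w 0) (hw' : AnalyticAt ℂ w' 0)
    (hw0 : w 0 = c) (hw0' : w' 0 = c)
    (hww' : (fun x => w x - w' x - ω * x ^ k) =o[𝓝 0] fun x => x ^ k)
    (hπ : AnalyticAt ℂ π 0) (hπ' : AnalyticAt ℂ π' 0)
    (hc : ∀ᶠ x in 𝓝 (0 : ℂ), π (H (x, w x)).1 = (H (x, w x)).2)
    (hc' : ∀ᶠ x in 𝓝 (0 : ℂ), π' (H' (x, w' x)).1 = (H' (x, w' x)).2) :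
    taylorCoeff k π 0 - taylorCoeff k π' 0 = ω + β := by
  have a1 : AnalyticAt ℂ (fun y => (H y).1) (0, c) := analyticAt_fst.comp hH
  have a1' : AnalyticAt ℂ (fun y => (H' y).1) (0, c) := analyticAt_fst.comp hH'
  have a2 : AnalyticAt ℂ (fun y => (H y).2) (0, c) := analyticAt_snd.comp hH
  have a2' : AnalyticAt ℂ (fun y => (H' y).2) (0, c) := analyticAt_snd.comp hH'
  -- Subtracting `u` makes the second component vanish on the divisor, as `isLittleO_comp_sub_comp`
  -- requires. The removed part comes back as `w - w'` and contributes `ω`.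
  have b2 : AnalyticAt ℂ (fun y => (H y).2 - y.2) (0, c) := a2.sub analyticAt_snd
  have b2' : AnalyticAt ℂ (fun y => (H' y).2 - y.2) (0, c) := a2'.sub analyticAt_snd
  have z1 : ∀ᶠ u in 𝓝 c, (H (0, u)).1 = 0 := hdiv.mono fun u hu => by rw [hu]
  have z1' : ∀ᶠ u in 𝓝 c, (H' (0, u)).1 = 0 := hdiv'.mono fun u hu => by rw [hu]
  have z2 : ∀ᶠ u in 𝓝 c, (H (0, u)).2 - u = 0 := hdiv.mono fun u hu => by rw [hu]; simp
  have z2' : ∀ᶠ u in 𝓝 c, (H' (0, u)).2 - u = 0 := hdiv'.mono fun u hu => by rw [hu]; simp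
  have h1' : ∀ r ≤ k, coeffX r (fun y => (H y).1) =ᶠ[𝓝 c] coeffX r (fun y => (H' y).1) := by
    intro r hr
    rcases Nat.eq_zero_or_pos r with rfl | hr0
    · filter_upwards [z1, z1'] with u hu hu'
      rw [coeffX_zero, coeffX_zero, hu, hu']
    · exact eventuallyEq_of_punctured (analyticAt_coeffX a1 r) (analyticAt_coeffX a1' r)
        (h1 r hr0 hr)
  have h2' : ∀ r < k, coeffX r (fun y => (H y).2 - y.2) =ᶠ[𝓝 c]
      coeffX r (fun y => (H' y).2 - y.2) := by
    intro r hr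
    rcases Nat.eq_zero_or_pos r with rfl | hr0
    · filter_upwards [z2, z2'] with u hu hu'
      rw [coeffX_zero, coeffX_zero, hu, hu']
    · have hcont : Tendsto (fun u => ((0 : ℂ), u)) (𝓝 c) (𝓝 (0, c)) :=
        Continuous.tendsto' (by fun_prop) _ _ rfl
      filter_upwards [eventuallyEq_of_punctured (analyticAt_coeffX a2 r)
        (analyticAt_coeffX a2' r) (h2 r hr0 hr), hcont.eventually a2.eventually_analyticAt,
        hcont.eventually a2'.eventually_analyticAt] with u hu hu1 hu2
      rw [coeffX_sub hu1 analyticAt_snd, coeffX_sub hu2 analyticAt_snd, hu]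
  have hwt : Tendsto w (𝓝 0) (𝓝 c) := by simpa [hw0] using hw.continuousAt.tendsto
  have hwt' : Tendsto w' (𝓝 0) (𝓝 c) := by simpa [hw0'] using hw'.continuousAt.tendsto
  have hid : (fun x : ℂ => x - x) =o[𝓝 0] fun x : ℂ => x := by simp
  have hid' : (fun x : ℂ => x - x) =o[𝓝 0] fun x : ℂ => x ^ k := by simp
  have hwO := isBigO_of_isLittleO_sub hww'
  have hXX' := isLittleO_comp_sub_comp (ψ := fun x => x) (ψ' := fun x => x) a1 a1' z1 z1'
    (fun r hr => h1' r hr.le) hid hid hid' hwt hwt' hwO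
  have hUU' := isLittleO_comp_sub_comp (ψ := fun x => x) (ψ' := fun x => x) b2 b2' z2 z2'
    h2' hid hid hid' hwt hwt' hwO
  have hX : AnalyticAt ℂ (fun x => (H (x, w x)).1) 0 :=
    a1.comp_of_eq (f := fun x => (x, w x)) (analyticAt_id.prod hw) (by simp [hw0])
  have hX' : AnalyticAt ℂ (fun x => (H' (x, w' x)).1) 0 :=
    a1'.comp_of_eq (f := fun x => (x, w' x)) (analyticAt_id.prod hw') (by simp [hw0'])
  have hX0 : (H (0, w 0)).1 = 0 := by rw [hw0]; exact z1.self_of_nhds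
  have hX0' : (H' (0, w' 0)).1 = 0 := by rw [hw0']; exact z1'.self_of_nhds
  have hX1 : deriv (fun x => (H (x, w x)).1) 0 = 1 := by
    have h0 : ∀ r, coeffX r (fun _ => (0 : ℂ)) = fun _ => 0 := fun r => by
      ext u
      simp [coeffX, taylorCoeff]
    -- Comparison with the zero function at order `1` shows that the derivative of the first
    -- component along the curve is its first coefficient at `c`.
    have h := isLittleO_comp_sub_comp (k := 1) (ψ := fun x => x) (ψ' := fun x => x) (v' := w)
      (e' := fun _ => 0) a1 analyticAt_const z1 (by simp)
      (fun r hr => by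
        obtain rfl : r = 0 := by omega
        filter_upwards [z1] with u hu
        rw [coeffX_zero, coeffX_zero, hu]) hid hid (by simp) hwt hwt
      (by simpa using isBigO_zero (fun x : ℂ => x) (𝓝 (0 : ℂ)))
    have := taylorCoeff_sub_of_isLittleO hX analyticAt_const h
    rw [ha, h0, taylorCoeff_one, taylorCoeff_one] at this
    simpa using this
  refine taylorCoeff_sub_of_conj hπ hπ' hX hX0 hX1 (by simpa [hX0'] using hX'.continuousAt.tendsto)
    (hXX'.congr_left fun x => ?_) hc hc' ((hUU'.add hww').congr_left fun x => ?_)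
  · rw [(h1' k le_rfl).self_of_nhds]
    ring
  · rw [coeffX_sub a2 analyticAt_snd, coeffX_sub a2' analyticAt_snd, ← hβ]
    ring

/-! ### The local computation at a tangency point -/

/-- The critical point of `g = (q - u) (I - q)`, where `I` is an involution at `q`. -/
lemma exists_deriv_eq_mul {I : ℂ → ℂ} {q : ℂ} (hI : AnalyticAt ℂ I q) (hIq : I q = q)
    (hI1 : deriv I q = -1) {g : ℂ → ℂ} (hg : ∀ u, g u = (q - u) * (I u - q)) :
    AnalyticAt ℂ g q ∧ ∃ h, AnalyticAt ℂ h q ∧ h q = 2 ∧ deriv h q = iteratedDeriv 3 g q / 2 ∧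
      ∀ u, deriv g u = (u - q) * h u := by
  have hga : AnalyticAt ℂ g q := by
    rw [funext hg]
    fun_prop
  have hdg : deriv g =ᶠ[𝓝 q] fun u => -(I u - q) + (q - u) * deriv I u := by
    filter_upwards [hI.eventually_analyticAt] with u hu
    rw [funext hg]
    have h1 : HasDerivAt (fun u => q - u) (-1) u := (hasDerivAt_id u).const_sub q
    have h2 : HasDerivAt (fun u => I u - q) (deriv I u) u :=
      hu.differentiableAt.hasDerivAt.sub_const q
    rw [(h1.fun_mul h2).deriv]
    ring
  have hdg0 : deriv g q = 0 := by
    rw [hdg.eq_of_nhds, hIq]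
    ring
  -- At `q` the second derivative of `(q - u)(I - q)` is `-2 I'(q)`.
  have hddg : deriv (deriv g) q = 2 := by
    rw [hdg.deriv_eq]
    have h1 : HasDerivAt (fun u => q - u) (-1) q := (hasDerivAt_id q).const_sub q
    have h2 : HasDerivAt (fun u => -(I u - q)) (-deriv I q) q :=
      (hI.differentiableAt.hasDerivAt.sub_const q).neg
    rw [(h2.fun_add (h1.fun_mul hI.deriv.differentiableAt.hasDerivAt)).deriv, hI1]
    ring
  have hha : AnalyticAt ℂ (dslope (deriv g) q) q := by
    obtain ⟨ps, hps⟩ := hga.deriv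
    exact hps.has_fpower_series_dslope_fslope.analyticAt
  have hfac : ∀ u, deriv g u = (u - q) * dslope (deriv g) q u := fun u => by
    have := sub_smul_dslope (deriv g) q u
    rw [hdg0, sub_zero, smul_eq_mul] at this
    exact this.symm
  refine ⟨hga, dslope (deriv g) q, hha, by rw [dslope_same, hddg], ?_, hfac⟩
  set h := dslope (deriv g) q
  -- Differentiating `g' = (u - q) h` twice gives `g'''(q) = 2 h'(q)`.
  have h2 : deriv (deriv g) =ᶠ[𝓝 q] fun u => h u + (u - q) * deriv h u := by
    filter_upwards [hha.eventually_analyticAt] with u hu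
    rw [funext hfac]
    have h1 : HasDerivAt (fun u => u - q) 1 u := (hasDerivAt_id u).sub_const q
    rw [(h1.fun_mul hu.differentiableAt.hasDerivAt).deriv]
    ring
  rw [iteratedDeriv_succ, iteratedDeriv_succ, iteratedDeriv_one, h2.deriv_eq]
  have h1 : HasDerivAt (fun u => u - q) 1 q := (hasDerivAt_id q).sub_const q
  rw [(hha.differentiableAt.hasDerivAt.fun_add
    (h1.fun_mul hha.deriv.differentiableAt.hasDerivAt)).deriv]
  ring

/-- A simple pole with residue `ζ / (σ(q)^k h(q)) = ζ / 2`: the source of the factor `1/2` in the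
theorem. -/
lemma principalPart_div_pow_mul {σ h g' : ℂ → ℂ} {q : ℂ} (hσ : AnalyticAt ℂ σ q) (hσq : σ q = 1)
    (hh : AnalyticAt ℂ h q) (hhq : h q = 2) (hg' : ∀ u, g' u = (u - q) * h u) (ζ : ℂ) (k : ℕ)
    (u : ℂ) :
    principalPart (fun t => ζ / (σ t ^ k * g' t)) q u = ζ / (2 * (u - q)) := by
  have h1 : AnalyticAt ℂ (fun t => ζ / (σ t ^ k * h t)) q :=
    analyticAt_const.div ((hσ.pow k).mul hh) (by simp [hσq, hhq])
  rw [principalPart_simplePole h1, hσq, hhq, one_pow, one_mul, div_div]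
  refine Eventually.of_forall fun t => ?_
  rw [hg', div_div]
  ring_nf

/-- The poles at `q` both have residue `1/2` and cancel. The difference is minus the slope of `σ^k
h` at `q`, where its value is `2`, divided by `2 h`. -/
lemma tendsto_inv_sub_div {σ h g' : ℂ → ℂ} {q : ℂ} (hσ : AnalyticAt ℂ σ q) (hσq : σ q = 1)
    (hh : AnalyticAt ℂ h q) (hhq : h q = 2) (hg' : ∀ u, g' u = (u - q) * h u) (k : ℕ) :
    Tendsto (fun u => 1 / g' u - σ u ^ k / (2 * (u - q))) (𝓝[≠] q)
      (𝓝 (-(k * deriv σ q + deriv h q / 2) / 2)) := by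
  have hd : HasDerivAt (fun u => σ u ^ k * h u) (k * deriv σ q * 2 + deriv h q) q := by
    refine ((hσ.differentiableAt.hasDerivAt.pow k).mul
      hh.differentiableAt.hasDerivAt).congr_deriv ?_
    simp [hσq, hhq]
  have h1 := hd.tendsto_slope
  have h2 : Tendsto (fun u => -slope (fun u => σ u ^ k * h u) q u / (2 * h u)) (𝓝[≠] q)
      (𝓝 (-(k * deriv σ q * 2 + deriv h q) / (2 * h q))) :=
    h1.neg.div ((hh.continuousAt.tendsto.mono_left nhdsWithin_le_nhds).const_mul 2)
      (by simp [hhq])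
  have h3 : -(k * deriv σ q * 2 + deriv h q) / (2 * h q) =
      -(k * deriv σ q + deriv h q / 2) / 2 := by
    rw [hhq]; ring
  rw [h3] at h2
  refine h2.congr' ?_
  filter_upwards [self_mem_nhdsWithin, (hh.continuousAt.eventually_ne
    (by rw [hhq]; exact two_ne_zero)).filter_mono nhdsWithin_le_nhds] with u hu hu0
  have : u - q ≠ 0 := sub_ne_zero.2 hu
  rw [slope_def_field, hg', hσq, hhq]
  field_simp
  ring

namespace NormalizingData

variable {n m : ℕ} {D D' : NormalizingData n m} {p : Fin (n + 1) → ℂ} {q : Fin m → ℂ}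

/-! ### Regularity of the data and agreement up to a given order -/

/-- The local regularity and normalization conditions on the data. -/
structure IsRegular (D : NormalizingData n m) (p : Fin (n + 1) → ℂ) (q : Fin m → ℂ) : Prop where
  s_analytic : ∀ i, AnalyticAt ℂ (D.s i) 0
  s_zero : ∀ i, D.s i 0 = 0
  z_analytic : ∀ j, AnalyticAt ℂ (D.z j) 0
  z_zero : ∀ j, D.z j 0 = 0
  eps_analytic : ∀ i, AnalyticAt ℂ (D.eps i) (0, p i)
  eps_divisor : ∀ i, ∀ᶠ u in 𝓝 (p i), D.eps i (0, u) = 0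
  eps_one : ∀ i, coeffX 1 (D.eps i) (p i) = 1
  sig_analytic : ∀ j, AnalyticAt ℂ (D.sig j) (0, q j)
  sig_divisor : ∀ j, ∀ᶠ u in 𝓝 (q j), D.sig j (0, u) = 0
  sig_one : ∀ j, coeffX 1 (D.sig j) (q j) = 1
  phi_spec : ∀ j, ∀ᶠ u in 𝓝[≠] (q j), AnalyticAt ℂ (D.phi j) (0, u) ∧ D.phi j (0, u) = u ∧
    ∀ᶠ y in 𝓝 ((0 : ℂ), u), D.g q j (D.phi j y) = D.g q j y.2 + D.z j y.1
  invol_analytic : ∀ j, AnalyticAt ℂ (D.I j) (q j)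
  invol_fix : ∀ j, D.I j (q j) = q j
  invol_deriv : ∀ j, deriv (D.I j) (q j) = -1

lemma IsNormalizing.isRegular {F G Fμ : ℂ × ℂ → ℂ × ℂ} (h : D.IsNormalizing p q F G Fμ)
    (hG : MemD q D.I G) : D.IsRegular p q where
  s_analytic := h.s_analytic
  s_zero := h.s_zero
  z_analytic := h.z_analytic
  z_zero := h.z_zero
  eps_analytic := h.eps_analytic
  eps_divisor := h.eps_divisor
  eps_one := h.eps_one
  sig_analytic := h.sig_analytic
  sig_divisor := h.sig_divisor
  sig_one := h.sig_one
  phi_spec := h.phi_spec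
  invol_analytic := hG.invol_analytic
  invol_fix := hG.invol_fix
  invol_deriv := hG.invol_deriv

lemma IsRegular.exists_deriv_g (h : D.IsRegular p q) (j : Fin m) :
    AnalyticAt ℂ (D.g q j) (q j) ∧ ∃ f, AnalyticAt ℂ f (q j) ∧ f (q j) = 2 ∧
      deriv f (q j) = iteratedDeriv 3 (D.g q j) (q j) / 2 ∧
      ∀ u, deriv (D.g q j) u = (u - q j) * f u :=
  exists_deriv_eq_mul (h.invol_analytic j) (h.invol_fix j) (h.invol_deriv j) fun _ => rfl

lemma IsRegular.eventually_deriv_g_ne_zero (h : D.IsRegular p q) (j : Fin m) :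
    ∀ᶠ u in 𝓝[≠] (q j), deriv (D.g q j) u ≠ 0 := by
  obtain ⟨-, f, hf, hf2, -, hgf⟩ := h.exists_deriv_g j
  filter_upwards [self_mem_nhdsWithin, (hf.continuousAt.eventually_ne
    (by rw [hf2]; exact two_ne_zero)).filter_mono nhdsWithin_le_nhds] with u hu hfu
  rw [hgf]
  exact mul_ne_zero (sub_ne_zero.2 hu) hfu

/-- The data of order `< k` of `D` and `D'` agree. -/
structure AgreeBelow (D D' : NormalizingData n m) (p : Fin (n + 1) → ℂ) (q : Fin m → ℂ)
    (k : ℕ) : Prop where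
  lam : D.lam = D'.lam
  s : ∀ i r, 1 ≤ r → r < k → taylorCoeff r (D.s i) 0 = taylorCoeff r (D'.s i) 0
  z : ∀ j r, 1 ≤ r → r < k → taylorCoeff r (D.z j) 0 = taylorCoeff r (D'.z j) 0
  g : ∀ j, D.g q j =ᶠ[𝓝 (q j)] D'.g q j
  eps : ∀ i r, 1 ≤ r → r < k → coeffX r (D.eps i) =ᶠ[𝓝 (p i)] coeffX r (D'.eps i)
  sig : ∀ j r, 1 ≤ r → r < k → coeffX r (D.sig j) =ᶠ[𝓝 (q j)] coeffX r (D'.sig j)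

lemma AgreeBelow.mono {k l : ℕ} (h : AgreeBelow D D' p q k) (hl : l ≤ k) :
    AgreeBelow D D' p q l where
  lam := h.lam
  s i r h1 h2 := h.s i r h1 (h2.trans_le hl)
  z j r h1 h2 := h.z j r h1 (h2.trans_le hl)
  g := h.g
  eps i r h1 h2 := h.eps i r h1 (h2.trans_le hl)
  sig j r h1 h2 := h.sig j r h1 (h2.trans_le hl)

lemma agreeBelow_of_lowerData_eq {k : ℕ} (h : D.lowerData p q k = D'.lowerData p q k) :
    AgreeBelow D D' p q k where
  lam := congrArg LowerData.lam h
  s i r h1 h2 := by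
    -- The index in `Fin (k - 1)` stands for the order one higher.
    have := congrFun (congrFun (congrArg LowerData.s h) i) ⟨r - 1, by omega⟩
    simpa [lowerData, Nat.sub_add_cancel h1] using this
  z j r h1 h2 := by
    have := congrFun (congrFun (congrArg LowerData.z h) j) ⟨r - 1, by omega⟩
    simpa [lowerData, Nat.sub_add_cancel h1] using this
  g j := Germ.coe_eq.1 (congrFun (congrArg LowerData.g h) j)
  eps i r h1 h2 := by
    have := congrFun (congrFun (congrArg LowerData.eps h) i) ⟨r - 1, by omega⟩
    simp only [lowerData, Nat.sub_add_cancel h1] at this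
    exact Germ.coe_eq.1 this
  sig j r h1 h2 := by
    have := congrFun (congrFun (congrArg LowerData.sig h) j) ⟨r - 1, by omega⟩
    simp only [lowerData, Nat.sub_add_cancel h1] at this
    exact Germ.coe_eq.1 this

lemma AgreeBelow.s_sub {k : ℕ} (h : AgreeBelow D D' p q k) (hD : D.IsRegular p q)
    (hD' : D'.IsRegular p q) (i : Fin (n + 1)) :
    (fun x => D.s i x - D'.s i x - (taylorCoeff k (D.s i) 0 - taylorCoeff k (D'.s i) 0) * x ^ k)
      =o[𝓝 0] fun x => x ^ k := by
  refine isLittleO_sub_of_taylorCoeff_eq (hD.s_analytic i) (hD'.s_analytic i) fun r hr => ?_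
  rcases Nat.eq_zero_or_pos r with rfl | h0
  · rw [taylorCoeff_zero, taylorCoeff_zero, hD.s_zero, hD'.s_zero]
  · exact h.s i r h0 hr

lemma AgreeBelow.z_sub {k : ℕ} (h : AgreeBelow D D' p q k) (hD : D.IsRegular p q)
    (hD' : D'.IsRegular p q) (j : Fin m) :
    (fun x => D.z j x - D'.z j x - (taylorCoeff k (D.z j) 0 - taylorCoeff k (D'.z j) 0) * x ^ k)
      =o[𝓝 0] fun x => x ^ k := by
  refine isLittleO_sub_of_taylorCoeff_eq (hD.z_analytic j) (hD'.z_analytic j) fun r hr => ?_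
  rcases Nat.eq_zero_or_pos r with rfl | h0
  · rw [taylorCoeff_zero, taylorCoeff_zero, hD.z_zero, hD'.z_zero]
  · exact h.z j r h0 hr

/-! ### The coefficients of the canonical solutions off the divisor points -/

/-- The points of the divisor different from all `p_i` and `q_j`. -/
def IsOff (p : Fin (n + 1) → ℂ) (q : Fin m → ℂ) (u : ℂ) : Prop :=
  (∀ i, u ≠ p i) ∧ ∀ j, u ≠ q j

lemma eventually_isOff (p : Fin (n + 1) → ℂ) (q : Fin m → ℂ) (c : ℂ) :
    ∀ᶠ u in 𝓝[≠] c, IsOff p q u := by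
  have key : ∀ a : ℂ, ∀ᶠ u in 𝓝[≠] c, u ≠ a := fun a => by
    rcases eq_or_ne a c with rfl | h
    · exact self_mem_nhdsWithin
    · exact (eventually_ne_nhds h.symm).filter_mono nhdsWithin_le_nhds
  exact (eventually_all.2 fun i => key (p i)).and (eventually_all.2 fun j => key (q j))

lemma analyticAt_nextA (k : ℕ) (A : ℂ × ℂ → ℂ) {u : ℂ} (hu : IsOff p q u) :
    AnalyticAt ℂ (D.nextA p q k A) u :=
  (Finset.analyticAt_fun_sum _ fun i _ => analyticAt_principalPart _ (hu.1 i)).neg.sub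
    (Finset.analyticAt_fun_sum _ fun j _ => analyticAt_principalPart _ (hu.2 j))

lemma analyticAt_nextB (k : ℕ) (B : ℂ × ℂ → ℂ) {u : ℂ} (hu : IsOff p q u) :
    AnalyticAt ℂ (D.nextB p q k B) u :=
  (Finset.analyticAt_fun_sum _ fun i _ => analyticAt_principalPart _ (hu.1 i)).neg.sub
    (Finset.analyticAt_fun_sum _ fun j _ => analyticAt_principalPart _ (hu.2 j))

lemma analyticAt_bOne {u : ℂ} (hu : IsOff p q u) : AnalyticAt ℂ (D.bOne q) u :=
  (Finset.analyticAt_fun_sum _ fun j _ => analyticAt_principalPart _ (hu.2 j)).neg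

lemma meromorphicAt_bOne (u : ℂ) : MeromorphicAt (D.bOne q) u :=
  (MeromorphicAt.fun_sum fun j _ => meromorphicAt_principalPart _ (q j) u).neg

lemma meromorphicAt_nextB (k : ℕ) (B : ℂ × ℂ → ℂ) (u : ℂ) :
    MeromorphicAt (D.nextB p q k B) u :=
  (MeromorphicAt.fun_sum fun i _ => meromorphicAt_principalPart _ (p i) u).neg.sub
    (MeromorphicAt.fun_sum fun j _ => meromorphicAt_principalPart _ (q j) u)

/-- The shape `c u + β(u) x + O(x^2)` of `isLittleO_polynomial_comp`, with `c = 0`, `β = 1`; for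
`truncB` it is `c = 1`, `β = b_{n,1}`. -/
lemma truncA_succ (k : ℕ) (y : ℂ × ℂ) :
    D.truncA p q (k + 1) y = 0 * y.2 + 1 * y.1
      + ∑ r ∈ Finset.range k, D.aN p q (r + 2) y.2 * y.1 ^ (r + 2) := by
  induction k with
  | zero => simp [truncA]
  | succ k ih =>
    rw [Finset.sum_range_succ, ← add_assoc, ← ih]
    rfl

lemma truncB_succ (k : ℕ) (y : ℂ × ℂ) :
    D.truncB p q (k + 1) y = 1 * y.2 + D.bOne q y.2 * y.1
      + ∑ r ∈ Finset.range k, D.bN p q (r + 2) y.2 * y.1 ^ (r + 2) := by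
  induction k with
  | zero => simp [truncB]
  | succ k ih =>
    rw [Finset.sum_range_succ, ← add_assoc, ← ih]
    rfl

/-! ### Comparison of compositions -/

/-- At `t = 0` the base is `1`, inside the slit plane, so the principal branch is analytic. -/
lemma analyticAt_cpow_model (a lam : ℂ) :
    AnalyticAt ℂ (fun t : ℂ => (1 + t / a) ^ lam) 0 := by
  refine AnalyticAt.cpow ?_ analyticAt_const ?_
  · simp only [div_eq_mul_inv]
    fun_prop
  · simp

lemma IsRegular.analyticAt_eps_Psi (hD : D.IsRegular p q) (i : Fin (n + 1)) {u : ℂ}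
    (he : AnalyticAt ℂ (D.eps i) (0, u)) :
    AnalyticAt ℂ (fun x => D.eps i (D.Psi p i (x, u))) 0 := by
  have h1 : AnalyticAt ℂ (fun x => (1 + D.s i x / (u - p i)) ^ D.lam i) 0 :=
    (analyticAt_cpow_model (u - p i) (D.lam i)).comp_of_eq (hD.s_analytic i) (hD.s_zero i)
  have h2 : AnalyticAt ℂ (fun x => D.Psi p i (x, u)) 0 :=
    (analyticAt_id.mul h1).prod (analyticAt_const.add (hD.s_analytic i))
  exact he.comp_of_eq h2 (by simp [Psi, hD.s_zero])

/-- The coefficients of order `k` of `T ∘ ξ_i ∘ Ψ_i` for data that agree up to order `< k`. -/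
lemma coeffX_comp_p_sub {k N : ℕ} (hD : D.IsRegular p q) (hD' : D'.IsRegular p q)
    (h : AgreeBelow D D' p q k) {c : ℂ} {β : ℂ → ℂ} {t : ℕ → ℂ → ℂ}
    (hβ : ∀ u, IsOff p q u → AnalyticAt ℂ β u) (ht : ∀ r u, IsOff p q u → AnalyticAt ℂ (t r) u)
    {T : ℂ × ℂ → ℂ}
    (hT : ∀ y, T y = c * y.2 + β y.2 * y.1 + ∑ r ∈ Finset.range N, t r y.2 * y.1 ^ (r + 2))
    (i : Fin (n + 1)) :
    ∀ᶠ u in 𝓝[≠] (p i), coeffX k (fun y => T (D.xi i (D.Psi p i y))) u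
      - coeffX k (fun y => T (D'.xi i (D'.Psi p i y))) u =
        c * (taylorCoeff k (D.s i) 0 - taylorCoeff k (D'.s i) 0)
          + β u * (coeffX k (D.eps i) u - coeffX k (D'.eps i) u) := by
  have hcont : Tendsto (fun u => ((0 : ℂ), u)) (𝓝 (p i)) (𝓝 (0, p i)) :=
    Continuous.tendsto' (by fun_prop) _ _ rfl
  have hall : ∀ᶠ u in 𝓝 (p i), ∀ r ∈ Finset.range k,
      coeffX r (D.eps i) =ᶠ[𝓝 u] coeffX r (D'.eps i) := by
    rw [eventually_all_finset]
    intro r hr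
    rw [Finset.mem_range] at hr
    rw [eventually_eventuallyEq_nhds]
    rcases Nat.eq_zero_or_pos r with rfl | h0
    · filter_upwards [hD.eps_divisor i, hD'.eps_divisor i] with u hu hu'
      rw [coeffX_zero, coeffX_zero, hu, hu']
    · exact h.eps i r h0 hr
  filter_upwards [eventually_isOff p q (p i),
    (hcont.eventually (hD.eps_analytic i).eventually_analyticAt).filter_mono nhdsWithin_le_nhds,
    (hcont.eventually (hD'.eps_analytic i).eventually_analyticAt).filter_mono nhdsWithin_le_nhds,
    (hD.eps_divisor i).eventually_nhds.filter_mono nhdsWithin_le_nhds,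
    (hD'.eps_divisor i).eventually_nhds.filter_mono nhdsWithin_le_nhds,
    hall.filter_mono nhdsWithin_le_nhds] with u hoff he he' he0 he0' hee'
  have hs := h.s_sub hD hD' i
  have hsO := isBigO_of_isLittleO_sub hs
  have hst : Tendsto (D.s i) (𝓝 0) (𝓝 0) := by
    simpa [hD.s_zero] using (hD.s_analytic i).continuousAt.tendsto
  have hst' : Tendsto (D'.s i) (𝓝 0) (𝓝 0) := by
    simpa [hD'.s_zero] using (hD'.s_analytic i).continuousAt.tendsto
  have hf := analyticAt_cpow_model (u - p i) (D.lam i)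
  have hψ : ∀ {s : ℂ → ℂ}, Tendsto s (𝓝 0) (𝓝 0) →
      (fun x => x * (1 + s x / (u - p i)) ^ D.lam i - x) =o[𝓝 0] fun x => x := by
    intro s hs
    have h1 : (fun x => (1 + s x / (u - p i)) ^ D.lam i - 1) =o[𝓝 0] fun _ : ℂ => (1 : ℂ) := by
      rw [isLittleO_one_iff]
      simpa using (hf.continuousAt.tendsto.comp hs).sub_const 1
    refine ((isBigO_refl (fun x : ℂ => x) (𝓝 0)).mul_isLittleO h1).congr (fun x => ?_)
      fun x => ?_ <;> ring
  -- The factor `x` gains one order over `s_i - s_i' = O(x^k)`: the first component of `Ψ_i` does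
  -- not see `s_{i,k}` at order `k`.
  have hψψ' : (fun x => x * (1 + D.s i x / (u - p i)) ^ D.lam i
      - x * (1 + D'.s i x / (u - p i)) ^ D.lam i) =o[𝓝 0] fun x => x ^ k := by
    have h1 := (isBigO_comp_sub_comp hf hst hst').trans hsO
    have h2 : (fun x : ℂ => x) =o[𝓝 0] fun _ : ℂ => (1 : ℂ) :=
      (isLittleO_one_iff ℂ).2 tendsto_id
    refine (h2.mul_isBigO h1).congr (fun x => ?_) fun x => ?_ <;> ring
  have hv : Tendsto (fun x => u + D.s i x) (𝓝 0) (𝓝 u) := by simpa using hst.const_add u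
  have hv' : Tendsto (fun x => u + D'.s i x) (𝓝 0) (𝓝 u) := by simpa using hst'.const_add u
  have hEE' := isLittleO_comp_sub_comp he he' he0 he0'
    (fun r hr => hee' r (Finset.mem_range.2 hr)) (hψ hst) (hψ hst') hψψ' hv hv'
    (hsO.congr_left fun x => by ring)
  have ha := hD.analyticAt_eps_Psi i he
  have ha' := hD'.analyticAt_eps_Psi i he'
  have hE : (fun x => D.eps i (D.Psi p i (x, u))) =O[𝓝 0] fun x => x := by
    simpa [Psi, hD.s_zero, he0.self_of_nhds] using ha.differentiableAt.isBigO_sub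
  have hE' : (fun x => D'.eps i (D'.Psi p i (x, u))) =O[𝓝 0] fun x => x := by
    simpa [Psi, hD'.s_zero, he0'.self_of_nhds] using ha'.differentiableAt.isBigO_sub
  have hlam : D'.lam i = D.lam i := by rw [h.lam]
  have key := isLittleO_polynomial_comp (ε := coeffX k (D.eps i) u - coeffX k (D'.eps i) u)
    (ν := taylorCoeff k (D.s i) 0 - taylorCoeff k (D'.s i) 0) (hβ u hoff) (fun r => ht r u hoff) hT hE hE' hv hv'
    (by simpa [Psi, hlam] using hEE') (hs.congr_left fun x => by ring)
  exact taylorCoeff_sub_of_isLittleO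
    (analyticAt_polynomial_comp (hβ u hoff) (fun r => ht r u hoff) hT ha
      (analyticAt_const.add (hD.s_analytic i)) (show u + D.s i 0 = u by simp [hD.s_zero]))
    (analyticAt_polynomial_comp (hβ u hoff) (fun r => ht r u hoff) hT ha'
      (analyticAt_const.add (hD'.s_analytic i)) (show u + D'.s i 0 = u by simp [hD'.s_zero])) key

/-- Solutions of `g (v x) = g u + z x` for right-hand sides that agree up to order `< k`. -/
lemma isLittleO_sub_of_comp_eq {k : ℕ} {g v v' z z' : ℂ → ℂ} {u ζ : ℂ} (hg : AnalyticAt ℂ g u)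
    (hg0 : deriv g u ≠ 0) (hv : Tendsto v (𝓝 0) (𝓝 u)) (hv' : Tendsto v' (𝓝 0) (𝓝 u))
    (hz : ∀ᶠ x in 𝓝 0, g (v x) = g u + z x) (hz' : ∀ᶠ x in 𝓝 0, g (v' x) = g u + z' x)
    (hzz' : (fun x => z x - z' x - ζ * x ^ k) =o[𝓝 0] fun x => x ^ k) :
    (fun x => v x - v' x - ζ / deriv g u * x ^ k) =o[𝓝 0] fun x => x ^ k := by
  have hvv : Tendsto (fun x => (v x, v' x)) (𝓝 0) (𝓝 (u, u)) := by
    rw [nhds_prod_eq]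
    exact hv.prodMk hv'
  -- Strict differentiability at `u`: since `g'(u) ≠ 0`, the difference `v - v'` is equivalent to
  -- that of the right-hand sides divided by `g'(u)`.
  have h1 : (fun x => g (v x) - g (v' x) - (v x - v' x) * deriv g u)
      =o[𝓝 0] fun x => v x - v' x := by
    have := hg.hasStrictDerivAt.isLittleO.comp_tendsto hvv
    simpa [Function.comp_def] using this
  have h2 : IsEquivalent (𝓝 0) (fun x => g (v x) - g (v' x))
      fun x => (v x - v' x) * deriv g u :=
    h1.trans_isBigO ((isBigO_refl (fun x => v x - v' x) (𝓝 0)).mul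
      (isBigO_const_const (1 : ℂ) hg0 (𝓝 0)) |>.congr_left fun x => by ring)
  have h3 : (fun x => g (v x) - g (v' x)) =ᶠ[𝓝 0] fun x => z x - z' x := by
    filter_upwards [hz, hz'] with x hx hx'
    rw [hx, hx']
    ring
  have h4 : (fun x => v x - v' x) =O[𝓝 0] fun x => x ^ k := by
    have := (h2.symm.isBigO.trans (h3.isBigO.trans (isBigO_of_isLittleO_sub hzz'))).const_mul_left
      (deriv g u)⁻¹
    refine this.congr_left fun x => ?_
    field_simp
  refine (((hzz'.sub (h1.trans_isBigO h4)).const_mul_left (deriv g u)⁻¹)).congr' ?_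
    EventuallyEq.rfl
  filter_upwards [h3] with x hx
  rw [hx]
  field_simp
  ring

/-- The coefficients of order `k` of `T ∘ ζ_j ∘ Φ_j` for data that agree up to order `< k`. -/
lemma coeffX_comp_q_sub {k N : ℕ} (hD : D.IsRegular p q) (hD' : D'.IsRegular p q)
    (h : AgreeBelow D D' p q k) {c : ℂ} {β : ℂ → ℂ} {t : ℕ → ℂ → ℂ}
    (hβ : ∀ u, IsOff p q u → AnalyticAt ℂ β u) (ht : ∀ r u, IsOff p q u → AnalyticAt ℂ (t r) u)
    {T : ℂ × ℂ → ℂ}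
    (hT : ∀ y, T y = c * y.2 + β y.2 * y.1 + ∑ r ∈ Finset.range N, t r y.2 * y.1 ^ (r + 2))
    (j : Fin m) :
    ∀ᶠ u in 𝓝[≠] (q j), coeffX k (fun y => T (D.zeta j (D.Phi j y))) u
      - coeffX k (fun y => T (D'.zeta j (D'.Phi j y))) u =
        c * ((taylorCoeff k (D.z j) 0 - taylorCoeff k (D'.z j) 0) / deriv (D.g q j) u)
          + β u * (coeffX k (D.sig j) u - coeffX k (D'.sig j) u) := by
  have hcont : Tendsto (fun u => ((0 : ℂ), u)) (𝓝 (q j)) (𝓝 (0, q j)) :=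
    Continuous.tendsto' (by fun_prop) _ _ rfl
  have hall : ∀ᶠ u in 𝓝 (q j), ∀ r ∈ Finset.range k,
      coeffX r (D.sig j) =ᶠ[𝓝 u] coeffX r (D'.sig j) := by
    rw [eventually_all_finset]
    intro r hr
    rw [Finset.mem_range] at hr
    rw [eventually_eventuallyEq_nhds]
    rcases Nat.eq_zero_or_pos r with rfl | h0
    · filter_upwards [hD.sig_divisor j, hD'.sig_divisor j] with u hu hu'
      rw [coeffX_zero, coeffX_zero, hu, hu']
    · exact h.sig j r h0 hr
  filter_upwards [eventually_isOff p q (q j),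
    (hcont.eventually (hD.sig_analytic j).eventually_analyticAt).filter_mono nhdsWithin_le_nhds,
    (hcont.eventually (hD'.sig_analytic j).eventually_analyticAt).filter_mono nhdsWithin_le_nhds,
    (hD.sig_divisor j).eventually_nhds.filter_mono nhdsWithin_le_nhds,
    (hD'.sig_divisor j).eventually_nhds.filter_mono nhdsWithin_le_nhds,
    hall.filter_mono nhdsWithin_le_nhds, hD.phi_spec j, hD'.phi_spec j,
    hD.eventually_deriv_g_ne_zero j,
    (hD.exists_deriv_g j).1.eventually_analyticAt.filter_mono nhdsWithin_le_nhds,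
    (eventually_eventuallyEq_nhds.2 (h.g j)).filter_mono nhdsWithin_le_nhds]
    with u hoff he he' he0 he0' hee' ⟨hφ, hφ0, hφg⟩ ⟨hφ', hφ0', hφg'⟩ hg0 hga hgg'
  have hline : Tendsto (fun x : ℂ => (x, u)) (𝓝 0) (𝓝 (0, u)) :=
    Continuous.tendsto' (by fun_prop) _ _ rfl
  have hva : AnalyticAt ℂ (fun x => D.phi j (x, u)) 0 :=
    hφ.comp_of_eq (f := fun x => (x, u)) (by fun_prop) rfl
  have hva' : AnalyticAt ℂ (fun x => D'.phi j (x, u)) 0 :=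
    hφ'.comp_of_eq (f := fun x => (x, u)) (by fun_prop) rfl
  have hv : Tendsto (fun x => D.phi j (x, u)) (𝓝 0) (𝓝 u) := by
    simpa [hφ0] using hva.continuousAt.tendsto
  have hv' : Tendsto (fun x => D'.phi j (x, u)) (𝓝 0) (𝓝 u) := by
    simpa [hφ0'] using hva'.continuousAt.tendsto
  have hvv' := isLittleO_sub_of_comp_eq (v' := fun x => D'.phi j (x, u)) (z' := D'.z j) hga hg0
    hv hv' (hline.eventually hφg) (by
      filter_upwards [hline.eventually hφg', hv'.eventually hgg'] with x hx hx'
      rw [hx', hx, hgg'.self_of_nhds]) (h.z_sub hD hD' j)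
  have hid : (fun x : ℂ => x - x) =o[𝓝 0] fun x : ℂ => x := by simp
  have hid' : (fun x : ℂ => x - x) =o[𝓝 0] fun x : ℂ => x ^ k := by simp
  have hEE' := isLittleO_comp_sub_comp (ψ := fun x => x) (ψ' := fun x => x) he he' he0 he0'
    (fun r hr => hee' r (Finset.mem_range.2 hr)) hid hid hid' hv hv'
    (isBigO_of_isLittleO_sub hvv')
  have ha : AnalyticAt ℂ (fun x => D.sig j (x, D.phi j (x, u))) 0 :=
    he.comp_of_eq (analyticAt_id.prod hva) (by simp [hφ0])
  have ha' : AnalyticAt ℂ (fun x => D'.sig j (x, D'.phi j (x, u))) 0 :=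
    he'.comp_of_eq (analyticAt_id.prod hva') (by simp [hφ0'])
  have hE : (fun x => D.sig j (x, D.phi j (x, u))) =O[𝓝 0] fun x => x := by
    simpa [hφ0, he0.self_of_nhds] using ha.differentiableAt.isBigO_sub
  have hE' : (fun x => D'.sig j (x, D'.phi j (x, u))) =O[𝓝 0] fun x => x := by
    simpa [hφ0', he0'.self_of_nhds] using ha'.differentiableAt.isBigO_sub
  exact taylorCoeff_sub_of_isLittleO
    (analyticAt_polynomial_comp (hβ u hoff) (fun r => ht r u hoff) hT ha hva hφ0)
    (analyticAt_polynomial_comp (hβ u hoff) (fun r => ht r u hoff) hT ha' hva' hφ0')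
    (isLittleO_polynomial_comp (hβ u hoff) (fun r => ht r u hoff) hT hE hE' hv hv' hEE' hvv')

/-! ### Dependence of the canonical solutions on the data -/

lemma analyticAt_aN (k : ℕ) {u : ℂ} (hu : IsOff p q u) : AnalyticAt ℂ (D.aN p q k) u := by
  match k with
  | 0 => exact analyticAt_const
  | 1 => exact analyticAt_const
  | k + 2 => exact analyticAt_nextA _ _ hu

lemma analyticAt_bN (k : ℕ) {u : ℂ} (hu : IsOff p q u) : AnalyticAt ℂ (D.bN p q k) u := by
  match k with
  | 0 => exact analyticAt_const
  | 1 => exact analyticAt_bOne hu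
  | k + 2 => exact analyticAt_nextB _ _ hu

lemma meromorphicAt_bN (k : ℕ) (u : ℂ) : MeromorphicAt (D.bN p q k) u := by
  match k with
  | 0 => exact MeromorphicAt.const _ _
  | 1 => exact meromorphicAt_bOne u
  | k + 2 => exact meromorphicAt_nextB _ _ u

lemma AgreeBelow.deriv_g {k : ℕ} (h : AgreeBelow D D' p q k) (j : Fin m) :
    deriv (D.g q j) =ᶠ[𝓝[≠] (q j)] deriv (D'.g q j) :=
  (h.g j).deriv.filter_mono nhdsWithin_le_nhds

lemma AgreeBelow.eps_punctured {k r : ℕ} (h : AgreeBelow D D' p q k) (i : Fin (n + 1))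
    (h1 : 1 ≤ r) (h2 : r < k) :
    coeffX r (D.eps i) =ᶠ[𝓝[≠] (p i)] coeffX r (D'.eps i) :=
  (h.eps i r h1 h2).filter_mono nhdsWithin_le_nhds

lemma AgreeBelow.sig_punctured {k r : ℕ} (h : AgreeBelow D D' p q k) (j : Fin m)
    (h1 : 1 ≤ r) (h2 : r < k) :
    coeffX r (D.sig j) =ᶠ[𝓝[≠] (q j)] coeffX r (D'.sig j) :=
  (h.sig j r h1 h2).filter_mono nhdsWithin_le_nhds

/-- `b_{n,1}` is built from `z_{j,1}`, `ς_{j,1}` and `g_j`, which are lower-order data once `k ≥ 2`.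
-/
lemma bOne_eq {k : ℕ} (hk : 2 ≤ k) (h : AgreeBelow D D' p q k) : D.bOne q = D'.bOne q := by
  funext u
  rw [bOne, bOne]
  congr 1
  refine Finset.sum_congr rfl fun j _ => congrFun (principalPart_congr ?_) u
  filter_upwards [h.deriv_g j, h.sig_punctured j le_rfl hk] with t h1 h2
  rw [h1, h2, h.z j 1 le_rfl hk]

/-- With `c = 0` and `β = 1`, the composition varies at order `k` by `ε_{i,k} - ε'_{i,k}`, exactly
what `resAp` subtracts. -/
lemma resAp_eventuallyEq {k r : ℕ} (hD : D.IsRegular p q) (hD' : D'.IsRegular p q)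
    (h : AgreeBelow D D' p q k) (hT : D.truncA p q (r + 1) = D'.truncA p q (r + 1))
    (i : Fin (n + 1)) :
    D.resAp p k (D.truncA p q (r + 1)) i =ᶠ[𝓝[≠] (p i)]
      D'.resAp p k (D'.truncA p q (r + 1)) i := by
  rw [← hT]
  filter_upwards [coeffX_comp_p_sub hD hD' h (β := fun _ => 1) (fun _ _ => analyticAt_const)
    (fun r u hu => analyticAt_aN (r + 2) hu) (truncA_succ r) i] with u hu
  rw [resAp, resAp]
  linear_combination hu

lemma resAq_eventuallyEq {k r : ℕ} (hD : D.IsRegular p q) (hD' : D'.IsRegular p q)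
    (h : AgreeBelow D D' p q k) (hT : D.truncA p q (r + 1) = D'.truncA p q (r + 1))
    (j : Fin m) :
    D.resAq k (D.truncA p q (r + 1)) j =ᶠ[𝓝[≠] (q j)]
      D'.resAq k (D'.truncA p q (r + 1)) j := by
  rw [← hT]
  filter_upwards [coeffX_comp_q_sub hD hD' h (β := fun _ => 1) (fun _ _ => analyticAt_const)
    (fun r u hu => analyticAt_aN (r + 2) hu) (truncA_succ r) j] with u hu
  rw [resAq, resAq]
  linear_combination hu

/-- With `c = 1` and `β = b_{n,1}`, the variation at order `k` is that of `s_{i,k} + ε_{i,k}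
b_{n,1}`, exactly what `resBp` subtracts. -/
lemma resBp_eventuallyEq {k r : ℕ} (hk : 2 ≤ k) (hD : D.IsRegular p q) (hD' : D'.IsRegular p q)
    (h : AgreeBelow D D' p q k) (hT : D.truncB p q (r + 1) = D'.truncB p q (r + 1))
    (i : Fin (n + 1)) :
    D.resBp p q k (D.truncB p q (r + 1)) i =ᶠ[𝓝[≠] (p i)]
      D'.resBp p q k (D'.truncB p q (r + 1)) i := by
  rw [← hT]
  filter_upwards [coeffX_comp_p_sub hD hD' h (fun u hu => analyticAt_bOne hu)
    (fun r u hu => analyticAt_bN (r + 2) hu) (truncB_succ r) i] with u hu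
  rw [resBp, resBp, ← bOne_eq hk h]
  linear_combination hu

lemma resBq_eventuallyEq {k r : ℕ} (hk : 2 ≤ k) (hD : D.IsRegular p q) (hD' : D'.IsRegular p q)
    (h : AgreeBelow D D' p q k) (hT : D.truncB p q (r + 1) = D'.truncB p q (r + 1))
    (j : Fin m) :
    D.resBq q k (D.truncB p q (r + 1)) j =ᶠ[𝓝[≠] (q j)]
      D'.resBq q k (D'.truncB p q (r + 1)) j := by
  rw [← hT]
  filter_upwards [h.deriv_g j, coeffX_comp_q_sub hD hD' h (fun u hu => analyticAt_bOne hu)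
    (fun r u hu => analyticAt_bN (r + 2) hu) (truncB_succ r) j] with u hg hu
  rw [resBq, resBq, ← bOne_eq hk h, ← hg]
  linear_combination hu

lemma nextA_eq {k r : ℕ} (hk : 2 ≤ k) (hD : D.IsRegular p q) (hD' : D'.IsRegular p q)
    (h : AgreeBelow D D' p q k) (hT : D.truncA p q (r + 1) = D'.truncA p q (r + 1)) :
    D.nextA p q k (D.truncA p q (r + 1)) = D'.nextA p q k (D'.truncA p q (r + 1)) := by
  funext u
  rw [nextA, nextA]
  congr 1
  · congr 1
    refine Finset.sum_congr rfl fun i _ => congrFun (principalPart_congr ?_) u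
    filter_upwards [resAp_eventuallyEq hD hD' h hT i, h.eps_punctured i le_rfl hk] with t h1 h2
    rw [h1, h2]
  · refine Finset.sum_congr rfl fun j _ => congrFun (principalPart_congr ?_) u
    filter_upwards [resAq_eventuallyEq hD hD' h hT j, h.sig_punctured j le_rfl hk] with t h1 h2
    rw [h1, h2]

lemma truncA_eq {k r : ℕ} (hr : r + 2 ≤ k) (hD : D.IsRegular p q) (hD' : D'.IsRegular p q)
    (h : AgreeBelow D D' p q k) : D.truncA p q (r + 1) = D'.truncA p q (r + 1) := by
  induction r with
  | zero => rfl
  | succ r ih =>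
    have hT := ih (by omega)
    rw [truncA, truncA,
      nextA_eq (k := r + 2) (by omega) hD hD' (h.mono (by omega)) hT, hT]

lemma aN_eq {k : ℕ} (hk : 2 ≤ k) (hD : D.IsRegular p q) (hD' : D'.IsRegular p q)
    (h : AgreeBelow D D' p q k) : D.aN p q k = D'.aN p q k := by
  obtain ⟨r, rfl⟩ := Nat.exists_eq_add_of_le' hk
  exact nextA_eq hk hD hD' h (truncA_eq le_rfl hD hD' h)

/-- The function whose principal part at `q_j` enters `b_{n,k}`. -/
def polarB (D : NormalizingData n m) (p : Fin (n + 1) → ℂ) (q : Fin m → ℂ) (k : ℕ) (j : Fin m)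
    (t : ℂ) : ℂ :=
  taylorCoeff k (D.z j) 0 / (coeffX 1 (D.sig j) t ^ k * deriv (D.g q j) t)
    + D.resBq q k (D.truncB p q (k - 1)) j t / coeffX 1 (D.sig j) t ^ k

/-- The contributions of the `p_i` to `b_{n,k}` involve no data of order `k`. -/
lemma sum_principalPart_resBp_eq {k r : ℕ} (hk : 2 ≤ k) (hD : D.IsRegular p q)
    (hD' : D'.IsRegular p q) (h : AgreeBelow D D' p q k)
    (hT : D.truncB p q (r + 1) = D'.truncB p q (r + 1)) (u : ℂ) :
    ∑ i, principalPart (fun t => D.resBp p q k (D.truncB p q (r + 1)) i t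
        / coeffX 1 (D.eps i) t ^ k) (p i) u =
      ∑ i, principalPart (fun t => D'.resBp p q k (D'.truncB p q (r + 1)) i t
        / coeffX 1 (D'.eps i) t ^ k) (p i) u := by
  refine Finset.sum_congr rfl fun i _ => congrFun (principalPart_congr ?_) u
  filter_upwards [resBp_eventuallyEq hk hD hD' h hT i, h.eps_punctured i le_rfl hk] with t h1 h2
  rw [h1, h2]

/-- Unlike `a_{n,k}`, the coefficient `b_{n,k}` contains the numbers `z_{j,k}`, whence agreement
below `k + 1`. -/
lemma nextB_eq {k r : ℕ} (hk : 2 ≤ k) (hD : D.IsRegular p q) (hD' : D'.IsRegular p q)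
    (h : AgreeBelow D D' p q (k + 1)) (hT : D.truncB p q (r + 1) = D'.truncB p q (r + 1)) :
    D.nextB p q k (D.truncB p q (r + 1)) = D'.nextB p q k (D'.truncB p q (r + 1)) := by
  have h' := h.mono k.le_succ
  funext u
  rw [nextB, nextB, sum_principalPart_resBp_eq hk hD hD' h' hT]
  congr 1
  refine Finset.sum_congr rfl fun j _ => congrFun (principalPart_congr ?_) u
  filter_upwards [resBq_eventuallyEq hk hD hD' h' hT j, h'.sig_punctured j le_rfl hk,
    h.deriv_g j] with t h1 h2 h3
  rw [h1, h2, h3, h.z j k (by omega) (by omega)]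

lemma truncB_eq {k r : ℕ} (hr : r + 2 ≤ k) (hD : D.IsRegular p q) (hD' : D'.IsRegular p q)
    (h : AgreeBelow D D' p q k) : D.truncB p q (r + 1) = D'.truncB p q (r + 1) := by
  induction r with
  | zero =>
    funext y
    rw [truncB, truncB, bOne_eq hr h]
  | succ r ih =>
    have hT := ih (by omega)
    rw [truncB, truncB,
      nextB_eq (k := r + 2) (by omega) hD hD' (h.mono (by omega)) hT, hT]

lemma bN_eq {k : ℕ} (hk : 2 ≤ k) (hD : D.IsRegular p q) (hD' : D'.IsRegular p q)
    (h : AgreeBelow D D' p q (k + 1)) : D.bN p q k = D'.bN p q k := by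
  obtain ⟨r, rfl⟩ := Nat.exists_eq_add_of_le' hk
  exact nextB_eq hk hD hD' h (truncB_eq (by omega) hD hD' h)

lemma IsRegular.analyticAt_sig_one (hD : D.IsRegular p q) (j : Fin m) :
    AnalyticAt ℂ (coeffX 1 (D.sig j)) (q j) :=
  analyticAt_coeffX (hD.sig_analytic j) 1

lemma IsRegular.eventually_sig_one_ne_zero (hD : D.IsRegular p q) (j : Fin m) :
    ∀ᶠ u in 𝓝[≠] (q j), coeffX 1 (D.sig j) u ≠ 0 :=
  ((hD.analyticAt_sig_one j).continuousAt.eventually_ne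
    (by rw [hD.sig_one]; exact one_ne_zero)).filter_mono nhdsWithin_le_nhds

lemma IsRegular.principalPart_inv (hD : D.IsRegular p q) (j : Fin m) (ζ : ℂ) (k : ℕ) (u : ℂ) :
    principalPart (fun t => ζ / (coeffX 1 (D.sig j) t ^ k * deriv (D.g q j) t)) (q j) u =
      ζ / (2 * (u - q j)) := by
  obtain ⟨-, f, hf, hf2, -, hgf⟩ := hD.exists_deriv_g j
  exact principalPart_div_pow_mul (hD.analyticAt_sig_one j) (hD.sig_one j) hf hf2 hgf ζ k u

lemma IsRegular.bOne_apply (hD : D.IsRegular p q) (u : ℂ) :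
    D.bOne q u = -∑ j, taylorCoeff 1 (D.z j) 0 / (2 * (u - q j)) := by
  rw [bOne]
  congr 1
  refine Finset.sum_congr rfl fun j _ => ?_
  simpa using hD.principalPart_inv j (taylorCoeff 1 (D.z j) 0) 1 u

/-- The coefficient `b_{n,k}` depends on the data of order `k` through the numbers `z_{j,k}`
only, and this dependence is explicit. -/
lemma bN_sub {k : ℕ} (hk : 2 ≤ k) (hD : D.IsRegular p q) (hD' : D'.IsRegular p q)
    (h : AgreeBelow D D' p q k) (hm : ∀ j, MeromorphicAt (D.polarB p q k j) (q j))
    (hm' : ∀ j, MeromorphicAt (D'.polarB p q k j) (q j)) (u : ℂ) :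
    D.bN p q k u - D'.bN p q k u =
      -∑ j, (taylorCoeff k (D.z j) 0 - taylorCoeff k (D'.z j) 0) / (2 * (u - q j)) := by
  obtain ⟨r, rfl⟩ := Nat.exists_eq_add_of_le' hk
  have hT : D.truncB p q (r + 1) = D'.truncB p q (r + 1) := truncB_eq le_rfl hD hD' h
  -- The terms `𝐁_{q_j}` cancel and leave only the simple pole of `Δz / (ς_{j,1}^k g_j')`.
  have key : ∀ j, principalPart (D.polarB p q (r + 2) j) (q j) u
      - principalPart (D'.polarB p q (r + 2) j) (q j) u =
      (taylorCoeff (r + 2) (D.z j) 0 - taylorCoeff (r + 2) (D'.z j) 0) / (2 * (u - q j)) := by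
    intro j
    rw [← principalPart_sub (hm j) (hm' j), ← hD.principalPart_inv j _ (r + 2)]
    refine congrFun (principalPart_congr ?_) u
    filter_upwards [resBq_eventuallyEq hk hD hD' h hT j, h.sig_punctured j le_rfl hk,
      h.deriv_g j] with t h1 h2 h3
    simp only [polarB, Nat.add_succ_sub_one, h1, ← h2, ← h3]
    ring
  have e : D.bN p q (r + 2) u = -(∑ i, principalPart (fun t =>
      D.resBp p q (r + 2) (D.truncB p q (r + 1)) i t / coeffX 1 (D.eps i) t ^ (r + 2)) (p i) u)
      - ∑ j, principalPart (D.polarB p q (r + 2) j) (q j) u := rfl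
  have e' : D'.bN p q (r + 2) u = -(∑ i, principalPart (fun t =>
      D'.resBp p q (r + 2) (D'.truncB p q (r + 1)) i t / coeffX 1 (D'.eps i) t ^ (r + 2)) (p i) u)
      - ∑ j, principalPart (D'.polarB p q (r + 2) j) (q j) u := rfl
  rw [e, e', sum_principalPart_resBp_eq hk hD hD' h hT, ← Finset.sum_congr rfl fun j _ => key j,
    Finset.sum_sub_distrib]
  ring

/-- If `b_{q_j,k}` extends holomorphically, the principal part entering `b_{n,k}` exists. -/
lemma meromorphicAt_polarB {k : ℕ} (hk : 2 ≤ k) (hD : D.IsRegular p q) {j : Fin m} {b : ℂ → ℂ}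
    (hb : AnalyticAt ℂ b (q j)) (h : b =ᶠ[𝓝[≠] (q j)] D.bQ p q k j) :
    MeromorphicAt (D.polarB p q k j) (q j) := by
  -- The definition of `b_{q_j,k}` is solved for the polar term. Its meromorphy thus comes from the
  -- holomorphy of `b`, since `φ_j` is controlled only off `q_j`.
  have h1 : MeromorphicAt (fun u => (b u - coeffX k (D.sig j) u * D.bOne q u)
      / coeffX 1 (D.sig j) u ^ k - D.bN p q k u) (q j) :=
    ((hb.meromorphicAt.sub ((analyticAt_coeffX (hD.sig_analytic j) k).meromorphicAt.mul
      (meromorphicAt_bOne (q j)))).div ((hD.analyticAt_sig_one j).pow k).meromorphicAt).sub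
      (meromorphicAt_bN k (q j))
  refine h1.congr ?_
  filter_upwards [h, hD.eventually_sig_one_ne_zero j, hD.eventually_deriv_g_ne_zero j]
    with u hu h0 h0'
  rw [hu, bQ, if_neg (by omega), polarB]
  field_simp
  ring

/-! ### Dependence of the normalizing transformations on the data -/

/-- The only datum of order `k` in `a_{p_i,k}` is `ε_{i,k}`. -/
lemma aP_eventuallyEq {k : ℕ} (hk : 1 ≤ k) (hD : D.IsRegular p q) (hD' : D'.IsRegular p q)
    (h : AgreeBelow D D' p q k) {i : Fin (n + 1)}
    (he : coeffX k (D.eps i) =ᶠ[𝓝[≠] (p i)] coeffX k (D'.eps i)) :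
    D.aP p q k i =ᶠ[𝓝[≠] (p i)] D'.aP p q k i := by
  rcases hk.eq_or_lt with rfl | hk2
  · filter_upwards [he] with u hu
    simp [aP, hu]
  · obtain ⟨r, rfl⟩ := Nat.exists_eq_add_of_le' hk2
    have hT := truncA_eq (r := r) le_rfl hD hD' h
    filter_upwards [he, resAp_eventuallyEq hD hD' h hT i, h.eps_punctured i le_rfl hk2]
      with u h1 h2 h3
    rw [aP, aP, if_neg (by omega), if_neg (by omega), h1, h3, aN_eq hk2 hD hD' h]
    simp only [Nat.succ_eq_add_one, Nat.add_succ_sub_one, h2]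

lemma aQ_eventuallyEq {k : ℕ} (hk : 1 ≤ k) (hD : D.IsRegular p q) (hD' : D'.IsRegular p q)
    (h : AgreeBelow D D' p q k) {j : Fin m}
    (he : coeffX k (D.sig j) =ᶠ[𝓝[≠] (q j)] coeffX k (D'.sig j)) :
    D.aQ p q k j =ᶠ[𝓝[≠] (q j)] D'.aQ p q k j := by
  rcases hk.eq_or_lt with rfl | hk2
  · filter_upwards [he] with u hu
    simp [aQ, hu]
  · obtain ⟨r, rfl⟩ := Nat.exists_eq_add_of_le' hk2
    have hT := truncA_eq (r := r) le_rfl hD hD' h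
    filter_upwards [he, resAq_eventuallyEq hD hD' h hT j, h.sig_punctured j le_rfl hk2]
      with u h1 h2 h3
    rw [aQ, aQ, if_neg (by omega), if_neg (by omega), h1, h3, aN_eq hk2 hD hD' h]
    simp only [Nat.succ_eq_add_one, Nat.add_succ_sub_one, h2]

/-- Once `ε_{i,k}` is fixed, only the explicit term `s_{i,k}` and `b_{n,k}` can vary. -/
lemma bP_sub {k : ℕ} (hk : 2 ≤ k) (hD : D.IsRegular p q) (hD' : D'.IsRegular p q)
    (h : AgreeBelow D D' p q k) {i : Fin (n + 1)}
    (he : coeffX k (D.eps i) =ᶠ[𝓝[≠] (p i)] coeffX k (D'.eps i)) :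
    ∀ᶠ u in 𝓝[≠] (p i), D.bP p q k i u - D'.bP p q k i u =
      (taylorCoeff k (D.s i) 0 - taylorCoeff k (D'.s i) 0)
        + coeffX 1 (D.eps i) u ^ k * (D.bN p q k u - D'.bN p q k u) := by
  obtain ⟨r, rfl⟩ := Nat.exists_eq_add_of_le' hk
  have hT := truncB_eq (r := r) le_rfl hD hD' h
  filter_upwards [he, resBp_eventuallyEq hk hD hD' h hT i, h.eps_punctured i le_rfl hk]
    with u h1 h2 h3
  rw [bP, bP, if_neg (by omega), if_neg (by omega), h1, h3, bOne_eq hk h]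
  simp only [Nat.add_succ_sub_one, h2]
  ring

lemma bQ_sub {k : ℕ} (hk : 2 ≤ k) (hD : D.IsRegular p q) (hD' : D'.IsRegular p q)
    (h : AgreeBelow D D' p q k) {j : Fin m}
    (he : coeffX k (D.sig j) =ᶠ[𝓝[≠] (q j)] coeffX k (D'.sig j)) :
    ∀ᶠ u in 𝓝[≠] (q j), D.bQ p q k j u - D'.bQ p q k j u =
      (taylorCoeff k (D.z j) 0 - taylorCoeff k (D'.z j) 0) / deriv (D.g q j) u
        + coeffX 1 (D.sig j) u ^ k * (D.bN p q k u - D'.bN p q k u) := by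
  obtain ⟨r, rfl⟩ := Nat.exists_eq_add_of_le' hk
  have hT := truncB_eq (r := r) le_rfl hD hD' h
  filter_upwards [he, resBq_eventuallyEq hk hD hD' h hT j, h.sig_punctured j le_rfl hk,
    h.deriv_g j] with u h1 h2 h3 h4
  rw [bQ, bQ, if_neg (by omega), if_neg (by omega), h1, h3, ← h4, bOne_eq hk h]
  simp only [Nat.add_succ_sub_one, h2]
  ring

lemma bP_eventuallyEq {k : ℕ} (hk : 1 ≤ k) (hD : D.IsRegular p q) (hD' : D'.IsRegular p q)
    (h : AgreeBelow D D' p q (k + 1)) (i : Fin (n + 1)) :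
    D.bP p q k i =ᶠ[𝓝[≠] (p i)] D'.bP p q k i := by
  have he := h.eps_punctured i hk k.lt_succ_self
  rcases hk.eq_or_lt with rfl | hk2
  · filter_upwards [he] with u hu
    simp [bP, hu, h.s i 1 le_rfl one_lt_two, bOne_eq le_rfl h]
  · filter_upwards [bP_sub hk2 hD hD' (h.mono k.le_succ) he] with u hu
    rw [bN_eq hk2 hD hD' h, h.s i k hk k.lt_succ_self] at hu
    linear_combination hu

lemma bQ_eventuallyEq {k : ℕ} (hk : 1 ≤ k) (hD : D.IsRegular p q) (hD' : D'.IsRegular p q)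
    (h : AgreeBelow D D' p q (k + 1)) (j : Fin m) :
    D.bQ p q k j =ᶠ[𝓝[≠] (q j)] D'.bQ p q k j := by
  have he := h.sig_punctured j hk k.lt_succ_self
  rcases hk.eq_or_lt with rfl | hk2
  · filter_upwards [he, h.deriv_g j] with u hu hg
    simp [bQ, hu, hg, h.z j 1 le_rfl one_lt_two, bOne_eq le_rfl h]
  · filter_upwards [bQ_sub hk2 hD hD' (h.mono k.le_succ) he] with u hu
    rw [bN_eq hk2 hD hD' h, h.z j k hk k.lt_succ_self] at hu
    linear_combination hu

/-! ### The curves of tangencies in normal form -/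

/-- `D` consists of local models and normalizing transformations in `k`-normal form of some pair
of foliations of the classes under consideration. -/
def IsNormalized (D : NormalizingData n m) (p : Fin (n + 1) → ℂ) (q : Fin m → ℂ) (k : ℕ) : Prop :=
  ∃ (u₀ : ℂ) (h : (ℝ → ℂ) → ℂ → ℂ) (F G Fμ : ℂ × ℂ → ℂ × ℂ),
    MemN p u₀ h F ∧ MemD q D.I G ∧ MemN p u₀ h Fμ ∧ HasStraightSeparatrices p Fμ ∧
      D.IsNormalizing p q F G Fμ ∧ D.InNormalForm p q k

lemma InNormalForm.mono {k l : ℕ} (h : D.InNormalForm p q k) (hl : l ≤ k) :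
    D.InNormalForm p q l where
  n_first r h1 h2 := h.n_first r h1 (h2.trans hl)
  n_second r h1 h2 := h.n_second r h1 (h2.trans hl)
  p_first r h1 h2 := h.p_first r h1 (h2.trans hl)
  p_second r h1 h2 := h.p_second r h1 (h2.trans hl)
  q_first r h1 h2 := h.q_first r h1 (h2.trans hl)
  q_second r h1 h2 := h.q_second r h1 (h2.trans hl)

/-- The image under `H_{p_i}` of the curve of tangencies `u = p_i - λ_i x s_i'(x)` of the local
models at `p_i` is the graph of `π`. -/
def IsCurveP (D : NormalizingData n m) (p : Fin (n + 1) → ℂ) (i : Fin (n + 1)) (π : ℂ → ℂ) :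
    Prop :=
  AnalyticAt ℂ π 0 ∧ ∀ᶠ x in 𝓝 (0 : ℂ),
    π (D.Hp i (x, p i - D.lam i * x * deriv (D.s i) x)).1 =
      (D.Hp i (x, p i - D.lam i * x * deriv (D.s i) x)).2

/-- The image under `H_{q_j}` of the curve of tangencies `u = q_j` of the local models at `q_j` is
the graph of `π`. -/
def IsCurveQ (D : NormalizingData n m) (q : Fin m → ℂ) (j : Fin m) (π : ℂ → ℂ) : Prop :=
  AnalyticAt ℂ π 0 ∧ ∀ᶠ x in 𝓝 (0 : ℂ), π (D.Hq j (x, q j)).1 = (D.Hq j (x, q j)).2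

/-- The part of the coefficient `c_{p_i,k}` not accounted for by `s_{i,k}` and the `z_{j,k}`. -/
def remainderP (D : NormalizingData n m) (p : Fin (n + 1) → ℂ) (q : Fin m → ℂ)
    (i : Fin (n + 1)) (k : ℕ) (π : ℂ → ℂ) : ℂ :=
  taylorCoeff k π 0 - ((1 - k * D.lam i) * taylorCoeff k (D.s i) 0
    - ∑ j, taylorCoeff k (D.z j) 0 / (2 * (p i - q j)))

/-- The part of the coefficient `c_{q_j,k}` not accounted for by the `z_{l,k}`. -/
def remainderQ (D : NormalizingData n m) (q : Fin m → ℂ) (j : Fin m) (k : ℕ) (π : ℂ → ℂ) : ℂ :=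
  taylorCoeff k π 0 - (-(taylorCoeff k (D.z j) 0 / 2)
      * (k * deriv (coeffX 1 (D.sig j)) (q j) + iteratedDeriv 3 (D.g q j) (q j) / 4)
    - ∑ l ∈ Finset.univ.erase j, taylorCoeff k (D.z l) 0 / (2 * (q j - q l)))

lemma IsNormalizing.exists_curveP {F G Fμ : ℂ × ℂ → ℂ × ℂ} (h : D.IsNormalizing p q F G Fμ)
    (i : Fin (n + 1)) :
    ∃ π, IsTangencyBranch (blowUp (n - 1) F) (blowUp (m + 1) G) (p i) π ∧ D.IsCurveP p i π := by
  have hw : AnalyticAt ℂ (fun x => p i - D.lam i * x * deriv (D.s i) x) 0 :=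
    analyticAt_const.sub ((analyticAt_const.mul analyticAt_id).mul (h.s_analytic i).deriv)
  -- The determinant of `(λ_i x, u - p_i)` and `(1, -s_i')` is `-(u - p_i + λ_i x s_i')`.
  obtain ⟨π, hπ, hc⟩ := exists_isTangencyBranch (h.Hp_biholomorphism i) (h.Hp_divisor i)
    (h.Hp_F i) (h.Hp_G i) hw (by simp) (Eventually.of_forall fun y => by
      simp only [tangencyLocus, linField, modelGp, Set.mem_ofPred_eq]
      constructor <;> intro hy <;> linear_combination -hy)
  exact ⟨π, hπ, hπ.1, hc⟩

lemma IsNormalizing.exists_curveQ {F G Fμ : ℂ × ℂ → ℂ × ℂ} (h : D.IsNormalizing p q F G Fμ)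
    (hD : D.IsRegular p q) (j : Fin m) :
    ∃ π, IsTangencyBranch (blowUp (n - 1) F) (blowUp (m + 1) G) (q j) π ∧ D.IsCurveQ q j π := by
  obtain ⟨-, f, hf, hf2, -, hgf⟩ := hD.exists_deriv_g j
  -- The determinant of `(0, 1)` and `(g_j', -z_j')` is `-g_j' = -(u - q_j) f`, with `f` nonzero
  -- near `q_j`.
  obtain ⟨π, hπ, hc⟩ := exists_isTangencyBranch (w := fun _ => q j) (h.Hq_biholomorphism j)
    (h.Hq_divisor j) (h.Hq_F j) (h.Hq_G j) analyticAt_const rfl (by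
      have h1 : ∀ᶠ u in 𝓝 (q j), f u ≠ 0 :=
        hf.continuousAt.eventually_ne (by rw [hf2]; exact two_ne_zero)
      filter_upwards [(continuous_snd.tendsto ((0 : ℂ), q j)).eventually h1] with y hy
      simp only [tangencyLocus, modelGq, Set.mem_ofPred_eq, hgf]
      constructor
      · intro h0
        have h0' : (y.2 - q j) * f y.2 = 0 := by linear_combination -h0
        exact sub_eq_zero.1 ((mul_eq_zero.1 h0').resolve_right hy)
      · intro h0
        rw [h0]
        ring)
  exact ⟨π, hπ, hπ.1, hc⟩

/-- The operator `x d/dx` multiplies the coefficient of order `k` by `k`; this yields the term `-k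
λ_i s_{i,k}` of the theorem. -/
lemma isLittleO_model_curve {s s' : ℂ → ℂ} (hs : AnalyticAt ℂ s 0) (hs' : AnalyticAt ℂ s' 0)
    {k : ℕ} (hk : 1 ≤ k)
    (h : ∀ r, 1 ≤ r → r < k → taylorCoeff r s 0 = taylorCoeff r s' 0) (c lam : ℂ) :
    (fun x => (c - lam * x * deriv s x) - (c - lam * x * deriv s' x)
      - (-(k * lam * (taylorCoeff k s 0 - taylorCoeff k s' 0))) * x ^ k) =o[𝓝 0]
      fun x => x ^ k := by
  obtain ⟨l, rfl⟩ := Nat.exists_eq_add_of_le' hk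
  have key : ∀ (r : ℕ) (f : ℂ → ℂ), taylorCoeff r (deriv f) 0 = (r + 1) * taylorCoeff (r + 1) f 0 :=
    fun r f => by
      have : (r : ℂ) + 1 ≠ 0 := by exact_mod_cast r.succ_ne_zero
      rw [taylorCoeff_succ]
      field_simp
  have h1 := isLittleO_sub_of_taylorCoeff_eq (k := l) hs.deriv hs'.deriv fun r hr => by
    rw [key, key, h (r + 1) (by omega) (by omega)]
  rw [key, key] at h1
  refine ((((isBigO_refl (fun x : ℂ => x) (𝓝 0)).mul_isLittleO h1).const_mul_left
    (-lam))).congr (fun x => ?_) fun x => ?_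
  · push_cast
    ring
  · ring

lemma IsRegular.analyticAt_eps_one (hD : D.IsRegular p q) (i : Fin (n + 1)) :
    AnalyticAt ℂ (coeffX 1 (D.eps i)) (p i) :=
  analyticAt_coeffX (hD.eps_analytic i) 1

lemma IsNormalizing.analyticAt_Hp {F G Fμ : ℂ × ℂ → ℂ × ℂ} (h : D.IsNormalizing p q F G Fμ)
    (i : Fin (n + 1)) (r : ℕ) :
    AnalyticAt ℂ (coeffX r fun y => (D.Hp i y).1) (p i) ∧
      AnalyticAt ℂ (coeffX r fun y => (D.Hp i y).2) (p i) :=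
  ⟨analyticAt_coeffX (analyticAt_fst.comp (h.Hp_biholomorphism i).1) r,
    analyticAt_coeffX (analyticAt_snd.comp (h.Hp_biholomorphism i).1) r⟩

lemma IsNormalizing.analyticAt_Hq {F G Fμ : ℂ × ℂ → ℂ × ℂ} (h : D.IsNormalizing p q F G Fμ)
    (j : Fin m) (r : ℕ) :
    AnalyticAt ℂ (coeffX r fun y => (D.Hq j y).1) (q j) ∧
      AnalyticAt ℂ (coeffX r fun y => (D.Hq j y).2) (q j) :=
  ⟨analyticAt_coeffX (analyticAt_fst.comp (h.Hq_biholomorphism j).1) r,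
    analyticAt_coeffX (analyticAt_snd.comp (h.Hq_biholomorphism j).1) r⟩

lemma coeffX_one_Hp {F G Fμ : ℂ × ℂ → ℂ × ℂ} (h : D.IsNormalizing p q F G Fμ) {k : ℕ}
    (hk : 1 ≤ k) (hN : D.InNormalForm p q k) (hD : D.IsRegular p q) (i : Fin (n + 1)) :
    coeffX 1 (fun y => (D.Hp i y).1) (p i) = 1 := by
  rw [← hD.eps_one i]
  refine eq_of_tendsto_punctured (h.analyticAt_Hp i 1).1 (hN.p_first 1 le_rfl hk i) ?_
  have : D.aP p q 1 i = coeffX 1 (D.eps i) := by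
    ext u
    simp [aP]
  rw [this]
  exact (hD.analyticAt_eps_one i).continuousAt.tendsto.mono_left nhdsWithin_le_nhds

lemma coeffX_one_Hq {F G Fμ : ℂ × ℂ → ℂ × ℂ} (h : D.IsNormalizing p q F G Fμ) {k : ℕ}
    (hk : 1 ≤ k) (hN : D.InNormalForm p q k) (hD : D.IsRegular p q) (j : Fin m) :
    coeffX 1 (fun y => (D.Hq j y).1) (q j) = 1 := by
  rw [← hD.sig_one j]
  refine eq_of_tendsto_punctured (h.analyticAt_Hq j 1).1 (hN.q_first 1 le_rfl hk j) ?_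
  have : D.aQ p q 1 j = coeffX 1 (D.sig j) := by
    ext u
    simp [aQ]
  rw [this]
  exact (hD.analyticAt_sig_one j).continuousAt.tendsto.mono_left nhdsWithin_le_nhds

/-- No pole occurs because `p_i` differs from every `q_j`; moreover `ε_{i,1}(p_i) = 1`. -/
lemma IsRegular.tendsto_at_p (hD : D.IsRegular p q) (hpq : ∀ i j, p i ≠ q j)
    (i : Fin (n + 1)) (k : ℕ) (σ : ℂ) (ζ : Fin m → ℂ) :
    Tendsto (fun u => σ + coeffX 1 (D.eps i) u ^ k * -∑ j, ζ j / (2 * (u - q j))) (𝓝[≠] (p i))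
      (𝓝 (σ - ∑ j, ζ j / (2 * (p i - q j)))) := by
  have h1 : ContinuousAt (fun u => σ + coeffX 1 (D.eps i) u ^ k * -∑ j, ζ j / (2 * (u - q j)))
      (p i) := by
    refine continuousAt_const.add (((hD.analyticAt_eps_one i).continuousAt.pow k).mul
      (tendsto_finsetSum _ fun j _ => ?_ : ContinuousAt _ _).neg)
    exact (continuousAt_const.div (by fun_prop)
      (mul_ne_zero two_ne_zero (sub_ne_zero.2 (hpq i j))) :
      ContinuousAt (fun u => ζ j / (2 * (u - q j))) (p i))
  have h2 := h1.tendsto.mono_left (nhdsWithin_le_nhds (s := {p i}ᶜ))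
  simpa [hD.eps_one, sub_eq_add_neg] using h2

/-- The term `l = j` of the sum cancels the pole of `ζ_j / g_j'`; the other terms are continuous at
`q_j`. -/
lemma IsRegular.tendsto_at_q (hD : D.IsRegular p q) (hq : Function.Injective q)
    (j : Fin m) (k : ℕ) (ζ : Fin m → ℂ) :
    Tendsto (fun u => ζ j / deriv (D.g q j) u
      + coeffX 1 (D.sig j) u ^ k * -∑ l, ζ l / (2 * (u - q l))) (𝓝[≠] (q j))
      (𝓝 (-(ζ j / 2) * (k * deriv (coeffX 1 (D.sig j)) (q j)
        + iteratedDeriv 3 (D.g q j) (q j) / 4)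
        - ∑ l ∈ Finset.univ.erase j, ζ l / (2 * (q j - q l)))) := by
  obtain ⟨-, f, hf, hf2, hf3, hgf⟩ := hD.exists_deriv_g j
  have h1 := (tendsto_inv_sub_div (hD.analyticAt_sig_one j) (hD.sig_one j) hf hf2 hgf k).const_mul
    (ζ j)
  have h2 : ContinuousAt (fun u => coeffX 1 (D.sig j) u ^ k *
      -∑ l ∈ Finset.univ.erase j, ζ l / (2 * (u - q l))) (q j) := by
    refine ((hD.analyticAt_sig_one j).continuousAt.pow k).mul
      (tendsto_finsetSum _ fun l hl => ?_ : ContinuousAt _ _).neg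
    have : q j ≠ q l := fun e => (Finset.ne_of_mem_erase hl) (hq e).symm
    exact (continuousAt_const.div (by fun_prop)
      (mul_ne_zero two_ne_zero (sub_ne_zero.2 this)) :
      ContinuousAt (fun u => ζ l / (2 * (u - q l))) (q j))
  have h3 := h1.add (h2.tendsto.mono_left (nhdsWithin_le_nhds (s := {q j}ᶜ)))
  rw [hD.sig_one, hf3] at h3
  have h4 : ζ j * (-(k * deriv (coeffX 1 (D.sig j)) (q j)
      + iteratedDeriv 3 (D.g q j) (q j) / 2 / 2) / 2)
      + 1 ^ k * -∑ l ∈ Finset.univ.erase j, ζ l / (2 * (q j - q l)) =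
      -(ζ j / 2) * (k * deriv (coeffX 1 (D.sig j)) (q j)
        + iteratedDeriv 3 (D.g q j) (q j) / 4)
        - ∑ l ∈ Finset.univ.erase j, ζ l / (2 * (q j - q l)) := by
    rw [one_pow]
    ring
  rw [h4] at h3
  refine h3.congr fun u => ?_
  rw [← Finset.add_sum_erase _ _ (Finset.mem_univ j)]
  ring

/-! ### Remainders of the branch coefficients -/

lemma coeffX_snd (k : ℕ) (hk : 1 ≤ k) (u : ℂ) : coeffX k (fun y => y.2) u = 0 := by
  rw [coeffX, taylorCoeff, iteratedDeriv_const, if_neg (by omega), zero_div]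

lemma remainderP_one (hpq : ∀ i j, p i ≠ q j) (h : D.IsNormalized p q 1) {i : Fin (n + 1)}
    {π : ℂ → ℂ} (hπ : D.IsCurveP p i π) : D.remainderP p q i 1 π = 0 := by
  obtain ⟨u₀, h, F, G, Fμ, -, hG, -, -, hN, hNF⟩ := h
  have hD := hN.isRegular hG
  have hH := (hN.Hp_biholomorphism i).1
  have hb : coeffX 1 (fun y => (D.Hp i y).2) (p i) =
      taylorCoeff 1 (D.s i) 0 - ∑ j, taylorCoeff 1 (D.z j) 0 / (2 * (p i - q j)) := by
    refine eq_of_tendsto_punctured (hN.analyticAt_Hp i 1).2 (hNF.p_second 1 le_rfl le_rfl i) ?_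
    refine (hD.tendsto_at_p hpq i 1 _ _).congr fun u => ?_
    simp [bP, hD.bOne_apply]
  -- The reference map keeps the first component and replaces the second by `u`; with `s = 0` its
  -- branch is the constant `p_i`.
  have key := taylorCoeff_branch_sub (k := 1) (H' := fun y => ((D.Hp i y).1, y.2)) (c := p i)
    (w' := fun x => p i - D.lam i * x * deriv (fun _ => 0) x) (π' := fun _ => p i)
    hH ((analyticAt_fst.comp hH).prod analyticAt_snd) (hN.Hp_divisor i)
    (by filter_upwards [hN.Hp_divisor i] with u hu; simp [hu])
    (fun r _ _ => EventuallyEq.rfl) (fun r h1 h2 => absurd h2 (by omega)) rfl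
    (coeffX_one_Hp hN le_rfl hNF hD i)
    (analyticAt_const.sub ((analyticAt_const.mul analyticAt_id).mul (hD.s_analytic i).deriv))
    (by simpa using analyticAt_const) (by simp) (by simp)
    (isLittleO_model_curve (hD.s_analytic i) analyticAt_const le_rfl
      (fun r h1 h2 => absurd h2 (by omega)) (p i) (D.lam i))
    hπ.1 analyticAt_const hπ.2 (by simp)
  rw [coeffX_snd 1 le_rfl, hb] at key
  simp only [taylorCoeff_one, deriv_const] at key
  rw [remainderP]
  simp only [taylorCoeff_one]
  push_cast at key ⊢
  linear_combination key

/-- The branch coefficients differ by `ω + β`, with `ω = -k λ_i Δs_{i,k}` and `β = Δs_{i,k} - ∑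
Δz_{j,k} / (2 (p_i - q_j))`. This is the difference of the explicit parts. -/
lemma remainderP_eq {k : ℕ} (hk : 2 ≤ k) (hpq : ∀ i j, p i ≠ q j) (h : D.IsNormalized p q k)
    (h' : D'.IsNormalized p q k) (hA : AgreeBelow D D' p q k) {i : Fin (n + 1)}
    (he : coeffX k (D.eps i) =ᶠ[𝓝 (p i)] coeffX k (D'.eps i))
    {π π' : ℂ → ℂ} (hπ : D.IsCurveP p i π) (hπ' : D'.IsCurveP p i π') :
    D.remainderP p q i k π = D'.remainderP p q i k π' := by
  obtain ⟨u₀, h, F, G, Fμ, -, hG, -, -, hN, hNF⟩ := h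
  obtain ⟨u₀', h', F', G', Fμ', -, hG', -, -, hN', hNF'⟩ := h'
  have hD := hN.isRegular hG
  have hD' := hN'.isRegular hG'
  have hk1 : 1 ≤ k := by omega
  have he' := he.filter_mono (nhdsWithin_le_nhds (s := {p i}ᶜ))
  have hm : ∀ j, MeromorphicAt (D.polarB p q k j) (q j) := fun j =>
    meromorphicAt_polarB hk hD (hN.analyticAt_Hq j k).2 (hNF.q_second k hk1 le_rfl j)
  have hm' : ∀ j, MeromorphicAt (D'.polarB p q k j) (q j) := fun j =>
    meromorphicAt_polarB hk hD' (hN'.analyticAt_Hq j k).2 (hNF'.q_second k hk1 le_rfl j)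
  have hb : coeffX k (fun y => (D.Hp i y).2) (p i) - coeffX k (fun y => (D'.Hp i y).2) (p i) =
      (taylorCoeff k (D.s i) 0 - taylorCoeff k (D'.s i) 0)
        - ∑ j, (taylorCoeff k (D.z j) 0 - taylorCoeff k (D'.z j) 0) / (2 * (p i - q j)) := by
    refine eq_of_tendsto_punctured (f := coeffX k (fun y => (D.Hp i y).2)
      - coeffX k (fun y => (D'.Hp i y).2))
      ((hN.analyticAt_Hp i k).2.sub (hN'.analyticAt_Hp i k).2) ?_ (hD.tendsto_at_p hpq i k _ _)
    filter_upwards [hNF.p_second k hk1 le_rfl i, hNF'.p_second k hk1 le_rfl i,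
      bP_sub hk hD hD' hA he'] with u h1 h2 h3
    rw [Pi.sub_apply, h1, h2, h3, bN_sub hk hD hD' hA hm hm']
  have hlam : D'.lam i = D.lam i := by rw [hA.lam]
  have key := taylorCoeff_branch_sub (k := k) (hN.Hp_biholomorphism i).1
    (hN'.Hp_biholomorphism i).1 (hN.Hp_divisor i) (hN'.Hp_divisor i)
    (fun r h1 h2 => by
      have e : coeffX r (D.eps i) =ᶠ[𝓝[≠] (p i)] coeffX r (D'.eps i) := by
        rcases h2.eq_or_lt with rfl | h3
        · exact he'
        · exact hA.eps_punctured i h1 h3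
      exact EventuallyEq.trans (hNF.p_first r h1 h2 i) ((aP_eventuallyEq h1 hD hD' (hA.mono h2) e).trans
        (EventuallyEq.symm (hNF'.p_first r h1 h2 i))))
    (fun r h1 h2 => EventuallyEq.trans (hNF.p_second r h1 h2.le i)
      ((bP_eventuallyEq h1 hD hD' (hA.mono h2) i).trans
        (EventuallyEq.symm (hNF'.p_second r h1 h2.le i)))) hb
    (coeffX_one_Hp hN hk1 hNF hD i)
    (analyticAt_const.sub ((analyticAt_const.mul analyticAt_id).mul (hD.s_analytic i).deriv))
    (analyticAt_const.sub ((analyticAt_const.mul analyticAt_id).mul (hD'.s_analytic i).deriv))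
    (by simp) (by simp)
    (by
      simp only [hlam]
      exact isLittleO_model_curve (hD.s_analytic i) (hD'.s_analytic i) hk1 (hA.s i) (p i)
        (D.lam i))
    hπ.1 hπ'.1 hπ.2 hπ'.2
  rw [remainderP, remainderP, hlam]
  simp only [sub_div, Finset.sum_sub_distrib] at key
  linear_combination key

lemma remainderQ_one (hq : Function.Injective q) (h : D.IsNormalized p q 1) {j : Fin m}
    {π : ℂ → ℂ} (hπ : D.IsCurveQ q j π) : D.remainderQ q j 1 π = 0 := by
  obtain ⟨u₀, h, F, G, Fμ, -, hG, -, -, hN, hNF⟩ := h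
  have hD := hN.isRegular hG
  have hH := (hN.Hq_biholomorphism j).1
  have hb := eq_of_tendsto_punctured (hN.analyticAt_Hq j 1).2 (hNF.q_second 1 le_rfl le_rfl j)
    ((hD.tendsto_at_q hq j 1 fun l => taylorCoeff 1 (D.z l) 0).congr fun u => by
      simp [bQ, hD.bOne_apply])
  have key := taylorCoeff_branch_sub (k := 1) (H' := fun y => ((D.Hq j y).1, y.2)) (c := q j)
    (w := fun _ => q j) (w' := fun _ => q j) (ω := 0) (π' := fun _ => q j)
    hH ((analyticAt_fst.comp hH).prod analyticAt_snd) (hN.Hq_divisor j)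
    (by filter_upwards [hN.Hq_divisor j] with u hu; simp [hu])
    (fun r _ _ => EventuallyEq.rfl) (fun r h1 h2 => absurd h2 (by omega)) rfl
    (coeffX_one_Hq hN le_rfl hNF hD j) analyticAt_const analyticAt_const rfl rfl (by simp)
    hπ.1 analyticAt_const hπ.2 (by simp)
  rw [coeffX_snd 1 le_rfl, hb] at key
  have h0 : taylorCoeff 1 (fun _ : ℂ => q j) 0 = 0 := by simp [taylorCoeff_one]
  rw [h0] at key
  rw [remainderQ]
  linear_combination key

lemma remainderQ_eq {k : ℕ} (hk : 2 ≤ k) (hq : Function.Injective q) (h : D.IsNormalized p q k)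
    (h' : D'.IsNormalized p q k) (hA : AgreeBelow D D' p q k) {j : Fin m}
    (he : coeffX k (D.sig j) =ᶠ[𝓝 (q j)] coeffX k (D'.sig j))
    {π π' : ℂ → ℂ} (hπ : D.IsCurveQ q j π) (hπ' : D'.IsCurveQ q j π') :
    D.remainderQ q j k π = D'.remainderQ q j k π' := by
  obtain ⟨u₀, h, F, G, Fμ, -, hG, -, -, hN, hNF⟩ := h
  obtain ⟨u₀', h', F', G', Fμ', -, hG', -, -, hN', hNF'⟩ := h'
  have hD := hN.isRegular hG
  have hD' := hN'.isRegular hG'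
  have hk1 : 1 ≤ k := by omega
  have he' := he.filter_mono (nhdsWithin_le_nhds (s := {q j}ᶜ))
  have hm : ∀ j, MeromorphicAt (D.polarB p q k j) (q j) := fun j =>
    meromorphicAt_polarB hk hD (hN.analyticAt_Hq j k).2 (hNF.q_second k hk1 le_rfl j)
  have hm' : ∀ j, MeromorphicAt (D'.polarB p q k j) (q j) := fun j =>
    meromorphicAt_polarB hk hD' (hN'.analyticAt_Hq j k).2 (hNF'.q_second k hk1 le_rfl j)
  have hev : (coeffX k (fun y => (D.Hq j y).2) - coeffX k (fun y => (D'.Hq j y).2))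
      =ᶠ[𝓝[≠] (q j)] fun u =>
        (taylorCoeff k (D.z j) 0 - taylorCoeff k (D'.z j) 0) / deriv (D.g q j) u
          + coeffX 1 (D.sig j) u ^ k *
            -∑ l, (taylorCoeff k (D.z l) 0 - taylorCoeff k (D'.z l) 0) / (2 * (u - q l)) := by
    filter_upwards [hNF.q_second k hk1 le_rfl j, hNF'.q_second k hk1 le_rfl j,
      bQ_sub hk hD hD' hA he'] with u h1 h2 h3
    rw [Pi.sub_apply, h1, h2, h3, bN_sub hk hD hD' hA hm hm']
  have hb := eq_of_tendsto_punctured ((hN.analyticAt_Hq j k).2.sub (hN'.analyticAt_Hq j k).2)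
    hev (hD.tendsto_at_q hq j k fun l => taylorCoeff k (D.z l) 0 - taylorCoeff k (D'.z l) 0)
  have key := taylorCoeff_branch_sub (k := k) (w := fun _ => q j) (w' := fun _ => q j) (ω := 0)
    (hN.Hq_biholomorphism j).1
    (hN'.Hq_biholomorphism j).1 (hN.Hq_divisor j) (hN'.Hq_divisor j)
    (fun r h1 h2 => by
      have e : coeffX r (D.sig j) =ᶠ[𝓝[≠] (q j)] coeffX r (D'.sig j) := by
        rcases h2.eq_or_lt with rfl | h3
        · exact he'
        · exact hA.sig_punctured j h1 h3
      exact EventuallyEq.trans (hNF.q_first r h1 h2 j) ((aQ_eventuallyEq h1 hD hD' (hA.mono h2) e).trans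
        (EventuallyEq.symm (hNF'.q_first r h1 h2 j))))
    (fun r h1 h2 => EventuallyEq.trans (hNF.q_second r h1 h2.le j)
      ((bQ_eventuallyEq h1 hD hD' (hA.mono h2) j).trans
        (EventuallyEq.symm (hNF'.q_second r h1 h2.le j)))) hb
    (coeffX_one_Hq hN hk1 hNF hD j) analyticAt_const analyticAt_const rfl rfl (by simp)
    hπ.1 hπ'.1 hπ.2 hπ'.2
  -- As `k ≥ 2`, both `ς_{j,1}` and `g_j` are lower-order data, so the factor of `z_{j,k}` is the
  -- same on both sides.
  have hσ : deriv (coeffX 1 (D'.sig j)) (q j) = deriv (coeffX 1 (D.sig j)) (q j) :=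
    (hA.sig j 1 le_rfl hk).deriv_eq.symm
  have hg : iteratedDeriv 3 (D'.g q j) (q j) = iteratedDeriv 3 (D.g q j) (q j) :=
    ((hA.g j).iteratedDeriv_eq 3).symm
  rw [remainderQ, remainderQ, hσ, hg]
  simp only [sub_div, Finset.sum_sub_distrib] at key
  linear_combination key

/-! ### Definition of the functional transformations -/

/-- The number `v` is the remainder of order `k` of the curve of tangencies at `p_i` for some
normalized data with `ε_{i,k} = e` and data of lower order `d`. -/
def IsRemainderP (p : Fin (n + 1) → ℂ) (q : Fin m → ℂ) (i : Fin (n + 1)) (k : ℕ)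
    (e : Germ (𝓝 (p i)) ℂ) (d : LowerData p q k) (v : ℂ) : Prop :=
  ∃ (D : NormalizingData n m) (π : ℂ → ℂ), 1 ≤ k ∧ D.IsNormalized p q k ∧ D.IsCurveP p i π ∧
    ((coeffX k (D.eps i) : ℂ → ℂ) : Germ (𝓝 (p i)) ℂ) = e ∧ D.lowerData p q k = d ∧
    D.remainderP p q i k π = v

/-- The number `v` is the remainder of order `k` of the curve of tangencies at `q_j` for some
normalized data with `ς_{j,k} = e` and data of lower order `d`. -/
def IsRemainderQ (p : Fin (n + 1) → ℂ) (q : Fin m → ℂ) (j : Fin m) (k : ℕ)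
    (e : Germ (𝓝 (q j)) ℂ) (d : LowerData p q k) (v : ℂ) : Prop :=
  ∃ (D : NormalizingData n m) (π : ℂ → ℂ), 1 ≤ k ∧ D.IsNormalized p q k ∧ D.IsCurveQ q j π ∧
    ((coeffX k (D.sig j) : ℂ → ℂ) : Germ (𝓝 (q j)) ℂ) = e ∧ D.lowerData p q k = d ∧
    D.remainderQ q j k π = v

lemma isRemainderP_one (hpq : ∀ i j, p i ≠ q j) {i : Fin (n + 1)}
    {e : Germ (𝓝 (p i)) ℂ} {d : LowerData p q 1} {v : ℂ} (h : IsRemainderP p q i 1 e d v) :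
    v = 0 := by
  obtain ⟨D, π, -, hD, hπ, -, -, rfl⟩ := h
  exact remainderP_one hpq hD hπ

lemma isRemainderQ_one (hq : Function.Injective q) {j : Fin m}
    {e : Germ (𝓝 (q j)) ℂ} {d : LowerData p q 1} {v : ℂ} (h : IsRemainderQ p q j 1 e d v) :
    v = 0 := by
  obtain ⟨D, π, -, hD, hπ, -, -, rfl⟩ := h
  exact remainderQ_one hq hD hπ

/-- The remainder at `p_i` is determined by `ε_{i,k}` and the data of lower order. -/
lemma IsRemainderP.unique (hpq : ∀ i j, p i ≠ q j) {i : Fin (n + 1)} {k : ℕ}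
    {e : Germ (𝓝 (p i)) ℂ} {d : LowerData p q k} {v v' : ℂ} (h : IsRemainderP p q i k e d v)
    (h' : IsRemainderP p q i k e d v') : v = v' := by
  rcases eq_or_ne k 1 with rfl | hk1
  · rw [isRemainderP_one hpq h, isRemainderP_one hpq h']
  · obtain ⟨D, π, hk, hD, hπ, rfl, rfl, rfl⟩ := h
    obtain ⟨D', π', -, hD', hπ', he, hd, rfl⟩ := h'
    exact remainderP_eq (by omega) hpq hD hD' (agreeBelow_of_lowerData_eq hd.symm)
      (Germ.coe_eq.1 he.symm) hπ hπ'

/-- The remainder at `q_j` is determined by `ς_{j,k}` and the data of lower order. -/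
lemma IsRemainderQ.unique (hq : Function.Injective q) {j : Fin m} {k : ℕ}
    {e : Germ (𝓝 (q j)) ℂ} {d : LowerData p q k} {v v' : ℂ} (h : IsRemainderQ p q j k e d v)
    (h' : IsRemainderQ p q j k e d v') : v = v' := by
  rcases eq_or_ne k 1 with rfl | hk1
  · rw [isRemainderQ_one hq h, isRemainderQ_one hq h']
  · obtain ⟨D, π, hk, hD, hπ, rfl, rfl, rfl⟩ := h
    obtain ⟨D', π', -, hD', hπ', he, hd, rfl⟩ := h'
    exact remainderQ_eq (by omega) hq hD hD' (agreeBelow_of_lowerData_eq hd.symm)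
      (Germ.coe_eq.1 he.symm) hπ hπ'

open Classical in
/-- The value at `p_i` of the functional transformation `π_{p_i,k}`. -/
def remainderMapP (p : Fin (n + 1) → ℂ) (q : Fin m → ℂ) (i : Fin (n + 1)) (k : ℕ)
    (e : Germ (𝓝 (p i)) ℂ) (d : LowerData p q k) : ℂ :=
  -- The default `0` for unrealized data makes the map of order `1` vanish identically.
  if h : ∃ v, IsRemainderP p q i k e d v then h.choose else 0

open Classical in
/-- The value at `q_j` of the functional transformation `π_{q_j,k}`. -/
def remainderMapQ (p : Fin (n + 1) → ℂ) (q : Fin m → ℂ) (j : Fin m) (k : ℕ)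
    (e : Germ (𝓝 (q j)) ℂ) (d : LowerData p q k) : ℂ :=
  if h : ∃ v, IsRemainderQ p q j k e d v then h.choose else 0

lemma IsRemainderP.remainderMapP_eq (hpq : ∀ i j, p i ≠ q j) {i : Fin (n + 1)} {k : ℕ}
    {e : Germ (𝓝 (p i)) ℂ} {d : LowerData p q k} {v : ℂ} (h : IsRemainderP p q i k e d v) :
    remainderMapP p q i k e d = v := by
  have hex : ∃ v, IsRemainderP p q i k e d v := ⟨v, h⟩
  rw [remainderMapP, dif_pos hex]
  exact hex.choose_spec.unique hpq h

lemma IsRemainderQ.remainderMapQ_eq (hq : Function.Injective q) {j : Fin m} {k : ℕ}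
    {e : Germ (𝓝 (q j)) ℂ} {d : LowerData p q k} {v : ℂ} (h : IsRemainderQ p q j k e d v) :
    remainderMapQ p q j k e d = v := by
  have hex : ∃ v, IsRemainderQ p q j k e d v := ⟨v, h⟩
  rw [remainderMapQ, dif_pos hex]
  exact hex.choose_spec.unique hq h

lemma remainderMapP_one (hpq : ∀ i j, p i ≠ q j) (i : Fin (n + 1)) (e : Germ (𝓝 (p i)) ℂ)
    (d : LowerData p q 1) : remainderMapP p q i 1 e d = 0 := by
  by_cases h : ∃ v, IsRemainderP p q i 1 e d v
  · rw [remainderMapP, dif_pos h, isRemainderP_one hpq h.choose_spec]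
  · rw [remainderMapP, dif_neg h]

lemma remainderMapQ_one (hq : Function.Injective q) (j : Fin m) (e : Germ (𝓝 (q j)) ℂ)
    (d : LowerData p q 1) : remainderMapQ p q j 1 e d = 0 := by
  by_cases h : ∃ v, IsRemainderQ p q j 1 e d v
  · rw [remainderMapQ, dif_pos h, isRemainderQ_one hq h.choose_spec]
  · rw [remainderMapQ, dif_neg h]

end NormalizingData

end TangencyCurves

end

open TangencyCurves
theorem mainTheorem2 {n m : ℕ} (hn : 1 ≤ n) (p : Fin (n + 1) → ℂ) (q : Fin m → ℂ)
    (hp : Function.Injective p) (hq : Function.Injective q) (hpq : ∀ i j, p i ≠ q j) :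
    ∃ (Tp : (i : Fin (n + 1)) → (k : ℕ) → Germ (𝓝 (p i)) ℂ → LowerData p q k → ℂ → ℂ)
      (Tq : (j : Fin m) → (k : ℕ) → Germ (𝓝 (q j)) ℂ → LowerData p q k → ℂ → ℂ),
      (∀ i e d, Tp i 1 e d = 0) ∧ (∀ j e d, Tq j 1 e d = 0) ∧
      ∀ (u₀ : ℂ) (h : (ℝ → ℂ) → ℂ → ℂ) (F G Fμ : ℂ × ℂ → ℂ × ℂ) (D : NormalizingData n m),
        MemN p u₀ h F → MemD q D.I G → MemN p u₀ h Fμ → HasStraightSeparatrices p Fμ →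
        D.IsNormalizing p q F G Fμ → ∀ k₀ : ℕ, D.InNormalForm p q k₀ →
        (∀ i, ∃ π : ℂ → ℂ, IsTangencyBranch (blowUp (n - 1) F) (blowUp (m + 1) G) (p i) π ∧
          ∀ k, 1 ≤ k → k ≤ k₀ →
            AnalyticAt ℂ
              (Tp i k ((coeffX k (D.eps i) : ℂ → ℂ) : Germ (𝓝 (p i)) ℂ) (D.lowerData p q k))
              (p i) ∧
            taylorCoeff k π 0 =
              (1 - k * D.lam i) * taylorCoeff k (D.s i) 0
                - ∑ j, taylorCoeff k (D.z j) 0 / (2 * (p i - q j))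
                + Tp i k ((coeffX k (D.eps i) : ℂ → ℂ) : Germ (𝓝 (p i)) ℂ)
                    (D.lowerData p q k) (p i)) ∧
        (∀ j, ∃ π : ℂ → ℂ, IsTangencyBranch (blowUp (n - 1) F) (blowUp (m + 1) G) (q j) π ∧
          ∀ k, 1 ≤ k → k ≤ k₀ →
            AnalyticAt ℂ
              (Tq j k ((coeffX k (D.sig j) : ℂ → ℂ) : Germ (𝓝 (q j)) ℂ) (D.lowerData p q k))
              (q j) ∧
            taylorCoeff k π 0 =
              -(taylorCoeff k (D.z j) 0 / 2)
                  * (k * deriv (coeffX 1 (D.sig j)) (q j) + iteratedDeriv 3 (D.g q j) (q j) / 4)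
                - ∑ l ∈ Finset.univ.erase j, taylorCoeff k (D.z l) 0 / (2 * (q j - q l))
                + Tq j k ((coeffX k (D.sig j) : ℂ → ℂ) : Germ (𝓝 (q j)) ℂ)
                    (D.lowerData p q k) (q j)) := by
  -- Functions constant in `u`: only their values at `p_i` and `q_j` enter the formulas, and
  -- holomorphy is immediate.
  refine ⟨fun i k e d _ => NormalizingData.remainderMapP p q i k e d,
    fun j k e d _ => NormalizingData.remainderMapQ p q j k e d,
    fun i e d => funext fun _ => NormalizingData.remainderMapP_one hpq i e d,
    fun j e d => funext fun _ => NormalizingData.remainderMapQ_one hq j e d, ?_⟩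
  intro u₀ h F G Fμ D hF hG hFμ hsep hN k₀ hNF
  have hnorm : ∀ k ≤ k₀, D.IsNormalized p q k := fun k hk =>
    ⟨u₀, h, F, G, Fμ, hF, hG, hFμ, hsep, hN, hNF.mono hk⟩
  refine ⟨fun i => ?_, fun j => ?_⟩
  · obtain ⟨π, hπ, hc⟩ := hN.exists_curveP i
    refine ⟨π, hπ, fun k hk1 hk => ⟨analyticAt_const, ?_⟩⟩
    beta_reduce
    -- The given data themselves realize the remainder, and by uniqueness the chosen value is
    -- theirs.
    rw [NormalizingData.IsRemainderP.remainderMapP_eq hpq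
      ⟨D, π, hk1, hnorm k hk, hc, rfl, rfl, rfl⟩, NormalizingData.remainderP]
    ring
  · obtain ⟨π, hπ, hc⟩ := hN.exists_curveQ (hN.isRegular hG) j
    refine ⟨π, hπ, fun k hk1 hk => ⟨analyticAt_const, ?_⟩⟩
    beta_reduce
    rw [NormalizingData.IsRemainderQ.remainderMapQ_eq hq
      ⟨D, π, hk1, hnorm k hk, hc, rfl, rfl, rfl⟩, NormalizingData.remainderQ]
    ring
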